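/- Let $G(d,k)$ be the Grassmannian of $k$-dimensional linear subspaces of $\mathbb{R}^d$, with its normalized $O(d)$-invariant measure $\gamma^{(d,k)}$ (the image of the normalized Haar measure of $O(d)$ under $\theta\mapsto\theta(L_0)$ for any fixed $L_0\in G(d,k)$); $L^p(G(d,k))$ is taken with respect to this measure. For $L\in G(d,k)$, $a\in\mathbb{R}^d$ and $\delta>0$ let the plate $L_\delta(a)$ be the $\delta$-neighbourhood in $\mathbb{R}^d$ of $B(a,\tfrac12)\cap(a+L)$, and define $$\mathcal{M}^k_\delta[f](L)=\sup_{a\in\mathbb{R}^d}\frac{1}{|L_\delta(a)|}\int_{L_\delta(a)}|f(y)|\,dy,\qquad \mathcal{N}^k[f](L)=\sup_{x\in\mathbb{R}^d}\int_{x+L}|f(y)|\,dy,$$ where $dy$ in the second integral is $k$-dimensional Lebesgue measure on $x+L$; both take values in $[0,\infty]$. **Proposition.** Let $d,k$ be integers with $2\le k\le d$, let $2\le p<\infty$ and $\alpha\in\mathbb{R}$. Suppose that there is a constant $A$ such that $$\|\mathcal{M}^{k-1}_\delta f\|_{L^p(G(d-1,k-1))}\le A\,\delta^{-\alpha/p}\,\|f\|_{L^p(\mathbb{R}^{d-1})}$$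 for all $0<\delta<1$ and all $f\in L^p(\mathbb{R}^{d-1})$. Then there is a constant $C$, independent of $\delta$ and $f$, such that the following holds. 1. If $\alpha>1$, then for all $0<\delta<1$ and all $f\in L^p(\mathbb{R}^d)$ $$\|\mathcal{M}^k_\delta f\|_{L^p(G(d,k))}\le C\,\delta^{-(\alpha-1)/p}\,\|f\|_{L^p(\mathbb{R}^d)}.$$ 2. If $\alpha=1$, then for all $0<\delta<1$ and all $f\in L^p(\mathbb{R}^d)$ $$\|\mathcal{M}^k_\delta f\|_{L^p(G(d,k))}\le C\,\bigl(1+\log\tfrac1\delta\bigr)\,\|f\|_{L^p(\mathbb{R}^d)}.$$ 3. If $\alpha<1$, then for all $f\in L^p(\mathbb{R}^d)$ supported in the closed unit ball, $\mathcal{N}^k f$ is $\gamma^{(d,k)}$-a.e. equal to a measurable function and $$\|\mathcal{N}^k f\|_{L^p(G(d,k))}\le C\,\|f\|_{L^p(\mathbb{R}^d)}.$$ -/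

import Mathlib

open MeasureTheory
open scoped NNReal ENNReal

namespace KPlane

/-- Euclidean space `ℝ^d`, with the Euclidean norm and Lebesgue measure. -/
abbrev E (d : ℕ) : Type := EuclideanSpace ℝ (Fin d)

/-- The orthogonal group `O(d)`, with the operator norm topology. -/
abbrev O (d : ℕ) : Type := unitary (E d →L[ℝ] E d)

/-- `G(d,k)`, the set of `k`-dimensional linear subspaces of `ℝ^d`. -/
def Gr (d k : ℕ) : Type := {L : Submodule ℝ (E d) // Module.finrank ℝ L = k}

/-- The usual topology of `G(d,k)`: a subspace is identified with the orthogonal projection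
onto it. -/
noncomputable instance (d k : ℕ) : TopologicalSpace (Gr d k) :=
  TopologicalSpace.induced (fun L => L.1.starProjection) inferInstance

noncomputable instance (d k : ℕ) : MeasurableSpace (Gr d k) := borel _

instance (d k : ℕ) : BorelSpace (Gr d k) := ⟨rfl⟩

/-- The image `θ(L)` of a subspace `L ∈ G(d,k)` under `θ ∈ O(d)`. -/
noncomputable def rotate {d k : ℕ} (θ : O d) (L : Gr d k) : Gr d k :=
  ⟨L.1.map (Unitary.linearIsometryEquiv θ).toLinearEquiv.toLinearMap, by
    rw [LinearEquiv.finrank_map_eq]; exact L.2⟩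

instance (d : ℕ) : ContinuousStar (E d →L[ℝ] E d) :=
  ⟨(ContinuousLinearMap.adjoint (𝕜 := ℝ) (E := E d) (F := E d)).continuous⟩

instance (d : ℕ) : CompactSpace (O d) := by
  refine isCompact_iff_compactSpace (s := (unitary (E d →L[ℝ] E d) : Set (E d →L[ℝ] E d))).1 ?_
  refine Metric.isCompact_of_isClosed_isBounded isClosed_unitary ?_
  refine (Metric.isBounded_iff_subset_closedBall 0).2 ⟨1, fun θ hθ => ?_⟩
  rw [mem_closedBall_zero_iff]
  refine ContinuousLinearMap.opNorm_le_bound _ zero_le_one fun x => ?_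
  have := (Unitary.linearIsometryEquiv (⟨θ, hθ⟩ : O d)).norm_map x
  rw [one_mul]
  exact this.le

/-- The normalized Haar measure of `O(d)`. -/
noncomputable def haarO (d : ℕ) : Measure (O d) := Measure.haarMeasure ⊤

/-- The invariant probability measure `γ^{(d,k)}` on `G(d,k)`:
`γ(F) = haarO {θ | θ(L₀) ∈ F}` for any fixed `L₀ ∈ G(d,k)`.  (If `d < k`, then `G(d,k)` is empty,
and the measure is zero.) -/
noncomputable def gamma (d k : ℕ) : Measure (Gr d k) :=
  open Classical in
  if h : Nonempty (Gr d k) then (haarO d).map (fun θ => rotate θ h.some) else 0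

/-- The plate `L_δ(a)`: the `δ`-neighbourhood in `ℝ^d` of `B(a,1/2) ∩ (a + L)`. -/
def plate {d k : ℕ} (δ : ℝ) (L : Gr d k) (a : E d) : Set (E d) :=
  Metric.thickening δ (Metric.ball a (1 / 2) ∩ {x | x - a ∈ L.1})

/-- The maximal function `M^k_δ[f](L)`, the supremum of the averages of `|f|` over the plates
`L_δ(a)`, `a ∈ ℝ^d`. -/
noncomputable def maxM {d k : ℕ} (δ : ℝ) (f : E d → ℝ) (L : Gr d k) : ℝ≥0∞ :=
  ⨆ a : E d, (volume (plate δ L a))⁻¹ * ∫⁻ y in plate δ L a, ‖f y‖ₑ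

/-- `k`-dimensional Lebesgue measure on a subspace `L ∈ G(d,k)`: the Haar measure that gives the
unit cube of an orthonormal basis of `L` measure one. -/
noncomputable def leb {d k : ℕ} (L : Gr d k) : Measure L.1 :=
  (stdOrthonormalBasis ℝ L.1).toBasis.addHaar

/-- The maximal function `N^k[f](L)`, the supremum of the integrals of `|f|` over all translates
`x + L` of `L`. -/
noncomputable def maxN {d k : ℕ} (f : E d → ℝ) (L : Gr d k) : ℝ≥0∞ :=
  ⨆ x : E d, ∫⁻ y : L.1, ‖f (x + (y : E d))‖ₑ ∂(leb L)

end KPlane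

namespace KPlane

open Filter Topology Set

/-! ### The action of O(d) on the Grassmannian and the invariant measure. -/

section Grassmannian

variable {d k : ℕ}

/-! Write d = n+1 and k = m+1. A random k-plane has the form θ(ℝe₀ + L) with θ Haar distributed in
O(n+1) and L distributed by `gamma n m` (`lintegral_gamma_lift`). Integrating f over a translate of
it amounts to integrating the X-ray transform `xray θ f`, a function on ℝ^n, over a translate of L.
At scale r the hypothesis controls the plate version of the latter with a loss r^(-α) in p-th
powers, while averaging the X-ray transform over θ gains a factor r on the part of f that lives at
scale r. This is why α turns into α - 1.

Let A_r be the averaging over balls of radius r, and D = A_r f - A_{2r} f. Then A_r² f - A_{2r}² f =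
(A_r + A_{2r}) D. The outer average thickens an m-plane to plates, so the integral of this
difference over a k-plane is bounded by the plate maximal functions of |xray θ D| at scales r and 2r
(`enorm_integral_plane_le`, `exists_supInt_succ_le`). The inner difference produces the gain. Indeed
the square of the L² norm of `xray θ g` in θ and y is bounded through the quadratic form in g with
kernel c|z|^(-n) (`lineMeasure_eq`, `Nice.lintegral_xray_sq_le`), and the averages of this kernel at
scales r and 2r differ by O(r) in L¹ (`exists_lintegral_rieszAvg_sub_le`); hence the bound C r ‖f‖₂²
of `exists_xray_sq_le`. Interpolation with the trivial L^∞ bound gives C r ‖f‖_p^p in p-th powers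
for all p ≥ 2 (`exists_xrayDiff_rpow_le`).

So the scale r contributes at most C r^(-(α-1)/p) ‖f‖_p, and telescoping over dyadic r from 1/2
downwards gives `PlateBound.exists_supInt_lavg_le`. The sum of these weights down to scale δ is
dominated by its last term if α > 1, counts the scales if α = 1, and is bounded if α < 1.

For plates, an average over a δ-plate is at most a constant times a plane integral of A_r²|f| with r
comparable to δ (`exists_supAvg_le_supInt`), and a lattice decomposition removes the restriction on
the support. For planes, r tends to 0: Fatou's lemma treats lower semicontinuous functions
(`PlateBound.exists_supInt_le`), and a general f is reached through lower semicontinuous majorants.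
-/

theorem norm_act (θ : O d) (x : E d) : ‖θ.1 x‖ = ‖x‖ :=
  (Unitary.linearIsometryEquiv θ).norm_map x

theorem star_act_act (θ : O d) (x : E d) : (star θ).1 (θ.1 x) = x :=
  (Unitary.linearIsometryEquiv θ).symm_apply_apply x

theorem act_star_act (θ : O d) (x : E d) : θ.1 ((star θ).1 x) = x :=
  (Unitary.linearIsometryEquiv θ).apply_symm_apply x

theorem mul_act (θ ρ : O d) (x : E d) : (θ * ρ).1 x = θ.1 (ρ.1 x) := rfl

theorem mem_rotate {θ : O d} {L : Gr d k} {x : E d} :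
    x ∈ (rotate θ L).1 ↔ ∃ y ∈ L.1, θ.1 y = x := Iff.rfl

theorem rotate_mul (θ ρ : O d) (L : Gr d k) : rotate (θ * ρ) L = rotate θ (rotate ρ L) := by
  refine Subtype.ext (Submodule.ext fun x => ?_)
  simp only [mem_rotate, mul_act]
  constructor
  · rintro ⟨y, hy, rfl⟩
    exact ⟨ρ.1 y, ⟨y, hy, rfl⟩, rfl⟩
  · rintro ⟨_, ⟨y, hy, rfl⟩, rfl⟩
    exact ⟨y, hy, rfl⟩

theorem inner_act (θ : O d) (x y : E d) : inner ℝ (θ.1 x) (θ.1 y) = inner ℝ x y :=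
  (Unitary.linearIsometryEquiv θ).inner_map_map x y

theorem starProjection_rotate (θ : O d) (L : Gr d k) :
    (rotate θ L).1.starProjection = θ.1 * L.1.starProjection * (star θ).1 := by
  ext1 x
  refine Submodule.eq_starProjection_of_mem_of_inner_eq_zero ?_ ?_
  · exact mem_rotate.2 ⟨_, Submodule.starProjection_apply_mem _ _, rfl⟩
  · intro w hw
    obtain ⟨y, hy, rfl⟩ := mem_rotate.1 hw
    have hx := act_star_act θ x
    rw [← hx]
    generalize (star θ).1 x = z at hx
    subst hx
    change inner ℝ (θ.1 z - θ.1 (L.1.starProjection ((star θ).1 (θ.1 z)))) _ = 0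
    rw [star_act_act, ← map_sub, inner_act]
    exact Submodule.starProjection_inner_eq_zero _ _ hy

theorem isInducing_starProjection :
    IsInducing (fun L : Gr d k => L.1.starProjection) := ⟨rfl⟩

instance : SecondCountableTopology (Gr d k) :=
  isInducing_starProjection.secondCountableTopology

instance : T2Space (Gr d k) := by
  refine T2Space.of_injective_continuous (f := fun L : Gr d k => L.1.starProjection) ?_
    isInducing_starProjection.continuous
  intro L L' h
  exact Subtype.ext (Submodule.starProjection_inj.1 h)

theorem continuous_rotate_prod :
    Continuous (fun q : O d × Gr d k => rotate q.1 q.2) := by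
  rw [isInducing_starProjection.continuous_iff]
  simp only [Function.comp_def, starProjection_rotate]
  refine ((continuous_subtype_val.comp continuous_fst).mul
    (isInducing_starProjection.continuous.comp continuous_snd)).mul ?_
  exact continuous_subtype_val.comp (continuous_star.comp continuous_fst)

theorem continuous_rotate (L : Gr d k) : Continuous (fun θ : O d => rotate θ L) :=
  continuous_rotate_prod.comp (continuous_id.prodMk continuous_const)

theorem exists_isometry (L : Gr d k) :
    ∃ U : E k →ₗᵢ[ℝ] E d, LinearMap.range U.toLinearMap = L.1 := by
  let e : E k ≃ₗᵢ[ℝ] L.1 :=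
    ((stdOrthonormalBasis ℝ L.1).reindex (finCongr L.2)).repr.symm
  refine ⟨L.1.subtypeₗᵢ.comp e.toLinearIsometry, ?_⟩
  ext x
  constructor
  · rintro ⟨y, rfl⟩
    exact (e y).2
  · intro hx
    exact ⟨e.symm ⟨x, hx⟩, by simp⟩

theorem exists_rotate_eq (L L' : Gr d k) : ∃ θ : O d, rotate θ L = L' := by
  let e : L.1 ≃ₗᵢ[ℝ] L'.1 :=
    ((stdOrthonormalBasis ℝ L.1).reindex (finCongr L.2)).repr.trans
    ((stdOrthonormalBasis ℝ L'.1).reindex (finCongr L'.2)).repr.symm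
  let W : E d →ₗᵢ[ℝ] E d := (L'.1.subtypeₗᵢ.comp e.toLinearIsometry).extend
  have hW : ∀ x : L.1, W x = e x := fun x => LinearIsometry.extend_apply _ x
  let W' : E d ≃ₗᵢ[ℝ] E d := W.toLinearIsometryEquiv rfl
  refine ⟨Unitary.linearIsometryEquiv.symm W', Subtype.ext (Submodule.ext fun x => ?_)⟩
  rw [mem_rotate]
  constructor
  · rintro ⟨y, hy, rfl⟩
    have : W y = e ⟨y, hy⟩ := hW ⟨y, hy⟩
    change W y ∈ _
    rw [this]
    exact (e _).2
  · intro hx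
    refine ⟨e.symm ⟨x, hx⟩, (e.symm _).2, ?_⟩
    change W _ = _
    rw [hW]
    simp

/-- An orbit map from the compact group onto the Hausdorff Grassmannian is closed, hence a quotient
map, so openness can be tested on O(d). All measurability of maximal functions comes from here. -/
theorem lowerSemicontinuous_of_rotate {F : Gr d k → ℝ≥0∞}
    (h : ∀ L, LowerSemicontinuous fun θ : O d => F (rotate θ L)) : LowerSemicontinuous F := by
  rcases isEmpty_or_nonempty (Gr d k) with hE | ⟨⟨L⟩⟩
  · exact fun x => isEmptyElim x
  have hq : IsQuotientMap (fun θ : O d => rotate θ L) :=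
    ((continuous_rotate L).isClosedMap).isQuotientMap (continuous_rotate L)
      (fun L' => exists_rotate_eq L L')
  rw [lowerSemicontinuous_iff_isOpen_preimage]
  intro c
  rw [← hq.isOpen_preimage]
  exact (h L).isOpen_preimage c

instance : (haarO d).IsHaarMeasure := by unfold haarO; infer_instance

instance : IsProbabilityMeasure (haarO d) := ⟨by
  have := Measure.haarMeasure_self (K₀ := (⊤ : TopologicalSpace.PositiveCompacts (O d)))
  simpa [haarO] using this⟩

/-- Compact groups are unimodular: a right translate of Haar measure is again a Haar probability
measure, and there is only one. -/
instance : (haarO d).IsMulRightInvariant := ⟨fun g => by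
  have h1 : (Measure.map (· * g) (haarO d)).IsHaarMeasure := inferInstance
  have h2 : IsProbabilityMeasure (Measure.map (· * g) (haarO d)) :=
    Measure.isProbabilityMeasure_map (by fun_prop)
  exact Measure.isHaarMeasure_eq_of_isProbabilityMeasure _ _⟩

/-- Right invariance absorbs the rotation that carries one base point to another. -/
theorem gamma_eq_map (L : Gr d k) : gamma d k = (haarO d).map (fun θ => rotate θ L) := by
  have hne : Nonempty (Gr d k) := ⟨L⟩
  rw [gamma, dif_pos hne]
  obtain ⟨ρ, hρ⟩ := exists_rotate_eq L hne.some
  simp_rw [← hρ, ← rotate_mul]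
  conv_rhs => rw [← map_mul_right_eq_self (haarO d) ρ]
  rw [Measure.map_map (continuous_rotate L).measurable (by fun_prop)]
  rfl

instance [Nonempty (Gr d k)] : IsProbabilityMeasure (gamma d k) := by
  rw [gamma_eq_map (Classical.arbitrary (Gr d k))]
  exact Measure.isProbabilityMeasure_map (continuous_rotate _).measurable.aemeasurable

theorem lintegral_gamma (L : Gr d k) {F : Gr d k → ℝ≥0∞} (hF : Measurable F) :
    ∫⁻ M, F M ∂gamma d k = ∫⁻ θ, F (rotate θ L) ∂haarO d := by
  rw [gamma_eq_map L, lintegral_map hF (continuous_rotate L).measurable]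

theorem nonempty_gr (h : k ≤ d) : Nonempty (Gr d k) := by
  have : k ≤ Module.finrank ℝ (E d) := by simpa using h
  obtain ⟨f, hf⟩ := exists_linearIndependent_of_le_finrank this
  exact ⟨⟨Submodule.span ℝ (Set.range f), by simpa using finrank_span_eq_card hf⟩⟩

end Grassmannian

/-! ### The splitting of ℝ^(n+1) into the first coordinate and ℝ^n, and the planes ℝe₀ + L. -/

section Cons

variable {n m : ℕ}

/-- The first coordinate vector. -/
noncomputable def e0 (n : ℕ) : E (n + 1) := EuclideanSpace.single 0 1

/-- The map that forgets the first coordinate. -/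
noncomputable def tailL (n : ℕ) : E (n + 1) →L[ℝ] E n :=
  LinearMap.toContinuousLinearMap
    { toFun := fun x => WithLp.toLp 2 (fun i => x i.succ)
      map_add' := fun _ _ => rfl
      map_smul' := fun _ _ => rfl }

/-- The embedding `y ↦ (0, y)`. -/
noncomputable def inclL (n : ℕ) : E n →L[ℝ] E (n + 1) :=
  LinearMap.toContinuousLinearMap
    { toFun := fun x => WithLp.toLp 2 (Fin.cons 0 x.ofLp)
      map_add' := fun x y => by ext i; refine Fin.cases ?_ (fun j => ?_) i <;> simp
      map_smul' := fun c y => by ext i; refine Fin.cases ?_ (fun j => ?_) i <;> simp }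

/-- The point `(t, y)`. -/
noncomputable def cons (t : ℝ) (y : E n) : E (n + 1) := t • e0 n + inclL n y

@[simp] theorem inclL_zero_apply (y : E n) : inclL n y 0 = 0 := rfl
@[simp] theorem inclL_succ_apply (y : E n) (i : Fin n) : inclL n y i.succ = y i := rfl
@[simp] theorem tailL_apply (x : E (n + 1)) (i : Fin n) : tailL n x i = x i.succ := rfl
@[simp] theorem cons_zero_apply (t : ℝ) (y : E n) : cons t y 0 = t := by simp [cons, e0]
@[simp] theorem cons_succ_apply (t : ℝ) (y : E n) (i : Fin n) : cons t y i.succ = y i := by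
  simp [cons, e0]

theorem cons_eq_toLp (t : ℝ) (y : E n) : cons t y = WithLp.toLp 2 (Fin.cons t y.ofLp) := by
  ext i; refine Fin.cases ?_ (fun j => ?_) i <;> simp

@[simp] theorem cons_head_tail (x : E (n + 1)) : cons (x 0) (tailL n x) = x := by
  ext i; refine Fin.cases ?_ (fun j => ?_) i <;> simp

@[simp] theorem tailL_cons (t : ℝ) (y : E n) : tailL n (cons t y) = y := by
  ext i; simp

theorem cons_add (s t : ℝ) (x y : E n) : cons (s + t) (x + y) = cons s x + cons t y := by
  simp only [cons, map_add, add_smul]; abel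

theorem cons_smul (c t : ℝ) (y : E n) : cons (c * t) (c • y) = c • cons t y := by
  simp [cons, mul_smul]

theorem norm_cons_sq (t : ℝ) (y : E n) : ‖cons t y‖ ^ 2 = t ^ 2 + ‖y‖ ^ 2 := by
  simp [EuclideanSpace.norm_sq_eq, Fin.sum_univ_succ]

theorem inner_cons (s t : ℝ) (x y : E n) :
    inner ℝ (cons s x) (cons t y) = s * t + inner ℝ x y := by
  simp [PiLp.inner_apply, Fin.sum_univ_succ, mul_comm]

theorem norm_le_norm_cons (t : ℝ) (y : E n) : ‖y‖ ≤ ‖cons t y‖ := by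
  have := norm_cons_sq t y
  exact (sq_le_sq₀ (norm_nonneg _) (norm_nonneg _)).1 (by nlinarith [sq_nonneg t])

theorem abs_le_norm_cons (t : ℝ) (y : E n) : |t| ≤ ‖cons t y‖ := by
  have := norm_cons_sq t y
  exact abs_le_of_sq_le_sq (by nlinarith [sq_nonneg ‖y‖]) (norm_nonneg _)

@[fun_prop]
theorem continuous_cons : Continuous fun q : ℝ × E n => cons q.1 q.2 := by
  unfold cons; fun_prop

theorem measurePreserving_cons :
    MeasurePreserving (fun q : ℝ × E n => cons q.1 q.2) (volume.prod volume) volume := by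
  have h1 : MeasurePreserving (fun q : ℝ × E n => (q.1, q.2.ofLp)) (volume.prod volume)
      (volume.prod volume) :=
    (MeasurePreserving.id _).prod (PiLp.volume_preserving_ofLp (Fin n))
  have h2 := (volume_preserving_piFinSuccAbove (fun _ : Fin (n + 1) => ℝ) 0).symm
  have h3 := (PiLp.volume_preserving_toLp (Fin (n + 1))).comp (h2.comp h1)
  have h4 : (fun q : ℝ × E n => cons q.1 q.2) = WithLp.toLp 2 ∘
      (MeasurableEquiv.piFinSuccAbove (fun _ => ℝ) 0).symm ∘ fun q => (q.1, q.2.ofLp) := by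
    funext q
    simp [cons_eq_toLp, MeasurableEquiv.piFinSuccAbove]
    rfl
  rw [h4]
  exact h3

/-- The space `ℝ e₀ + L`. -/
noncomputable def lift (L : Gr n m) : Gr (n + 1) (m + 1) :=
  ⟨L.1.comap (tailL n).toLinearMap, by
    have hs : Function.Surjective (tailL n).toLinearMap := fun y => ⟨cons 0 y, tailL_cons 0 y⟩
    have h1 := LinearMap.finrank_range_add_finrank_ker (tailL n).toLinearMap
    have h2 := ((tailL n).toLinearMap.domRestrict
      (L.1.comap (tailL n).toLinearMap)).finrank_range_add_finrank_ker
    have h3 : LinearMap.range ((tailL n).toLinearMap.domRestrict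
      (L.1.comap (tailL n).toLinearMap)) = L.1 := by
      rw [LinearMap.range_domRestrict, Submodule.map_comap_eq_of_surjective hs]
    have h4 : Module.finrank ℝ (LinearMap.ker ((tailL n).toLinearMap.domRestrict
      (L.1.comap (tailL n).toLinearMap))) =
        Module.finrank ℝ (LinearMap.ker (tailL n).toLinearMap) := by
      rw [LinearMap.ker_domRestrict]
      refine LinearEquiv.finrank_eq (Submodule.comapSubtypeEquivOfLe ?_)
      intro x hx
      simp only [LinearMap.mem_ker] at hx
      simp [Submodule.mem_comap, hx]
    rw [LinearMap.range_eq_top.2 hs] at h1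
    simp only [finrank_top, finrank_euclideanSpace, Fintype.card_fin] at h1
    rw [h3, h4, L.2] at h2
    omega⟩

theorem mem_lift {L : Gr n m} {x : E (n + 1)} : x ∈ (lift L).1 ↔ tailL n x ∈ L.1 := Iff.rfl

theorem starProjection_lift (L : Gr n m) (x : E (n + 1)) :
    (lift L).1.starProjection x = cons (x 0) (L.1.starProjection (tailL n x)) := by
  refine Submodule.eq_starProjection_of_mem_of_inner_eq_zero ?_ ?_
  · rw [mem_lift, tailL_cons]
    exact Submodule.starProjection_apply_mem _ _
  · intro w hw
    rw [mem_lift] at hw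
    have h0 := Submodule.starProjection_inner_eq_zero (K := L.1) (tailL n x) _ hw
    rw [← cons_head_tail w, inner_sub_left, inner_cons]
    nth_rw 1 [← cons_head_tail x]
    rw [inner_cons]
    rw [inner_sub_left] at h0
    linarith

theorem continuous_lift : Continuous (lift : Gr n m → Gr (n + 1) (m + 1)) := by
  rw [isInducing_starProjection.continuous_iff]
  have : ((fun L : Gr (n + 1) (m + 1) => L.1.starProjection) ∘ lift) = fun L : Gr n m =>
      ((EuclideanSpace.proj (𝕜 := ℝ) (0 : Fin (n + 1))).smulRight (e0 n)) +
        (inclL n).comp ((L.1.starProjection).comp (tailL n)) := by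
    funext L
    ext1 x
    simp only [Function.comp_apply, starProjection_lift]
    rfl
  rw [this]
  refine continuous_const.add ?_
  exact continuous_const.clm_comp
    (isInducing_starProjection.continuous.clm_comp continuous_const)

/-- For each fixed L the plane θ(ℝe₀ + L) already has distribution `gamma (n + 1) (m + 1)`, so
averaging over L as well changes nothing. The hypothesis on G(n,m) can then be applied for each θ.
-/
theorem lintegral_gamma_lift {F : Gr (n + 1) (m + 1) → ℝ≥0∞} (hF : Measurable F)
    [Nonempty (Gr n m)] :
    ∫⁻ M, F M ∂gamma (n + 1) (m + 1) =
      ∫⁻ θ, ∫⁻ L, F (rotate θ (lift L)) ∂gamma n m ∂haarO (n + 1) := by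
  rw [lintegral_lintegral_swap]
  · simp_rw [← lintegral_gamma _ hF]
    simp
  · refine (hF.comp ?_).aemeasurable
    exact (continuous_rotate_prod.comp
      (continuous_fst.prodMk (continuous_lift.comp continuous_snd))).measurable

end Cons

/-! ### Plane integrals and plate averages: semicontinuity in the plane. -/

section Planes

variable {d k : ℕ}

/-- This is Fatou's lemma. -/
theorem lowerSemicontinuous_lintegral {X Y : Type*} [TopologicalSpace X]
    [FirstCountableTopology X] [MeasurableSpace Y] {ν : Measure Y} {H : X → Y → ℝ≥0∞}
    (hm : ∀ x, Measurable (H x)) (hl : ∀ y, LowerSemicontinuous fun x => H x y) :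
    LowerSemicontinuous fun x => ∫⁻ y, H x y ∂ν := by
  rw [lowerSemicontinuous_iff_le_liminf]
  intro x
  refine le_trans (lintegral_mono fun y => ?_) (lintegral_liminf_le hm)
  exact (lowerSemicontinuous_iff_le_liminf.1 (hl y)) x

theorem lowerSemicontinuous_measure {X Y : Type*} [TopologicalSpace X]
    [FirstCountableTopology X] [MeasurableSpace Y] {ν : Measure Y} {S : X → Set Y}
    (hm : ∀ x, MeasurableSet (S x)) (ho : ∀ y, IsOpen {x | y ∈ S x}) :
    LowerSemicontinuous fun x => ν (S x) := by
  have : (fun x => ν (S x)) = fun x => ∫⁻ y, (S x).indicator 1 y ∂ν := by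
    funext x
    rw [lintegral_indicator_one (hm x)]
  rw [this]
  refine lowerSemicontinuous_lintegral (fun x => measurable_one.indicator (hm x)) fun y => ?_
  exact (ho y).lowerSemicontinuous_indicator (y := (1 : ℝ≥0∞)) zero_le_one

/-- A linear isometry onto `L` carries Lebesgue measure to Lebesgue measure on `L`. -/
theorem exists_measurePreserving {L : Gr d k} {U : E k →ₗᵢ[ℝ] E d}
    (hU : LinearMap.range U.toLinearMap = L.1) :
    ∃ e : E k ≃ₗᵢ[ℝ] L.1, MeasurePreserving e volume (leb L) ∧ ∀ v, ((e v : L.1) : E d) = U v := by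
  let W : E k →ₗᵢ[ℝ] L.1 :=
    { toLinearMap := U.toLinearMap.codRestrict L.1 fun v => hU ▸ ⟨v, rfl⟩
      norm_map' := fun v => U.norm_map v }
  let e : E k ≃ₗᵢ[ℝ] L.1 := W.toLinearIsometryEquiv (by simp [L.2])
  exact ⟨e, e.measurePreserving, fun v => rfl⟩

theorem lintegral_leb {L : Gr d k} {U : E k →ₗᵢ[ℝ] E d}
    (hU : LinearMap.range U.toLinearMap = L.1) (G : E d → ℝ≥0∞) :
    ∫⁻ y : L.1, G y ∂leb L = ∫⁻ v, G (U v) := by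
  obtain ⟨e, he, heU⟩ := exists_measurePreserving hU
  rw [← he.lintegral_comp_emb e.toHomeomorph.measurableEmbedding]
  simp only [heU]

/-- The supremum of the integrals of a nonnegative function over the translates of `L`. -/
noncomputable def supInt (G : E d → ℝ≥0∞) (L : Gr d k) : ℝ≥0∞ :=
  ⨆ x : E d, ∫⁻ y : L.1, G (x + (y : E d)) ∂leb L

theorem supInt_eq {L : Gr d k} {U : E k →ₗᵢ[ℝ] E d}
    (hU : LinearMap.range U.toLinearMap = L.1) (G : E d → ℝ≥0∞) :
    supInt G L = ⨆ x : E d, ∫⁻ v, G (x + U v) := by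
  unfold supInt
  congr 1
  funext x
  exact lintegral_leb hU fun y => G (x + y)

theorem supInt_mono {G G' : E d → ℝ≥0∞} (h : ∀ x, G x ≤ G' x) (L : Gr d k) :
    supInt G L ≤ supInt G' L :=
  iSup_mono fun _ => lintegral_mono fun _ => h _

theorem supInt_add_le {G G' : E d → ℝ≥0∞}
    (hG' : Measurable G') (L : Gr d k) :
    supInt (fun x => G x + G' x) L ≤ supInt G L + supInt G' L := by
  refine iSup_le fun x => ?_
  rw [lintegral_add_right _ (by fun_prop)]
  exact add_le_add (le_iSup (fun x : E d => ∫⁻ y : L.1, G (x + (y : E d)) ∂leb L) x)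
    (le_iSup (fun x : E d => ∫⁻ y : L.1, G' (x + (y : E d)) ∂leb L) x)

/-- The isometry `θ ∘ U`. -/
noncomputable def rotIso (θ : O d) (U : E k →ₗᵢ[ℝ] E d) : E k →ₗᵢ[ℝ] E d :=
  (Unitary.linearIsometryEquiv θ).toLinearIsometry.comp U

@[simp] theorem rotIso_apply (θ : O d) (U : E k →ₗᵢ[ℝ] E d) (v : E k) :
    rotIso θ U v = θ.1 (U v) := rfl

theorem range_rotIso {L : Gr d k} {U : E k →ₗᵢ[ℝ] E d}
    (hU : LinearMap.range U.toLinearMap = L.1) (θ : O d) :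
    LinearMap.range (rotIso θ U).toLinearMap = (rotate θ L).1 := by
  ext x
  rw [mem_rotate, ← hU]
  constructor
  · rintro ⟨v, rfl⟩
    exact ⟨U v, ⟨v, rfl⟩, rfl⟩
  · rintro ⟨_, ⟨v, rfl⟩, rfl⟩
    exact ⟨v, rfl⟩

@[fun_prop]
theorem continuous_act : Continuous fun q : O d × E d => q.1.1 q.2 := by
  have : Continuous fun q : O d × E d => (q.1.1, q.2) := by fun_prop
  exact isBoundedBilinearMap_apply.continuous.comp this

/-- One isometry U onto L parametrizes every θ(L) by θ ∘ U, so the integrals are taken against a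
fixed measure on ℝ^k and only the integrand depends on θ. -/
theorem lowerSemicontinuous_supInt {G : E d → ℝ≥0∞} (hG : LowerSemicontinuous G) :
    LowerSemicontinuous (supInt G : Gr d k → ℝ≥0∞) := by
  refine lowerSemicontinuous_of_rotate fun L => ?_
  obtain ⟨U, hU⟩ := exists_isometry L
  simp_rw [supInt_eq (range_rotIso hU _)]
  refine lowerSemicontinuous_iSup fun x => lowerSemicontinuous_lintegral (fun θ => ?_) fun v => ?_
  · exact hG.measurable.comp (by fun_prop)
  · exact hG.comp (show Continuous fun θ : O d => x + rotIso θ U v by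
      simp only [rotIso_apply]
      exact continuous_const.add (continuous_act.comp (continuous_id.prodMk continuous_const)))

theorem mem_plate {δ : ℝ} {L : Gr d k} {a y : E d} :
    y ∈ plate δ L a ↔ ∃ v ∈ L.1, ‖v‖ < 1 / 2 ∧ ‖y - a - v‖ < δ := by
  rw [plate, Metric.mem_thickening_iff]
  constructor
  · rintro ⟨z, ⟨hz1, hz2⟩, hz3⟩
    refine ⟨z - a, hz2, ?_, ?_⟩
    · rwa [mem_ball_iff_norm] at hz1
    · rwa [sub_sub_sub_cancel_right, ← dist_eq_norm]
  · rintro ⟨v, hv, h1, h2⟩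
    refine ⟨a + v, ⟨?_, ?_⟩, ?_⟩
    · simpa [mem_ball_iff_norm] using h1
    · simpa using hv
    · rwa [dist_eq_norm, ← sub_sub]

theorem mem_plate_iff {δ : ℝ} {L : Gr d k} {U : E k →ₗᵢ[ℝ] E d}
    (hU : LinearMap.range U.toLinearMap = L.1) {a y : E d} :
    y ∈ plate δ L a ↔ ∃ v : E k, ‖v‖ < 1 / 2 ∧ ‖y - a - U v‖ < δ := by
  rw [mem_plate, ← hU]
  constructor
  · rintro ⟨_, ⟨v, rfl⟩, h1, h2⟩
    exact ⟨v, by simpa using h1, h2⟩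
  · rintro ⟨v, h1, h2⟩
    exact ⟨U v, ⟨v, rfl⟩, by simpa using h1, h2⟩

theorem isOpen_plate {δ : ℝ} {L : Gr d k} {a : E d} : IsOpen (plate δ L a) :=
  Metric.isOpen_thickening

theorem volume_plate_eq (δ : ℝ) (L L' : Gr d k) (a b : E d) :
    volume (plate δ L a) = volume (plate δ L' b) := by
  have h1 : ∀ (L : Gr d k) (a : E d), volume (plate δ L a) = volume (plate δ L 0) := by
    intro L a
    have : plate δ L a = (fun x => -a + x) ⁻¹' plate δ L 0 := by
      ext y
      simp only [mem_plate, mem_preimage, sub_zero]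
      simp only [neg_add_eq_sub]
    rw [this, measure_preimage_add]
  rw [h1 L, h1 L']
  obtain ⟨θ, rfl⟩ := exists_rotate_eq L L'
  have hp : plate δ L 0 = (fun x => θ.1 x) ⁻¹' plate δ (rotate θ L) 0 := by
    ext y
    simp only [mem_plate, mem_preimage, sub_zero, mem_rotate]
    constructor
    · rintro ⟨v, hv, h1, h2⟩
      exact ⟨θ.1 v, ⟨v, hv, rfl⟩, by rwa [norm_act], by rwa [← map_sub, norm_act]⟩
    · rintro ⟨_, ⟨v, hv, rfl⟩, h1, h2⟩
      exact ⟨v, hv, by rwa [norm_act] at h1, by rwa [← map_sub, norm_act] at h2⟩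
  rw [hp]
  exact (Unitary.linearIsometryEquiv θ).measurePreserving.measure_preimage
    isOpen_plate.measurableSet.nullMeasurableSet

theorem ball_subset_plate {δ : ℝ} {L : Gr d k} {a : E d} : Metric.ball a δ ⊆ plate δ L a := by
  intro y hy
  rw [mem_plate]
  exact ⟨0, L.1.zero_mem, by norm_num, by simpa [dist_eq_norm] using hy⟩

theorem volume_plate_pos {δ : ℝ} (hδ : 0 < δ) (L : Gr d k) (a : E d) :
    0 < volume (plate δ L a) :=
  lt_of_lt_of_le (Metric.measure_ball_pos _ _ hδ) (measure_mono ball_subset_plate)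

theorem plate_subset_ball {δ : ℝ} {L : Gr d k} {a : E d} :
    plate δ L a ⊆ Metric.ball a (1 / 2 + δ) := by
  intro y hy
  obtain ⟨v, -, h1, h2⟩ := mem_plate.1 hy
  rw [mem_ball_iff_norm]
  calc ‖y - a‖ = ‖v + (y - a - v)‖ := by congr 1; abel
    _ ≤ ‖v‖ + ‖y - a - v‖ := norm_add_le _ _
    _ < _ := by linarith

/-- The maximal average over plates, for functions with values in `[0,∞]`. -/
noncomputable def supAvg (δ : ℝ) (G : E d → ℝ≥0∞) (L : Gr d k) : ℝ≥0∞ :=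
  ⨆ a : E d, (volume (plate δ L a))⁻¹ * ∫⁻ y in plate δ L a, G y

/-- The volume of a plate does not depend on the plane, and for fixed y the condition y ∈ `plate δ
(rotate θ L) a` is open in θ. Hence the mass of the plate under G dx is lower semicontinuous,
whatever G is. -/
theorem lowerSemicontinuous_supAvg {δ : ℝ} (hδ : 0 < δ) (G : E d → ℝ≥0∞) :
    LowerSemicontinuous (supAvg δ G : Gr d k → ℝ≥0∞) := by
  refine lowerSemicontinuous_of_rotate fun L => ?_
  refine lowerSemicontinuous_iSup fun a => ?_
  simp_rw [fun θ : O d => volume_plate_eq δ (rotate θ L) L a a]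
  refine (ENNReal.continuous_const_mul ?_).comp_lowerSemicontinuous ?_ ?_
  · exact ENNReal.inv_ne_top.2 (volume_plate_pos hδ L a).ne'
  · simp_rw [← withDensity_apply G (isOpen_plate (δ := δ) (a := a)).measurableSet]
    refine lowerSemicontinuous_measure (fun _ => isOpen_plate.measurableSet) fun y => ?_
    have : {θ : O d | y ∈ plate δ (rotate θ L) a} =
        ⋃ v ∈ {v ∈ (L.1 : Set (E d)) | ‖v‖ < 1 / 2}, {θ : O d | ‖y - a - θ.1 v‖ < δ} := by
      ext θ
      simp only [mem_ofPred_eq, mem_plate, mem_rotate, mem_iUnion, exists_prop]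
      constructor
      · rintro ⟨_, ⟨v, hv, rfl⟩, h1, h2⟩
        exact ⟨v, ⟨hv, by rwa [norm_act] at h1⟩, h2⟩
      · rintro ⟨v, ⟨hv, h1⟩, h2⟩
        exact ⟨θ.1 v, ⟨v, hv, rfl⟩, by rwa [norm_act], h2⟩
    rw [this]
    refine isOpen_biUnion fun v _ => ?_
    have hc : Continuous fun θ : O d => ‖y - a - θ.1 v‖ :=
      (continuous_const.sub (continuous_act.comp (continuous_id.prodMk continuous_const))).norm
    exact isOpen_lt hc continuous_const
  · exact fun x y h => mul_le_mul_right h _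

end Planes

/-! ### Plates have volume comparable to δ^(d-k). -/

section Volume

variable {d k : ℕ}

/-- The volume of the unit ball. -/
noncomputable def unitVol (n : ℕ) : ℝ≥0∞ := volume (Metric.ball (0 : E n) 1)

theorem unitVol_pos (n : ℕ) : unitVol n ≠ 0 := (Metric.measure_ball_pos _ _ one_pos).ne'

theorem unitVol_ne_top (n : ℕ) : unitVol n ≠ ∞ := measure_ball_lt_top.ne

theorem volume_ball_eq {n : ℕ} (x : E n) {r : ℝ} (hr : 0 < r) :
    volume (Metric.ball x r) = ENNReal.ofReal r ^ n * unitVol n := by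
  rw [Measure.addHaar_ball_of_pos _ _ hr, unitVol, ENNReal.ofReal_pow hr.le]
  simp

/-- The radius doubles because p need not lie in the range of U: the ball is centred at an arbitrary
point of the set. -/
theorem volume_norm_sub_lt_le (U : E k →ₗᵢ[ℝ] E d) (p : E d) {r : ℝ} (hr : 0 < r) :
    volume {v : E k | ‖p - U v‖ < r} ≤ ENNReal.ofReal (2 * r) ^ k * unitVol k := by
  rcases Set.eq_empty_or_nonempty {v : E k | ‖p - U v‖ < r} with h | ⟨v0, hv0⟩
  · simp [h]
  · rw [← volume_ball_eq v0 (by positivity)]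
    refine measure_mono fun v hv => ?_
    rw [mem_ball_iff_norm, ← U.norm_map, map_sub]
    calc ‖U v - U v0‖ = ‖(p - U v0) - (p - U v)‖ := by congr 1; abel
      _ ≤ _ := norm_sub_le _ _
      _ < _ := by simp only [mem_ofPred_eq] at hv hv0; linarith

/-- Tonelli for the pairs (u, v) with u close to a + Uv. Both bounds on the volume of a plate follow
by estimating the fibres over u, without orthogonal coordinates adapted to L. -/
theorem lintegral_volume_tube (U : E k →ₗᵢ[ℝ] E d) (a : E d) {ρ s : ℝ} (hs : 0 < s) :
    ∫⁻ u : E d, volume {v : E k | ‖v‖ < ρ ∧ ‖u - a - U v‖ < s} =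
      ENNReal.ofReal s ^ d * unitVol d * volume (Metric.ball (0 : E k) ρ) := by
  let S : Set (E d × E k) := {q | ‖q.2‖ < ρ ∧ ‖q.1 - a - U q.2‖ < s}
  have hS : MeasurableSet S := by
    apply IsOpen.measurableSet
    have c1 : Continuous fun q : E d × E k => ‖q.2‖ := by fun_prop
    have c2 : Continuous fun q : E d × E k => ‖q.1 - a - U q.2‖ := by fun_prop
    exact (isOpen_lt c1 continuous_const).inter (isOpen_lt c2 continuous_const)
  have h1 := Measure.prod_apply (μ := (volume : Measure (E d))) (ν := (volume : Measure (E k))) hS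
  have h2 := Measure.prod_apply_symm (μ := (volume : Measure (E d)))
    (ν := (volume : Measure (E k))) hS
  have h3 : ∀ v : E k, volume ((fun u => (u, v)) ⁻¹' S) =
      (Metric.ball (0 : E k) ρ).indicator (fun _ => ENNReal.ofReal s ^ d * unitVol d) v := by
    intro v
    by_cases hv : ‖v‖ < ρ
    · rw [indicator_of_mem (by simpa using hv), ← volume_ball_eq (a + U v) hs]
      congr 1
      ext u
      simp [S, hv, dist_eq_norm, sub_sub]
    · rw [indicator_of_notMem (by simpa using hv)]
      have : (fun u => (u, v)) ⁻¹' S = ∅ := by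
        ext u; simp [S, hv]
      rw [this, measure_empty]
  simp_rw [h3] at h2
  rw [lintegral_indicator_const Metric.isOpen_ball.measurableSet] at h2
  rw [← h2, h1]
  rfl

/-- Upper bound for the volume of a plate. -/
theorem exists_volume_plate_le (d k : ℕ) : ∃ C : ℝ≥0∞, C ≠ ∞ ∧ ∀ (δ : ℝ), 0 < δ → δ < 1 →
    ∀ (L : Gr d k) (a : E d),
    volume (plate δ L a) * ENNReal.ofReal δ ^ k ≤ C * ENNReal.ofReal δ ^ d := by
  refine ⟨(unitVol k)⁻¹ * (2 ^ d * unitVol d * volume (Metric.ball (0 : E k) 2)), ?_,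
    fun δ h0 h1 L a => ?_⟩
  · exact ENNReal.mul_ne_top (ENNReal.inv_ne_top.2 (unitVol_pos k))
      (ENNReal.mul_ne_top (ENNReal.mul_ne_top (by simp) (unitVol_ne_top d))
        measure_ball_lt_top.ne)
  obtain ⟨U, hU⟩ := exists_isometry L
  -- Over each u in the plate, the fibre of the tube of radius 2δ contains a whole δ-ball of
  -- parameters, inside the ball of radius 2 since 1/2 + δ < 2.
  have key : volume (plate δ L a) * (ENNReal.ofReal δ ^ k * unitVol k) ≤
      ENNReal.ofReal (2 * δ) ^ d * unitVol d * volume (Metric.ball (0 : E k) 2) := by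
    rw [← lintegral_volume_tube U a (ρ := 2) (by positivity : 0 < 2 * δ), mul_comm,
      ← lintegral_indicator_const isOpen_plate.measurableSet]
    refine lintegral_mono (indicator_le fun u hu => ?_)
    obtain ⟨v0, hv0, hu0⟩ := (mem_plate_iff hU).1 hu
    rw [← volume_ball_eq v0 h0]
    refine measure_mono fun v hv => ?_
    rw [mem_ball_iff_norm] at hv
    constructor
    · calc ‖v‖ = ‖v0 + (v - v0)‖ := by congr 1; abel
        _ ≤ _ := norm_add_le _ _
        _ < 2 := by linarith
    · calc ‖u - a - U v‖ = ‖(u - a - U v0) - U (v - v0)‖ := by rw [map_sub]; congr 1; abel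
        _ ≤ _ := norm_sub_le _ _
        _ < _ := by rw [U.norm_map]; linarith
  rw [ENNReal.ofReal_mul (by norm_num), mul_pow, ENNReal.ofReal_ofNat] at key
  calc volume (plate δ L a) * ENNReal.ofReal δ ^ k
      = (unitVol k)⁻¹ * (volume (plate δ L a) * (ENNReal.ofReal δ ^ k * unitVol k)) := by
        rw [show volume (plate δ L a) * (ENNReal.ofReal δ ^ k * unitVol k) =
          unitVol k * (volume (plate δ L a) * ENNReal.ofReal δ ^ k) by ring, ← mul_assoc,
          ENNReal.inv_mul_cancel (unitVol_pos k) (unitVol_ne_top k), one_mul]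
    _ ≤ _ := (mul_le_mul_right key _).trans_eq (by ring)

/-- Lower bound for the volume of a plate. -/
theorem exists_le_volume_plate (d k : ℕ) : ∃ C : ℝ≥0∞, C ≠ ∞ ∧ ∀ (δ : ℝ), 0 < δ →
    ∀ (L : Gr d k) (a : E d),
    ENNReal.ofReal δ ^ d ≤ C * ENNReal.ofReal δ ^ k * volume (plate δ L a) := by
  refine ⟨(unitVol d * volume (Metric.ball (0 : E k) (1 / 2)))⁻¹ * (2 ^ k * unitVol k), ?_,
    fun δ h0 L a => ?_⟩
  · refine ENNReal.mul_ne_top (ENNReal.inv_ne_top.2 (mul_ne_zero (unitVol_pos d) ?_))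
      (ENNReal.mul_ne_top (by simp) (unitVol_ne_top k))
    exact (Metric.measure_ball_pos _ _ (by norm_num)).ne'
  obtain ⟨U, hU⟩ := exists_isometry L
  -- Here the tube projects into the plate, and each fibre lies in a ball of radius 2δ.
  have key : ENNReal.ofReal δ ^ d * unitVol d * volume (Metric.ball (0 : E k) (1 / 2)) ≤
      (ENNReal.ofReal (2 * δ) ^ k * unitVol k) * volume (plate δ L a) := by
    rw [← lintegral_volume_tube U a (ρ := 1 / 2) h0,
      ← lintegral_indicator_const isOpen_plate.measurableSet]
    refine lintegral_mono fun u => ?_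
    by_cases hu : u ∈ plate δ L a
    · rw [indicator_of_mem hu]
      exact (measure_mono fun v hv => hv.2).trans (volume_norm_sub_lt_le U (u - a) h0)
    · have : {v : E k | ‖v‖ < 1 / 2 ∧ ‖u - a - U v‖ < δ} = ∅ := by
        ext v
        simp only [mem_ofPred_eq, mem_empty_iff_false, iff_false]
        exact fun hv => hu ((mem_plate_iff hU).2 ⟨v, hv⟩)
      rw [this, measure_empty]
      exact zero_le
  rw [ENNReal.ofReal_mul (by norm_num), mul_pow, ENNReal.ofReal_ofNat, mul_assoc] at key
  set W := unitVol d * volume (Metric.ball (0 : E k) (1 / 2)) with hW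
  have hW0 : W ≠ 0 := mul_ne_zero (unitVol_pos d) (Metric.measure_ball_pos _ _ (by norm_num)).ne'
  have hWt : W ≠ ∞ := ENNReal.mul_ne_top (unitVol_ne_top d) measure_ball_lt_top.ne
  calc ENNReal.ofReal δ ^ d = W⁻¹ * (ENNReal.ofReal δ ^ d * W) := by
        rw [mul_comm _ W, ← mul_assoc, ENNReal.inv_mul_cancel hW0 hWt, one_mul]
    _ ≤ _ := (mul_le_mul_right key _).trans_eq (by ring)

end Volume

/-! ### The class of functions on which signed integrals are manipulated. -/

section Nice

variable {d k n m : ℕ}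

/-- Measurable functions bounded by `Λ` that vanish outside the ball of radius `R`. -/
structure Nice (Λ R : ℝ) (f : E d → ℝ) : Prop where
  meas : Measurable f
  bound : ∀ x, |f x| ≤ Λ
  supp : ∀ x, R ≤ ‖x‖ → f x = 0

theorem integrable_of_bounded_of_supp {X : Type*} [MeasurableSpace X] {ν : Measure X}
    {f : X → ℝ} {S : Set X} {Λ : ℝ} (hf : Measurable f) (hb : ∀ x, |f x| ≤ Λ)
    (hs : ∀ x, x ∉ S → f x = 0) (hS : ν S ≠ ∞) : Integrable f ν := by
  have hsup : Function.support f ⊆ S := fun x hx => by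
    by_contra h
    exact hx (hs x h)
  rw [← integrableOn_iff_integrable_of_support_subset hsup]
  exact Measure.integrableOn_of_bounded hS hf.aestronglyMeasurable
    (ae_of_all _ fun x => (Real.norm_eq_abs _).trans_le (hb x))

namespace Nice

variable {Λ Λ' R R' : ℝ} {f g : E d → ℝ}

theorem nonneg (hf : Nice Λ R f) : 0 ≤ Λ := (abs_nonneg _).trans (hf.bound 0)

theorem integrable_comp_isometry (hf : Nice Λ R f) (U : E k →ₗᵢ[ℝ] E d) (x : E d) :
    Integrable fun v => f (x + U v) := by
  refine integrable_of_bounded_of_supp (S := Metric.ball 0 (R + ‖x‖))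
    (hf.meas.comp (by fun_prop)) (fun _ => hf.bound _) (fun v hv => hf.supp _ ?_)
    measure_ball_lt_top.ne
  have h1 : R + ‖x‖ ≤ ‖U v‖ := by simpa using hv
  have h2 : ‖U v‖ ≤ ‖x + U v‖ + ‖x‖ := by
    calc ‖U v‖ = ‖(x + U v) - x‖ := by congr 1; abel
      _ ≤ _ := norm_sub_le _ _
  linarith

theorem sub (hf : Nice Λ R f) (hg : Nice Λ' R' g) :
    Nice (Λ + Λ') (max R R') (fun x => f x - g x) where
  meas := hf.meas.sub hg.meas
  bound x := (abs_sub _ _).trans (add_le_add (hf.bound x) (hg.bound x))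
  supp x hx := by
    rw [hf.supp x ((le_max_left _ _).trans hx), hg.supp x ((le_max_right _ _).trans hx), sub_zero]

theorem mono (hf : Nice Λ R f) (h : Λ ≤ Λ') (h' : R ≤ R') : Nice Λ' R' f where
  meas := hf.meas
  bound x := (hf.bound x).trans h
  supp x hx := hf.supp x (h'.trans hx)

end Nice

end Nice

/-! ### Ball averages and the X-ray transform. -/

section Average

variable {d k n m : ℕ}

/-- The uniform probability measure on the ball of radius `r`. -/
noncomputable def unif (d : ℕ) (r : ℝ) : Measure (E d) :=
  (volume (Metric.ball (0 : E d) r))⁻¹ • volume.restrict (Metric.ball 0 r)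

theorem isProbabilityMeasure_unif (d : ℕ) {r : ℝ} (hr : 0 < r) :
    IsProbabilityMeasure (unif d r) := ⟨by
  simp only [unif, Measure.smul_apply, Measure.restrict_apply_univ, smul_eq_mul]
  exact ENNReal.inv_mul_cancel (Metric.measure_ball_pos _ _ hr).ne' measure_ball_lt_top.ne⟩

instance (d : ℕ) (r : ℝ) : IsFiniteMeasure (unif d r) := by
  rcases le_or_gt r 0 with h | h
  · have : Metric.ball (0 : E d) r = ∅ := Metric.ball_eq_empty.2 h
    rw [unif, this]
    simp only [Measure.restrict_empty, smul_zero]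
    infer_instance
  · have := isProbabilityMeasure_unif d h
    infer_instance

theorem ae_unif (d : ℕ) (r : ℝ) : ∀ᵐ z ∂unif d r, ‖z‖ < r := by
  refine Measure.ae_smul_measure ?_ _
  filter_upwards [ae_restrict_mem Metric.isOpen_ball.measurableSet] with z hz
  simpa using hz

theorem measurePreserving_unif (e : E d ≃ₗᵢ[ℝ] E d) (r : ℝ) :
    MeasurePreserving e (unif d r) (unif d r) := by
  have h := e.measurePreserving.restrict_preimage
    (Metric.isOpen_ball (x := (0 : E d)) (ε := r)).measurableSet
  have h2 : e ⁻¹' Metric.ball (0 : E d) r = Metric.ball 0 r := by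
    ext x; simp
  rw [h2] at h
  exact h.smul_measure _

theorem lintegral_unif (r : ℝ) (F : E d → ℝ≥0∞) :
    ∫⁻ z, F z ∂unif d r =
      (volume (Metric.ball (0 : E d) r))⁻¹ * ∫⁻ z in Metric.ball 0 r, F z := by
  rw [unif, lintegral_smul_measure, smul_eq_mul]

/-- The averages of `f` over balls of radius `r`. -/
noncomputable def avg (r : ℝ) (f : E d → ℝ) (x : E d) : ℝ := ∫ z, f (x + z) ∂unif d r

namespace Nice

variable {Λ Λ' R R' : ℝ} {f g : E d → ℝ}

theorem integrable_unif (hf : Nice Λ R f) (x : E d) (r : ℝ) :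
    Integrable (fun z => f (x + z)) (unif d r) :=
  Integrable.of_bound (hf.meas.comp (measurable_const_add x)).aestronglyMeasurable Λ
    (ae_of_all _ fun _ => (Real.norm_eq_abs _).trans_le (hf.bound _))

theorem avg (hf : Nice Λ R f) {r : ℝ} (hr : 0 < r) : Nice Λ (R + r) (avg r f) where
  meas := by
    have h : Measurable fun q : E d × E d => f (q.1 + q.2) := hf.meas.comp (by fun_prop)
    exact h.stronglyMeasurable.integral_prod_right'.measurable
  bound x := by
    have := isProbabilityMeasure_unif d hr
    refine (norm_integral_le_of_norm_le_const (C := Λ)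
      (ae_of_all _ fun _ => (Real.norm_eq_abs _).trans_le (hf.bound _))).trans ?_
    simp
  supp x hx := by
    refine integral_eq_zero_of_ae ?_
    filter_upwards [ae_unif d r] with z hz
    refine hf.supp _ ?_
    have : ‖x‖ ≤ ‖x + z‖ + ‖z‖ := by
      calc ‖x‖ = ‖(x + z) - z‖ := by congr 1; abel
        _ ≤ _ := norm_sub_le _ _
    linarith

theorem avg_sub (hf : Nice Λ R f) (hg : Nice Λ' R' g) (r : ℝ) (x : E d) :
    KPlane.avg r (fun x => f x - g x) x = KPlane.avg r f x - KPlane.avg r g x :=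
  integral_sub (hf.integrable_unif x r) (hg.integrable_unif x r)

theorem avg_comm (hf : Nice Λ R f) (r s : ℝ) (x : E d) :
    KPlane.avg r (KPlane.avg s f) x = KPlane.avg s (KPlane.avg r f) x := by
  unfold KPlane.avg
  rw [integral_integral_swap]
  · simp only [add_right_comm]
  · refine Integrable.of_bound (Measurable.aestronglyMeasurable ?_) Λ
      (ae_of_all _ fun _ => (Real.norm_eq_abs _).trans_le (hf.bound _))
    exact hf.meas.comp (by fun_prop)

end Nice

/-- The integrals of `g` over the lines `θ (ℝ e₀ + y)`. -/
noncomputable def xray (θ : O (n + 1)) (g : E (n + 1) → ℝ) (y : E n) : ℝ :=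
  ∫ t : ℝ, g (θ.1 (cons t y))

@[fun_prop]
theorem measurable_cons : Measurable fun q : ℝ × E n => cons q.1 q.2 :=
  continuous_cons.measurable

@[fun_prop]
theorem measurable_act : Measurable fun q : O d × E d => q.1.1 q.2 :=
  continuous_act.measurable

section

variable {Λ Λ' R R' : ℝ} {f g : E (n + 1) → ℝ}

theorem Nice.integrable_line (hg : Nice Λ R g) (θ : O (n + 1)) (y : E n) :
    Integrable fun t : ℝ => g (θ.1 (cons t y)) := by
  refine integrable_of_bounded_of_supp (S := Metric.ball 0 R) (hg.meas.comp ?_)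
    (fun _ => hg.bound _) (fun t ht => hg.supp _ ?_) measure_ball_lt_top.ne
  · exact θ.1.continuous.measurable.comp
      (measurable_cons.comp (measurable_id.prodMk measurable_const))
  · have h1 : R ≤ |t| := by simpa using ht
    rw [norm_act]
    exact h1.trans (abs_le_norm_cons t y)

theorem measurable_xray (hg : Measurable g) :
    Measurable fun q : O (n + 1) × E n => xray q.1 g q.2 := by
  have h : Measurable fun q : (O (n + 1) × E n) × ℝ => g (q.1.1.1 (cons q.2 q.1.2)) := by
    refine hg.comp (measurable_act.comp (Measurable.prodMk (by fun_prop) ?_))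
    exact measurable_cons.comp (measurable_snd.prodMk (measurable_snd.comp measurable_fst))
  exact h.stronglyMeasurable.integral_prod_right'.measurable

theorem Nice.xray (hg : Nice Λ R g) (hR : 0 ≤ R) (θ : O (n + 1)) :
    Nice (Λ * (2 * R)) R (xray θ g) where
  meas := (measurable_xray hg.meas).comp measurable_prodMk_left
  bound y := by
    have h0 : KPlane.xray θ g y = ∫ t in Metric.ball (0 : ℝ) R, g (θ.1 (cons t y)) := by
      refine (setIntegral_eq_integral_of_forall_compl_eq_zero fun t ht => hg.supp _ ?_).symm
      have h1 : R ≤ |t| := by simpa using ht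
      rw [norm_act]
      exact h1.trans (abs_le_norm_cons t y)
    rw [h0, ← Real.norm_eq_abs]
    refine (norm_setIntegral_le_of_norm_le_const (C := Λ) measure_ball_lt_top
      (fun t _ => (Real.norm_eq_abs _).trans_le (hg.bound _))).trans_eq ?_
    rw [Real.volume_real_ball hR]
  supp y hy := by
    refine integral_eq_zero_of_ae (ae_of_all _ fun t => hg.supp _ ?_)
    rw [norm_act]
    exact hy.trans (norm_le_norm_cons t y)

theorem Nice.xray_sub (hf : Nice Λ R f) (hg : Nice Λ' R' g) (θ : O (n + 1)) (y : E n) :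
    KPlane.xray θ (fun x => f x - g x) y = KPlane.xray θ f y - KPlane.xray θ g y :=
  integral_sub (hf.integrable_line θ y) (hg.integrable_line θ y)

/-- The uniform measure on the ball is rotation invariant, so the average can be taken after θ. The
e₀-component of the displacement z only translates the line parameter; what remains is an average of
`xray θ g` over the projections of z. -/
theorem Nice.enorm_xray_avg_le (hg : Nice Λ R g) {r : ℝ}
    (θ : O (n + 1)) (y : E n) :
    ‖KPlane.xray θ (KPlane.avg r g) y‖ₑ ≤
      ∫⁻ z, ‖KPlane.xray θ g (y + tailL n z)‖ₑ ∂unif (n + 1) r := by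
  have h1 : KPlane.xray θ (KPlane.avg r g) y =
      ∫ z, KPlane.xray θ g (y + tailL n z) ∂unif (n + 1) r := by
    unfold KPlane.xray KPlane.avg
    have hrot : ∀ t : ℝ, ∫ z, g (θ.1 (cons t y) + z) ∂unif (n + 1) r =
        ∫ z, g (θ.1 (cons t y + z)) ∂unif (n + 1) r := by
      intro t
      rw [← (measurePreserving_unif (Unitary.linearIsometryEquiv θ) r).integral_comp
        (Unitary.linearIsometryEquiv θ).toHomeomorph.measurableEmbedding]
      simp only [map_add]
      rfl
    simp_rw [hrot]
    rw [integral_integral_swap]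
    · refine integral_congr_ae (ae_of_all _ fun z => ?_)
      simp only
      rw [← integral_add_right_eq_self (fun t : ℝ => g (θ.1 (cons t (y + tailL n z)))) (z 0)]
      refine integral_congr_ae (ae_of_all _ fun t => ?_)
      simp only
      rw [cons_add, cons_head_tail]
    · have hm : Measurable fun q : ℝ × E (n + 1) => g (θ.1 (cons q.1 y + q.2)) := by
        refine hg.meas.comp (θ.1.continuous.measurable.comp (Measurable.add ?_ measurable_snd))
        exact measurable_cons.comp (measurable_fst.prodMk measurable_const)
      have : Integrable (fun q : ℝ × E (n + 1) => g (θ.1 (cons q.1 y + q.2)))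
          (volume.prod (unif (n + 1) r)) := by
        have hs : (volume.prod (unif (n + 1) r)) (Metric.ball (0 : ℝ) (R + r) ×ˢ univ) ≠ ∞ := by
          rw [Measure.prod_prod]
          exact ENNReal.mul_ne_top measure_ball_lt_top.ne (measure_ne_top _ _)
        have hae : (fun q : ℝ × E (n + 1) => g (θ.1 (cons q.1 y + q.2))) =ᵐ[
            volume.prod (unif (n + 1) r)]
            (Metric.ball (0 : ℝ) (R + r) ×ˢ univ).indicator
              (fun q : ℝ × E (n + 1) => g (θ.1 (cons q.1 y + q.2))) := by
          have : ∀ᵐ q ∂(volume : Measure ℝ).prod (unif (n + 1) r), ‖q.2‖ < r :=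
            Measure.quasiMeasurePreserving_snd.ae (ae_unif (n + 1) r)
          filter_upwards [this] with q hq
          by_cases hq1 : |q.1| < R + r
          · rw [indicator_of_mem (by simpa using hq1)]
          · rw [indicator_of_notMem (by simpa using hq1)]
            refine hg.supp _ ?_
            rw [norm_act]
            have h2 : ‖cons q.1 y‖ ≤ ‖cons q.1 y + q.2‖ + ‖q.2‖ := by
              calc ‖cons q.1 y‖ = ‖(cons q.1 y + q.2) - q.2‖ := by congr 1; abel
                _ ≤ _ := norm_sub_le _ _
            have := abs_le_norm_cons q.1 y
            linarith
        refine Integrable.congr ?_ hae.symm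
        rw [integrable_indicator_iff (by measurability)]
        exact Measure.integrableOn_of_bounded hs hm.aestronglyMeasurable
          (ae_of_all _ fun x => (Real.norm_eq_abs _).trans_le (hg.bound _))
      exact this
  rw [h1]
  exact enorm_integral_le_lintegral_enorm _

end

end Average

/-! ### Plane integrals of averages are controlled by plate averages of the X-ray transform. -/

section Domination

variable {d k n m : ℕ}

theorem ofReal_pow_ne_zero {r : ℝ} (hr : 0 < r) (n : ℕ) : ENNReal.ofReal r ^ n ≠ 0 :=
  pow_ne_zero _ (by simpa using hr)

theorem ofReal_pow_ne_top (r : ℝ) (n : ℕ) : ENNReal.ofReal r ^ n ≠ ∞ :=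
  ENNReal.pow_ne_top ENNReal.ofReal_ne_top

/-- The ball lies in the product of an interval of length 2r and a ball of ℝ^n, so the projection to
ℝ^n of the uniform measure has density at most a constant times r^(-n). -/
theorem lintegral_tail_unif_le (n : ℕ) {r : ℝ} (hr : 0 < r) {H : E n → ℝ≥0∞}
    (hH : Measurable H) :
    ENNReal.ofReal r ^ n * ∫⁻ z, H (tailL n z) ∂unif (n + 1) r ≤
      (unitVol (n + 1))⁻¹ * 2 * ∫⁻ w in Metric.ball 0 r, H w := by
  have key : ∫⁻ z in Metric.ball (0 : E (n + 1)) r, H (tailL n z) ≤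
      ENNReal.ofReal (2 * r) * ∫⁻ w in Metric.ball 0 r, H w := by
    rw [← lintegral_indicator Metric.isOpen_ball.measurableSet,
      ← lintegral_indicator Metric.isOpen_ball.measurableSet, ← Real.volume_ball 0,
      ← measurePreserving_cons.lintegral_comp]
    · calc ∫⁻ q : ℝ × E n, (Metric.ball (0 : E (n + 1)) r).indicator (fun z => H (tailL n z))
            (cons q.1 q.2) ∂(volume.prod volume)
          ≤ ∫⁻ q : ℝ × E n, (Metric.ball (0 : ℝ) r).indicator (fun _ => 1) q.1 *
            (Metric.ball 0 r).indicator H q.2 ∂(volume.prod volume) := by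
            refine lintegral_mono fun q => ?_
            by_cases hq : cons q.1 q.2 ∈ Metric.ball (0 : E (n + 1)) r
            · have hq' : ‖cons q.1 q.2‖ < r := by simpa using hq
              have h1 := (abs_le_norm_cons q.1 q.2).trans_lt hq'
              have h2 := (norm_le_norm_cons q.1 q.2).trans_lt hq'
              rw [indicator_of_mem hq, indicator_of_mem (by simpa using h1),
                indicator_of_mem (by simpa using h2), one_mul, tailL_cons]
            · rw [indicator_of_notMem hq]
              exact zero_le
        _ = _ := by
            rw [lintegral_prod_mul
              ((measurable_const.indicator Metric.isOpen_ball.measurableSet).aemeasurable)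
              ((hH.indicator Metric.isOpen_ball.measurableSet).aemeasurable),
              lintegral_indicator_const Metric.isOpen_ball.measurableSet, one_mul]
    · exact (hH.comp (by fun_prop)).indicator Metric.isOpen_ball.measurableSet
  rw [lintegral_unif, volume_ball_eq _ hr]
  set ρ := ENNReal.ofReal r with hρ
  have hρ0 : ρ ^ (n + 1) ≠ 0 := ofReal_pow_ne_zero hr _
  have hρt : ρ ^ (n + 1) ≠ ∞ := ofReal_pow_ne_top r _
  rw [ENNReal.ofReal_mul (by norm_num), ENNReal.ofReal_ofNat] at key
  calc ρ ^ n * ((ρ ^ (n + 1) * unitVol (n + 1))⁻¹ * _)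
      ≤ ρ ^ n * ((ρ ^ (n + 1) * unitVol (n + 1))⁻¹ * (2 * ρ * ∫⁻ w in Metric.ball 0 r, H w)) := by
        gcongr
    _ = ((ρ ^ (n + 1))⁻¹ * ρ ^ (n + 1)) *
          ((unitVol (n + 1))⁻¹ * 2 * ∫⁻ w in Metric.ball 0 r, H w) := by
        rw [ENNReal.mul_inv (Or.inl hρ0) (Or.inl hρt)]
        ring
    _ = _ := by rw [ENNReal.inv_mul_cancel hρ0 hρt, one_mul]

theorem setLIntegral_plate_le {δ : ℝ} (hδ : 0 < δ) (G : E d → ℝ≥0∞) (L : Gr d k) (a : E d) :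
    ∫⁻ y in plate δ L a, G y ≤ volume (plate δ L a) * supAvg δ G L := by
  have h1 := le_iSup (fun a : E d => (volume (plate δ L a))⁻¹ * ∫⁻ y in plate δ L a, G y) a
  have h0 := (volume_plate_pos hδ L a).ne'
  have ht : volume (plate δ L a) ≠ ∞ :=
    ((measure_mono plate_subset_ball).trans_lt measure_ball_lt_top).ne
  calc ∫⁻ y in plate δ L a, G y = volume (plate δ L a) * ((volume (plate δ L a))⁻¹ *
        ∫⁻ y in plate δ L a, G y) := by
        rw [← mul_assoc, ENNReal.mul_inv_cancel h0 ht, one_mul]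
    _ ≤ _ := by gcongr; exact h1

/-- Tonelli: each point u is counted with the measure of the parameters whose point of the plane is
within r of u. -/
theorem lintegral_lintegral_ball (U : E k →ₗᵢ[ℝ] E d) (y : E d) (r : ℝ) {h : E d → ℝ≥0∞}
    (hh : Measurable h) :
    ∫⁻ v : E k, ∫⁻ w in Metric.ball (0 : E d) r, h (y + U v + w) =
      ∫⁻ u : E d, h u * volume {v : E k | ‖u - y - U v‖ < r} := by
  have hS : MeasurableSet {q : E k × E d | ‖q.2 - y - U q.1‖ < r} := by
    have c1 : Continuous fun q : E k × E d => ‖q.2 - y - U q.1‖ := by fun_prop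
    exact (isOpen_lt c1 continuous_const).measurableSet
  calc _ = ∫⁻ v : E k, ∫⁻ u : E d,
        {q : E k × E d | ‖q.2 - y - U q.1‖ < r}.indicator (fun q => h q.2) (v, u) := by
        refine lintegral_congr fun v => ?_
        rw [← lintegral_indicator Metric.isOpen_ball.measurableSet]
        rw [← lintegral_add_left_eq_self _ (-(y + U v))]
        refine lintegral_congr fun u => ?_
        have : (-(y + U v) + u ∈ Metric.ball (0 : E d) r) ↔ ‖u - y - U v‖ < r := by
          rw [mem_ball_zero_iff, neg_add_eq_sub, sub_sub]
        by_cases hu : ‖u - y - U v‖ < r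
        · rw [indicator_of_mem (this.2 hu), indicator_of_mem (show (v, u) ∈ _ from hu),
            add_neg_cancel_left]
        · rw [indicator_of_notMem (fun hc => hu (this.1 hc)),
            indicator_of_notMem (show (v, u) ∉ _ from hu)]
    _ = ∫⁻ u : E d, ∫⁻ v : E k,
        {q : E k × E d | ‖q.2 - y - U q.1‖ < r}.indicator (fun q => h q.2) (v, u) := by
        rw [lintegral_lintegral_swap]
        exact ((hh.comp measurable_snd).indicator hS).aemeasurable
    _ = _ := by
        refine lintegral_congr fun u => ?_
        have : ∀ v : E k, {q : E k × E d | ‖q.2 - y - U q.1‖ < r}.indicator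
            (fun q => h q.2) (v, u) = {v : E k | ‖u - y - U v‖ < r}.indicator (fun _ => h u) v :=
          fun v => rfl
        simp_rw [this]
        exact lintegral_indicator_const (measurable_prodMk_right hS) _

/-- The left side is essentially r^(m-n) times the integral of h over the r-neighbourhood of y + L.
Inside the support of h that neighbourhood is covered by boundedly many plates, each of volume at
most a constant times r^(n-m). -/
theorem exists_plane_avg_le (n m : ℕ) {R : ℝ} :
    ∃ C : ℝ≥0∞, C ≠ ∞ ∧ ∀ r : ℝ, 0 < r → r < 1 → ∀ (L : Gr n m) (U : E m →ₗᵢ[ℝ] E n),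
      LinearMap.range U.toLinearMap = L.1 → ∀ h : E n → ℝ≥0∞, Measurable h →
      (∀ x, R ≤ ‖x‖ → h x = 0) → ∀ y : E n,
      ∫⁻ v : E m, ∫⁻ z, h (y + U v + tailL n z) ∂unif (n + 1) r ≤ C * supAvg r h L := by
  obtain ⟨C₂, hC₂, hplate⟩ := exists_volume_plate_le n m
  -- Two relevant points of the plane lie in the ball of radius R + 1, so their parameters differ by
  -- at most 2(R + 1). The covering radius 1/2 is the half-length of a plate.
  obtain ⟨S, -, hSfin, hS⟩ := (isCompact_closedBall (0 : E m) (2 * (R + 1))).finite_cover_balls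
    (show (0 : ℝ) < 1 / 2 by norm_num)
  refine ⟨(unitVol (n + 1))⁻¹ * 2 * (hSfin.toFinset.card * (2 ^ m * unitVol m * C₂)), ?_,
    fun r hr hr1 L U hU h hh hsupp y => ?_⟩
  · refine ENNReal.mul_ne_top (ENNReal.mul_ne_top
      (ENNReal.inv_ne_top.2 (unitVol_pos _)) (by simp)) ?_
    exact ENNReal.mul_ne_top (by simp)
      (ENNReal.mul_ne_top (ENNReal.mul_ne_top (by simp) (unitVol_ne_top m)) hC₂)
  set ρ := ENNReal.ofReal r with hρ
  have hρ0 : ρ ^ n ≠ 0 := ofReal_pow_ne_zero hr _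
  have hρt : ρ ^ n ≠ ∞ := ofReal_pow_ne_top r _
  have main : ∫⁻ u : E n, h u * volume {v : E m | ‖u - y - U v‖ < r} ≤
      hSfin.toFinset.card * (2 ^ m * unitVol m * C₂) * (ρ ^ n * supAvg r h L) := by
    -- Either the plane passes near the support and v0 serves as the centre of the covering, or the
    -- integrand vanishes.
    by_cases hne : ∃ v0 u0, ‖u0‖ < R ∧ ‖u0 - y - U v0‖ < r
    · obtain ⟨v0, u0, h1, h2⟩ := hne
      have hv0 : ‖y + U v0‖ < R + 1 := by
        calc ‖y + U v0‖ = ‖u0 - (u0 - y - U v0)‖ := by congr 1; abel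
          _ ≤ _ := norm_sub_le _ _
          _ < _ := by linarith
      calc ∫⁻ u : E n, h u * volume {v : E m | ‖u - y - U v‖ < r}
          ≤ ∫⁻ u : E n, ∑ s ∈ hSfin.toFinset,
            (2 ^ m * unitVol m * ρ ^ m) * (plate r L (y + U (v0 + s))).indicator h u := by
            refine lintegral_mono fun u => ?_
            by_cases hu : ‖u‖ < R
            · rcases Set.eq_empty_or_nonempty {v : E m | ‖u - y - U v‖ < r} with he | ⟨v, hv⟩
              · rw [he, measure_empty, mul_zero]
                exact zero_le
              · have hv' : ‖u - y - U v‖ < r := hv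
                have hv1 : ‖y + U v‖ < R + 1 := by
                  calc ‖y + U v‖ = ‖u - (u - y - U v)‖ := by congr 1; abel
                    _ ≤ _ := norm_sub_le _ _
                    _ < _ := by linarith
                have hvv : v - v0 ∈ Metric.closedBall (0 : E m) (2 * (R + 1)) := by
                  rw [mem_closedBall_zero_iff, ← U.norm_map]
                  calc ‖U (v - v0)‖ = ‖(y + U v) - (y + U v0)‖ := by
                        rw [map_sub]; congr 1; abel
                    _ ≤ _ := norm_sub_le _ _
                    _ ≤ _ := by linarith
                obtain ⟨s, hs, hsv⟩ := mem_iUnion₂.1 (hS hvv)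
                have hmem : u ∈ plate r L (y + U (v0 + s)) := by
                  rw [mem_plate_iff hU]
                  refine ⟨v - v0 - s, by rwa [mem_ball_iff_norm] at hsv, ?_⟩
                  convert hv' using 2
                  simp only [map_sub, map_add]; abel
                refine le_trans ?_ (Finset.single_le_sum (fun _ _ => zero_le)
                  (hSfin.mem_toFinset.2 hs))
                rw [indicator_of_mem hmem, mul_comm]
                gcongr
                refine (volume_norm_sub_lt_le U (u - y) hr).trans_eq ?_
                rw [ENNReal.ofReal_mul (by norm_num), mul_pow, ENNReal.ofReal_ofNat]
                ring
            · rw [hsupp u (not_lt.1 hu), zero_mul]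
              exact zero_le
        _ = ∑ s ∈ hSfin.toFinset, (2 ^ m * unitVol m * ρ ^ m) *
              ∫⁻ u in plate r L (y + U (v0 + s)), h u := by
            rw [lintegral_finsetSum]
            · refine Finset.sum_congr rfl fun s _ => ?_
              rw [lintegral_const_mul _ (hh.indicator isOpen_plate.measurableSet),
                lintegral_indicator isOpen_plate.measurableSet]
            · exact fun s _ => (hh.indicator isOpen_plate.measurableSet).const_mul _
        _ ≤ ∑ s ∈ hSfin.toFinset, (2 ^ m * unitVol m * C₂) * (ρ ^ n * supAvg r h L) := by
            refine Finset.sum_le_sum fun s _ => ?_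
            calc _ ≤ (2 ^ m * unitVol m * ρ ^ m) *
                  (volume (plate r L (y + U (v0 + s))) * supAvg r h L) := by
                  gcongr
                  exact setLIntegral_plate_le hr h L _
              _ = (2 ^ m * unitVol m) *
                  (volume (plate r L (y + U (v0 + s))) * ρ ^ m) * supAvg r h L := by ring
              _ ≤ (2 ^ m * unitVol m) * (C₂ * ρ ^ n) * supAvg r h L := by
                  exact mul_le_mul_left (mul_le_mul_right (hplate r hr hr1 L _) _) _
              _ = _ := by ring
        _ = _ := by rw [Finset.sum_const, nsmul_eq_mul]; ring
    · push Not at hne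
      have h0 : ∀ u : E n, h u * volume {v : E m | ‖u - y - U v‖ < r} = 0 := by
        intro u
        by_cases hu : ‖u‖ < R
        · have : {v : E m | ‖u - y - U v‖ < r} = ∅ := by
            ext v; simpa using hne v u hu
          rw [this, measure_empty, mul_zero]
        · rw [hsupp u (not_lt.1 hu), zero_mul]
      simp [h0]
  have h1 : ρ ^ n * ∫⁻ v : E m, ∫⁻ z, h (y + U v + tailL n z) ∂unif (n + 1) r ≤
      ρ ^ n * ((unitVol (n + 1))⁻¹ * 2 * (hSfin.toFinset.card * (2 ^ m * unitVol m * C₂)) *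
        supAvg r h L) := by
    rw [← lintegral_const_mul' _ _ hρt]
    calc _ ≤ ∫⁻ v : E m, (unitVol (n + 1))⁻¹ * 2 *
          ∫⁻ w in Metric.ball 0 r, h (y + U v + w) := by
          refine lintegral_mono fun v => ?_
          exact lintegral_tail_unif_le n hr (H := fun w => h (y + U v + w))
            (hh.comp (measurable_const_add _))
      _ = (unitVol (n + 1))⁻¹ * 2 * ∫⁻ u : E n, h u * volume {v : E m | ‖u - y - U v‖ < r} := by
          rw [lintegral_const_mul', lintegral_lintegral_ball U y r hh]
          exact ENNReal.mul_ne_top (ENNReal.inv_ne_top.2 (unitVol_pos _)) (by simp)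
      _ ≤ _ := (mul_le_mul_right main _).trans_eq (by ring)
  exact (ENNReal.mul_le_mul_iff_right hρ0 hρt).1 h1

/-- The isometry `(t, v) ↦ (t, U v)`. -/
noncomputable def consIso (U : E m →ₗᵢ[ℝ] E n) : E (m + 1) →ₗᵢ[ℝ] E (n + 1) where
  toFun w := cons (w 0) (U (tailL m w))
  map_add' x y := by simp only [map_add, ← cons_add]; rfl
  map_smul' c x := by
    simp only [map_smul, RingHom.id_apply]; rw [← cons_smul]; rfl
  norm_map' w := by
    change ‖cons (w 0) (U (tailL m w))‖ = ‖w‖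
    rw [← sq_eq_sq₀ (norm_nonneg _) (norm_nonneg _), norm_cons_sq, U.norm_map, ← norm_cons_sq,
      cons_head_tail]

@[simp] theorem consIso_cons (U : E m →ₗᵢ[ℝ] E n) (t : ℝ) (v : E m) :
    consIso U (cons t v) = cons t (U v) := by
  change cons _ _ = _
  simp

theorem range_consIso {L : Gr n m} {U : E m →ₗᵢ[ℝ] E n}
    (hU : LinearMap.range U.toLinearMap = L.1) :
    LinearMap.range (consIso U).toLinearMap = (lift L).1 := by
  ext x
  rw [mem_lift, ← hU]
  constructor
  · rintro ⟨w, rfl⟩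
    exact ⟨tailL m w, (tailL_cons _ _).symm⟩
  · rintro ⟨v, hv⟩
    refine ⟨cons (x 0) v, ?_⟩
    change consIso U _ = _
    rw [consIso_cons]
    have : U v = tailL n x := hv
    rw [this, cons_head_tail]

/-- Fubini with the e₀-direction integrated first; the offset s along that direction disappears by
translation. -/
theorem integral_plane_eq {Λ R : ℝ} {g : E (n + 1) → ℝ} (hg : Nice Λ R g) (θ : O (n + 1))
    (U : E m →ₗᵢ[ℝ] E n) (s : ℝ) (y : E n) :
    ∫ w, g (θ.1 (cons s y) + rotIso θ (consIso U) w) = ∫ v, xray θ g (y + U v) := by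
  have hi := hg.integrable_comp_isometry (rotIso θ (consIso U)) (θ.1 (cons s y))
  have hemb : Measurable (fun q : ℝ × E m => cons q.1 q.2) := measurable_cons
  rw [← measurePreserving_cons.map_eq] at hi ⊢
  have hi2 : Integrable (fun q : ℝ × E m => g (θ.1 (cons s y) +
      rotIso θ (consIso U) (cons q.1 q.2))) (volume.prod volume) := (integrable_map_measure hi.aestronglyMeasurable hemb.aemeasurable).1 hi
  rw [integral_map hemb.aemeasurable hi.aestronglyMeasurable]
  rw [integral_prod_symm _ hi2]
  refine integral_congr_ae (ae_of_all _ fun v => ?_)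
  simp only [rotIso_apply, consIso_cons, ← map_add, ← cons_add, xray]
  exact integral_add_left_eq_self (fun t => g (θ.1 (cons t (y + U v)))) s

theorem enorm_integral_plane_le {R : ℝ} (n m : ℕ) (hR : 0 ≤ R) :
    ∃ C : ℝ≥0∞, C ≠ ∞ ∧ ∀ r : ℝ, 0 < r → r < 1 → ∀ (L : Gr n m) (U : E m →ₗᵢ[ℝ] E n),
      LinearMap.range U.toLinearMap = L.1 → ∀ (Λ : ℝ) (g : E (n + 1) → ℝ), Nice Λ R g →
      ∀ (θ : O (n + 1)) (x : E (n + 1)),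
      ‖∫ w, avg r g (x + rotIso θ (consIso U) w)‖ₑ ≤
        C * supAvg r (fun y => ‖xray θ g y‖ₑ) L := by
  obtain ⟨C, hC, h⟩ := exists_plane_avg_le n m (R := R)
  refine ⟨C, hC, fun r hr hr1 L U hU Λ g hg θ x => ?_⟩
  have hx : x = θ.1 (cons (((star θ).1 x) 0) (tailL n ((star θ).1 x))) := by
    rw [cons_head_tail, act_star_act]
  rw [hx, integral_plane_eq (hg.avg hr)]
  refine (enorm_integral_le_lintegral_enorm _).trans ?_
  refine (lintegral_mono fun v => hg.enorm_xray_avg_le θ _).trans ?_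
  have hn := hg.xray hR θ
  refine h r hr hr1 L U hU (fun y => ‖xray θ g y‖ₑ) hn.meas.enorm (fun y hy => ?_) _
  rw [hn.supp y hy, enorm_zero]

end Domination

/-! ### Random lines through the origin and the kernel |z|^(-n). -/

section Polar

variable {n : ℕ}

theorem lintegral_norm (n : ℕ) {φ : ℝ → ℝ≥0∞} (hφ : Measurable φ) :
    ∫⁻ z : E (n + 1), φ ‖z‖ = (n + 1 : ℕ) * unitVol (n + 1) *
      ∫⁻ s in Ioi (0 : ℝ), ENNReal.ofReal (s ^ n) * φ s := by
  have h1 := ((volume : Measure (E (n + 1))).measurePreserving_homeomorphUnitSphereProd).lintegral_comp_emb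
    (Homeomorph.measurableEmbedding _) (fun q => φ q.2)
  simp only [homeomorphUnitSphereProd_apply_snd_coe] at h1
  have h0 : ∫⁻ z : E (n + 1), φ ‖z‖ = ∫⁻ z in ({0}ᶜ : Set (E (n + 1))), φ ‖z‖ := by
    rw [restrict_compl_singleton (μ := (volume : Measure (E (n + 1)))) 0]
  rw [h0, ← lintegral_subtype_comap (measurableSet_singleton (0 : E (n + 1))).compl, h1]
  have h2 : ∫⁻ q : Metric.sphere (0 : E (n + 1)) 1 × Ioi (0 : ℝ), φ q.2
      ∂((volume : Measure (E (n + 1))).toSphere.prod (Measure.volumeIoiPow (Module.finrank ℝ (E (n + 1)) - 1))) =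
      (volume : Measure (E (n + 1))).toSphere univ * ∫⁻ s : Ioi (0 : ℝ), φ s
        ∂(Measure.volumeIoiPow (Module.finrank ℝ (E (n + 1)) - 1)) := by
    have := lintegral_prod_mul (μ := (volume : Measure (E (n + 1))).toSphere)
      (ν := Measure.volumeIoiPow (Module.finrank ℝ (E (n + 1)) - 1))
      (f := fun _ => 1) (g := fun s : Ioi (0 : ℝ) => φ s) (by fun_prop)
      (hφ.comp measurable_subtype_coe).aemeasurable
    simpa using this
  rw [h2, Measure.toSphere_apply_univ, Measure.volumeIoiPow,
    lintegral_withDensity_eq_lintegral_mul _ (by fun_prop) (by fun_prop)]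
  simp only [finrank_euclideanSpace, Fintype.card_fin, Nat.add_sub_cancel, Pi.mul_apply]
  congr 1
  exact lintegral_subtype_comap measurableSet_Ioi (fun s => ENNReal.ofReal (s ^ n) * φ s)

theorem exists_act_eq {x y : E n} (h : ‖x‖ = ‖y‖) : ∃ θ : O n, θ.1 x = y :=
  ⟨Unitary.linearIsometryEquiv.symm (Submodule.reflection (ℝ ∙ (x - y))ᗮ),
    Submodule.reflection_sub h⟩

theorem norm_e0 (n : ℕ) : ‖e0 n‖ = 1 := by simp [e0]

/-- The density `‖z‖^(-n)` on `ℝ^(n+1)`. -/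
noncomputable def riesz (n : ℕ) (z : E (n + 1)) : ℝ := (‖z‖ ^ n)⁻¹

theorem riesz_nonneg (z : E (n + 1)) : 0 ≤ riesz n z := by unfold riesz; positivity

@[fun_prop]
theorem measurable_riesz : Measurable (riesz n) := by unfold riesz; fun_prop

/-- O(n+1) is transitive on spheres and Haar measure is right invariant, so the orbit average
depends on the norm of z only. -/
theorem lintegral_orbit_eq (F : E (n + 1) → ℝ≥0∞) (z : E (n + 1)) :
    ∫⁻ θ, F (θ.1 z) ∂haarO (n + 1) = ∫⁻ θ, F (θ.1 (‖z‖ • e0 n)) ∂haarO (n + 1) := by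
  obtain ⟨ρ, hρ⟩ := exists_act_eq (x := z) (y := ‖z‖ • e0 n) (by rw [norm_smul, norm_e0]; simp)
  rw [← hρ, ← lintegral_mul_right_eq_self (fun θ : O (n + 1) => F (θ.1 z)) ρ]
  rfl

/-- In polar coordinates the Jacobian s^n cancels |z|^(-n). The factor 2 appears because the
parameter s runs over the whole line while radii are positive; the orbit averages are even in s. -/
theorem lintegral_riesz {F : E (n + 1) → ℝ≥0∞} (hF : Measurable F) :
    2 * ∫⁻ z, ENNReal.ofReal (riesz n z) * F z = (n + 1 : ℕ) * unitVol (n + 1) *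
      ∫⁻ q : O (n + 1) × ℝ, F (q.2 • q.1.1 (e0 n)) ∂((haarO (n + 1)).prod volume) := by
  set Φ : ℝ → ℝ≥0∞ := fun s => ∫⁻ θ, F (θ.1 (s • e0 n)) ∂haarO (n + 1) with hΦ
  have hm : Measurable fun q : O (n + 1) × ℝ => F (q.1.1 (q.2 • e0 n)) :=
    hF.comp (measurable_act.comp (measurable_fst.prodMk (measurable_snd.smul_const _)))
  have hΦm : Measurable Φ := by
    exact hm.lintegral_prod_left'
  have hΦe : ∀ s, Φ s = Φ |s| := by
    intro s
    have := lintegral_orbit_eq F (s • e0 n)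
    rwa [norm_smul, norm_e0, mul_one, Real.norm_eq_abs] at this
  have h1 : ∫⁻ z, ENNReal.ofReal (riesz n z) * F z =
      ∫⁻ z : E (n + 1), ENNReal.ofReal ((‖z‖ ^ n)⁻¹) * Φ ‖z‖ := by
    have h2 : ∀ θ : O (n + 1), ∫⁻ z, ENNReal.ofReal (riesz n z) * F z =
        ∫⁻ z, ENNReal.ofReal (riesz n z) * F (θ.1 z) := by
      intro θ
      rw [← (Unitary.linearIsometryEquiv θ).measurePreserving.lintegral_comp_emb
        (Unitary.linearIsometryEquiv θ).toHomeomorph.measurableEmbedding]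
      refine lintegral_congr fun z => ?_
      change ENNReal.ofReal (riesz n (θ.1 z)) * F (θ.1 z) = _
      rw [riesz, norm_act, ← riesz]
    have h3 : ∫⁻ z, ENNReal.ofReal (riesz n z) * F z =
        ∫⁻ _ : O (n + 1), (∫⁻ z, ENNReal.ofReal (riesz n z) * F z) ∂haarO (n + 1) := by simp
    have h4 : Measurable fun q : O (n + 1) × E (n + 1) => F (q.1.1 q.2) := hF.comp measurable_act
    rw [h3, lintegral_congr h2, lintegral_lintegral_swap]
    · refine lintegral_congr fun z => ?_
      rw [lintegral_const_mul _ (show Measurable fun θ : O (n + 1) => F (θ.1 z) from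
        h4.comp measurable_prodMk_right), lintegral_orbit_eq]
      rfl
    · exact ((measurable_riesz.comp measurable_snd).ennreal_ofReal.mul h4).aemeasurable
  have h5 : ∫⁻ s in Ioi (0 : ℝ), ENNReal.ofReal (s ^ n) * (ENNReal.ofReal ((s ^ n)⁻¹) * Φ s) =
      ∫⁻ s in Ioi (0 : ℝ), Φ s := by
    refine setLIntegral_congr_fun measurableSet_Ioi fun s hs => ?_
    have hs' : 0 < s ^ n := pow_pos hs n
    rw [← mul_assoc, ← ENNReal.ofReal_mul hs'.le, mul_inv_cancel₀ hs'.ne', ENNReal.ofReal_one,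
      one_mul]
  have h6 : ∫⁻ s : ℝ, Φ s = 2 * ∫⁻ s in Ioi (0 : ℝ), Φ s := by
    rw [← lintegral_add_compl _ (measurableSet_Ioi (a := (0 : ℝ))), two_mul, compl_Ioi]
    congr 1
    rw [setLIntegral_congr Iio_ae_eq_Iic.symm]
    have hmp : MeasurePreserving (fun s : ℝ => -s) volume volume :=
      Measure.measurePreserving_neg _
    rw [← hmp.setLIntegral_comp_preimage_emb (MeasurableEquiv.neg ℝ).measurableEmbedding]
    simp only [neg_preimage, neg_Iio, neg_zero]
    refine lintegral_congr fun s => ?_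
    rw [hΦe, abs_neg, ← hΦe]
  rw [h1, lintegral_norm n (φ := fun s => ENNReal.ofReal ((s ^ n)⁻¹) * Φ s)
    (by fun_prop), h5, ← mul_assoc, mul_comm 2, mul_assoc, ← h6]
  congr 1
  rw [lintegral_prod_symm]
  · simp only [hΦ, map_smul]
  · simpa using hm.aemeasurable

/-- The distribution of `s θ e₀` under Haar measure in `θ` and Lebesgue measure in `s`. -/
noncomputable def lineMeasure (n : ℕ) : Measure (E (n + 1)) :=
  ((haarO (n + 1)).prod volume).map fun q : O (n + 1) × ℝ => q.2 • q.1.1 (e0 n)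

theorem measurable_smul_act :
    Measurable fun q : O (n + 1) × ℝ => q.2 • q.1.1 (e0 n) := by
  have : Measurable fun q : O (n + 1) × ℝ => q.1.1 (e0 n) :=
    measurable_act.comp (measurable_fst.prodMk measurable_const)
  fun_prop

theorem lineMeasure_ball (n : ℕ) (R : ℝ) :
    lineMeasure n (Metric.ball 0 R) = ENNReal.ofReal (2 * R) := by
  rw [lineMeasure, Measure.map_apply measurable_smul_act Metric.isOpen_ball.measurableSet]
  have : (fun q : O (n + 1) × ℝ => q.2 • q.1.1 (e0 n)) ⁻¹' Metric.ball 0 R =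
      univ ×ˢ Metric.ball (0 : ℝ) R := by
    ext q
    simp [norm_smul, norm_act, norm_e0]
  rw [this, Measure.prod_prod, measure_univ, one_mul, Real.volume_ball]

/-- The constant of proportionality between `lineMeasure` and the Riesz kernel. -/
noncomputable def rieszConst (n : ℕ) : ℝ := 2 / ((n + 1 : ℕ) * (unitVol (n + 1)).toReal)

theorem rieszConst_pos (n : ℕ) : 0 < rieszConst n := by
  have := ENNReal.toReal_pos (unitVol_pos (n + 1)) (unitVol_ne_top (n + 1))
  unfold rieszConst
  positivity

theorem lineMeasure_eq (n : ℕ) : lineMeasure n =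
    volume.withDensity fun z => ENNReal.ofReal (rieszConst n * riesz n z) := by
  refine Measure.ext_of_lintegral _ fun F hF => ?_
  rw [lineMeasure, lintegral_map hF measurable_smul_act,
    lintegral_withDensity_eq_lintegral_mul _ (by fun_prop) hF]
  simp only [Pi.mul_apply, ENNReal.ofReal_mul (rieszConst_pos n).le, mul_assoc]
  rw [lintegral_const_mul _ (by fun_prop)]
  have h := lintegral_riesz hF
  have hc : ENNReal.ofReal (rieszConst n) * ((n + 1 : ℕ) * unitVol (n + 1)) = 2 := by
    have h0 := ENNReal.toReal_pos (unitVol_pos (n + 1)) (unitVol_ne_top (n + 1))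
    rw [← ENNReal.ofReal_toReal (unitVol_ne_top (n + 1)), ← ENNReal.ofReal_natCast,
      ← ENNReal.ofReal_mul (by positivity), ← ENNReal.ofReal_mul (rieszConst_pos n).le, rieszConst,
      div_mul_cancel₀ _ (by positivity)]
    simp
  have h2 : ENNReal.ofReal (rieszConst n) * (2 * ∫⁻ z, ENNReal.ofReal (riesz n z) * F z) =
      2 * ∫⁻ q : O (n + 1) × ℝ, F (q.2 • q.1.1 (e0 n)) ∂((haarO (n + 1)).prod volume) := by
    rw [h, ← mul_assoc, hc]
  rw [mul_left_comm] at h2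
  exact ((ENNReal.mul_right_inj two_ne_zero ENNReal.ofNat_ne_top).1 h2).symm

end Polar

/-! ### Second differences of the Riesz kernel. -/

section Kernel

variable {n : ℕ}

theorem abs_pow_sub_one_sub_le (n : ℕ) {x : ℝ} (h0 : 0 ≤ x) (h2 : x ≤ 2) :
    |x ^ n - 1 - n * (x - 1)| ≤ n ^ 2 * 2 ^ n * (x - 1) ^ 2 := by
  induction n with
  | zero => simp
  | succ n ih =>
    have e : x ^ (n + 1) - 1 - (n + 1 : ℕ) * (x - 1) =
        x * (x ^ n - 1 - n * (x - 1)) + n * (x - 1) ^ 2 := by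
      push_cast; ring
    rw [e]
    have hpow : (1 : ℝ) ≤ 2 ^ n := one_le_pow₀ (by norm_num)
    calc |x * (x ^ n - 1 - n * (x - 1)) + n * (x - 1) ^ 2|
        ≤ x * |x ^ n - 1 - n * (x - 1)| + n * (x - 1) ^ 2 := by
          refine (abs_add_le _ _).trans ?_
          rw [abs_mul, abs_of_nonneg h0, abs_of_nonneg (a := (n : ℝ) * (x - 1) ^ 2) (by positivity)]
      _ ≤ 2 * (n ^ 2 * 2 ^ n * (x - 1) ^ 2) + n * 2 ^ n * (x - 1) ^ 2 := by
          refine add_le_add (mul_le_mul h2 ih (abs_nonneg _) (by norm_num)) ?_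
          refine mul_le_mul_of_nonneg_right ?_ (sq_nonneg _)
          nlinarith [(Nat.cast_nonneg n : (0 : ℝ) ≤ n)]
      _ ≤ _ := by
          push_cast
          have h3 : (0 : ℝ) ≤ 2 ^ n * (x - 1) ^ 2 := by positivity
          have h4 : (0 : ℝ) ≤ n := Nat.cast_nonneg n
          have h5 : ((n : ℝ) + 1) ^ 2 * 2 ^ (n + 1) * (x - 1) ^ 2 =
              (n ^ 2 * 2 + n * 4 + 2) * (2 ^ n * (x - 1) ^ 2) := by ring
          rw [h5]
          linarith [mul_nonneg h4 h3]

/-- To be used with p = |u - w|/|u|, q = |u + w|/|u| and τ = |w|/|u|. The hypothesis on p² + q² is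
the parallelogram law; it forces p + q - 2 = O(τ²), which cancels the first-order terms. -/
theorem abs_inv_add_inv_sub_two_le {p q τ : ℝ} (hτ : τ ≤ 1 / 4)
    (hp : |p - 1| ≤ τ) (hq : |q - 1| ≤ τ) (h : p ^ 2 + q ^ 2 = 2 + 2 * τ ^ 2) :
    |p⁻¹ + q⁻¹ - 2| ≤ 4 * τ ^ 2 ∧ (p⁻¹ - 1) ^ 2 ≤ 2 * τ ^ 2 ∧ p⁻¹ ≤ 2 := by
  rw [abs_le] at hp hq
  have hp0 : 3 / 4 ≤ p := by linarith
  have hq0 : 3 / 4 ≤ q := by linarith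
  have hpi : p⁻¹ ≤ 4 / 3 := by
    rw [inv_le_comm₀ (by linarith) (by norm_num)]; linarith
  have hqi : q⁻¹ ≤ 4 / 3 := by
    rw [inv_le_comm₀ (by linarith) (by norm_num)]; linarith
  have hpp : 0 < p⁻¹ := inv_pos.2 (by linarith)
  have hqp : 0 < q⁻¹ := inv_pos.2 (by linarith)
  have hp1 : (p - 1) ^ 2 ≤ τ ^ 2 := sq_le_sq' hp.1 hp.2
  have hq1 : (q - 1) ^ 2 ≤ τ ^ 2 := sq_le_sq' hq.1 hq.2
  have ep : p⁻¹ = 1 - (p - 1) + (p - 1) ^ 2 * p⁻¹ := by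
    field_simp; ring
  have eq : q⁻¹ = 1 - (q - 1) + (q - 1) ^ 2 * q⁻¹ := by
    field_simp; ring
  have hA : (p - 1) ^ 2 * p⁻¹ ≤ τ ^ 2 * (4 / 3) := mul_le_mul hp1 hpi hpp.le (sq_nonneg _)
  have hB : (q - 1) ^ 2 * q⁻¹ ≤ τ ^ 2 * (4 / 3) := mul_le_mul hq1 hqi hqp.le (sq_nonneg _)
  have hA0 : 0 ≤ (p - 1) ^ 2 * p⁻¹ := by positivity
  have hB0 : 0 ≤ (q - 1) ^ 2 * q⁻¹ := by positivity
  refine ⟨?_, ?_, by linarith⟩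
  · have hs : 2 * ((p - 1) + (q - 1)) = 2 * τ ^ 2 - (p - 1) ^ 2 - (q - 1) ^ 2 := by linarith
    have hX := sq_nonneg (p - 1)
    have hY := sq_nonneg (q - 1)
    generalize (p - 1) ^ 2 * p⁻¹ = A at *
    generalize (q - 1) ^ 2 * q⁻¹ = B at *
    generalize (p - 1) ^ 2 = X at *
    generalize (q - 1) ^ 2 = Y at *
    rw [abs_le]
    constructor <;> linarith
  · have : (p⁻¹ - 1) ^ 2 = (p - 1) ^ 2 * (p⁻¹) ^ 2 := by
      have : p ≠ 0 := by linarith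
      field_simp; ring
    rw [this]
    have h3 : (p⁻¹) ^ 2 ≤ 16 / 9 := by nlinarith
    linarith [mul_le_mul hp1 h3 (by positivity) (sq_nonneg τ), sq_nonneg τ]

/-- The second difference of the Riesz kernel. -/
theorem abs_riesz_second_difference_le {u w : E (n + 1)} (hu : u ≠ 0) (hw : 4 * ‖w‖ ≤ ‖u‖) :
    |riesz n (u - w) + riesz n (u + w) - 2 * riesz n u| ≤
      (4 * n + n ^ 2 * 2 ^ n * 4) * ‖w‖ ^ 2 * (‖u‖ ^ (n + 2))⁻¹ := by
  have hU : 0 < ‖u‖ := norm_pos_iff.2 hu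
  set τ := ‖w‖ / ‖u‖ with hτ
  set p := ‖u - w‖ / ‖u‖ with hp
  set q := ‖u + w‖ / ‖u‖ with hq
  have hτ0 : 0 ≤ τ := by positivity
  have hτ1 : τ ≤ 1 / 4 := by rw [hτ, div_le_iff₀ hU]; linarith
  have hp1 : |p - 1| ≤ τ := by
    have h1 := abs_norm_sub_norm_le (u - w) u
    rw [show u - w - u = -w by abel, norm_neg] at h1
    rw [hp, hτ, div_sub_one hU.ne', abs_div, abs_of_pos hU]
    gcongr
  have hq1 : |q - 1| ≤ τ := by
    have h1 := abs_norm_sub_norm_le (u + w) u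
    rw [show u + w - u = w by abel] at h1
    rw [hq, hτ, div_sub_one hU.ne', abs_div, abs_of_pos hU]
    gcongr
  have hpq : p ^ 2 + q ^ 2 = 2 + 2 * τ ^ 2 := by
    have := parallelogram_law_with_norm ℝ u w
    rw [hp, hq, hτ]
    field_simp
    linarith
  obtain ⟨h1, h2, h3⟩ := abs_inv_add_inv_sub_two_le hτ1 hp1 hq1 hpq
  obtain ⟨-, h5, h6⟩ := abs_inv_add_inv_sub_two_le hτ1 hq1 hp1 (by rw [add_comm]; exact hpq)
  have hp0 : 0 ≤ p⁻¹ := by positivity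
  have hq0 : 0 ≤ q⁻¹ := by positivity
  have e1 : riesz n (u - w) = (p⁻¹) ^ n * (‖u‖ ^ n)⁻¹ := by
    rw [riesz, hp, inv_div, div_pow, div_mul_eq_mul_div, mul_inv_cancel₀ (by positivity), one_div]
  have e2 : riesz n (u + w) = (q⁻¹) ^ n * (‖u‖ ^ n)⁻¹ := by
    rw [riesz, hq, inv_div, div_pow, div_mul_eq_mul_div, mul_inv_cancel₀ (by positivity), one_div]
  have e3 : riesz n u = (‖u‖ ^ n)⁻¹ := rfl
  have key : |(p⁻¹) ^ n + (q⁻¹) ^ n - 2| ≤ (4 * n + n ^ 2 * 2 ^ n * 4) * τ ^ 2 := by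
    have a1 := abs_pow_sub_one_sub_le n hp0 h3
    have a2 := abs_pow_sub_one_sub_le n hq0 h6
    have hn0 : (0 : ℝ) ≤ n ^ 2 * 2 ^ n := by positivity
    have a3 : |(n : ℝ) * (p⁻¹ + q⁻¹ - 2)| ≤ n * (4 * τ ^ 2) := by
      rw [abs_mul, Nat.abs_cast]
      gcongr
    have a4 := a1.trans (mul_le_mul_of_nonneg_left h2 hn0)
    have a5 := a2.trans (mul_le_mul_of_nonneg_left h5 hn0)
    rw [abs_le] at a3 a4 a5 ⊢
    constructor <;> linarith
  rw [e1, e2, e3, ← add_mul, ← sub_mul]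
  rw [abs_mul, abs_of_pos (a := (‖u‖ ^ n)⁻¹) (by positivity)]
  calc _ ≤ (4 * n + n ^ 2 * 2 ^ n * 4) * τ ^ 2 * (‖u‖ ^ n)⁻¹ := by gcongr
    _ = _ := by rw [hτ]; field_simp; ring

end Kernel

/-! ### The L¹ norm of the difference of averaged kernels. -/

section KernelNorm

variable {n : ℕ}

/-- The average of the Riesz kernel over the ball of radius `r` about `u`. -/
noncomputable def rieszAvg (n : ℕ) (r : ℝ) (u : E (n + 1)) : ℝ :=
  ∫ w, riesz n (u - w) ∂unif (n + 1) r

theorem measurable_rieszAvg (n : ℕ) (r : ℝ) : Measurable (rieszAvg n r) := by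
  have : Measurable fun q : E (n + 1) × E (n + 1) => riesz n (q.1 - q.2) := by fun_prop
  exact this.stronglyMeasurable.integral_prod_right'.measurable

theorem setLIntegral_riesz_ball (n : ℕ) (R : ℝ) :
    ∫⁻ z in Metric.ball (0 : E (n + 1)) R, ENNReal.ofReal (riesz n z) =
      (ENNReal.ofReal (rieszConst n))⁻¹ * ENNReal.ofReal (2 * R) := by
  rw [← lineMeasure_ball n, lineMeasure_eq, withDensity_apply _ Metric.isOpen_ball.measurableSet]
  simp_rw [ENNReal.ofReal_mul (rieszConst_pos n).le]
  rw [lintegral_const_mul _ (by fun_prop), ← mul_assoc, ENNReal.inv_mul_cancel, one_mul]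
  · simpa using rieszConst_pos n
  · exact ENNReal.ofReal_ne_top

/-- Translating the ball of radius R by a vector shorter than s keeps it in the ball of radius R +
s, whose Riesz mass is linear in the radius. -/
theorem setLIntegral_rieszAvg_near_le (n : ℕ) {s R : ℝ} :
    ∫⁻ u in Metric.ball (0 : E (n + 1)) R, ‖rieszAvg n s u‖ₑ ≤
      (ENNReal.ofReal (rieszConst n))⁻¹ * ENNReal.ofReal (2 * (R + s)) *
        unif (n + 1) s univ := by
  have hm : Measurable fun q : E (n + 1) × E (n + 1) => ENNReal.ofReal (riesz n (q.1 - q.2)) := by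
    fun_prop
  calc ∫⁻ u in Metric.ball (0 : E (n + 1)) R, ‖rieszAvg n s u‖ₑ
      ≤ ∫⁻ u in Metric.ball (0 : E (n + 1)) R, ∫⁻ w, ENNReal.ofReal (riesz n (u - w))
          ∂unif (n + 1) s := by
        refine lintegral_mono fun u => (enorm_integral_le_lintegral_enorm _).trans_eq ?_
        refine lintegral_congr fun w => ?_
        rw [Real.enorm_eq_ofReal (riesz_nonneg _)]
    _ = ∫⁻ w, (∫⁻ u in Metric.ball (0 : E (n + 1)) R, ENNReal.ofReal (riesz n (u - w)))
          ∂unif (n + 1) s := lintegral_lintegral_swap hm.aemeasurable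
    _ ≤ ∫⁻ _, (ENNReal.ofReal (rieszConst n))⁻¹ * ENNReal.ofReal (2 * (R + s))
          ∂unif (n + 1) s := by
        refine lintegral_mono_ae ?_
        filter_upwards [ae_unif (n + 1) s] with w hw
        rw [← setLIntegral_riesz_ball, ← lintegral_indicator Metric.isOpen_ball.measurableSet,
          ← lintegral_indicator Metric.isOpen_ball.measurableSet,
          ← lintegral_sub_right_eq_self ((Metric.ball (0 : E (n + 1)) (R + s)).indicator _) w]
        refine lintegral_mono fun u => ?_
        by_cases hu : u ∈ Metric.ball (0 : E (n + 1)) R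
        · have : u - w ∈ Metric.ball (0 : E (n + 1)) (R + s) := by
            rw [mem_ball_zero_iff] at hu ⊢
            exact (norm_sub_le _ _).trans_lt (add_lt_add hu hw)
          rw [indicator_of_mem hu, indicator_of_mem this]
        · rw [indicator_of_notMem hu]
          exact zero_le
    _ = _ := by rw [lintegral_const]

/-- The uniform measure is even, so the average can be symmetrized in w and -w, and the integrand
becomes half a second difference of the kernel. -/
theorem abs_rieszAvg_sub_le {s : ℝ} (hs : 0 < s) {u : E (n + 1)} (hu : 4 * s ≤ ‖u‖) :
    |rieszAvg n s u - riesz n u| ≤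
      (4 * n + n ^ 2 * 2 ^ n * 4) * s ^ 2 * (‖u‖ ^ (n + 2))⁻¹ := by
  have hprob := isProbabilityMeasure_unif (n + 1) hs
  have hU : 0 < ‖u‖ := by linarith
  have hint : ∀ e : E (n + 1) → E (n + 1), (∀ w, ‖e w‖ = ‖w‖) → Measurable e →
      Integrable (fun w => riesz n (u - e w)) (unif (n + 1) s) := by
    intro e he hem
    refine Integrable.of_bound
      (measurable_riesz.comp (by fun_prop)).aestronglyMeasurable (((3 / 4 * ‖u‖) ^ n)⁻¹) ?_
    filter_upwards [ae_unif (n + 1) s] with w hw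
    rw [Real.norm_of_nonneg (riesz_nonneg _), riesz]
    have : 3 / 4 * ‖u‖ ≤ ‖u - e w‖ := by
      have := norm_sub_norm_le u (e w)
      rw [he] at this
      linarith
    gcongr
  have h1 := hint id (fun _ => rfl) measurable_id
  have h2 := hint (fun w => -w) norm_neg measurable_neg
  simp only [sub_neg_eq_add, id] at h1 h2
  have h3 : rieszAvg n s u = ∫ w, riesz n (u + w) ∂unif (n + 1) s := by
    rw [rieszAvg, ← (measurePreserving_unif (LinearIsometryEquiv.neg ℝ) s).integral_comp
      (LinearIsometryEquiv.neg ℝ).toHomeomorph.measurableEmbedding]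
    simp
  have h4 : rieszAvg n s u - riesz n u = 2⁻¹ * ∫ w, (riesz n (u - w) + riesz n (u + w)
      - 2 * riesz n u) ∂unif (n + 1) s := by
    rw [integral_sub (f := fun w => riesz n (u - w) + riesz n (u + w)) (h1.add h2)
      (integrable_const _), integral_add h1 h2, ← h3, ← rieszAvg]
    simp
    ring
  rw [h4, abs_mul, ← Real.norm_eq_abs (∫ _, _ ∂_)]
  have h5 : ‖∫ w, (riesz n (u - w) + riesz n (u + w) - 2 * riesz n u) ∂unif (n + 1) s‖ ≤
      (4 * n + n ^ 2 * 2 ^ n * 4) * s ^ 2 * (‖u‖ ^ (n + 2))⁻¹ := by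
    refine (norm_integral_le_of_norm_le_const (C := (4 * n + n ^ 2 * 2 ^ n * 4) * s ^ 2 *
      (‖u‖ ^ (n + 2))⁻¹) ?_).trans_eq (by simp)
    filter_upwards [ae_unif (n + 1) s] with w hw
    rw [Real.norm_eq_abs]
    refine (abs_riesz_second_difference_le (norm_pos_iff.1 hU) (by linarith)).trans ?_
    gcongr
  refine le_trans (mul_le_mul_of_nonneg_left h5 (abs_nonneg _)) ?_
  refine mul_le_of_le_one_left (by positivity) (by norm_num [abs_of_pos])

theorem lintegral_Ioi_inv_sq {c : ℝ} (hc : 0 < c) :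
    ∫⁻ s in Ioi c, ENNReal.ofReal ((s ^ 2)⁻¹) = ENNReal.ofReal c⁻¹ := by
  have h : ∀ s : ℝ, s ∈ Ioi c → s ^ (-2 : ℝ) = (s ^ 2)⁻¹ := by
    intro s hs
    rw [Real.rpow_neg (hc.trans hs).le]
    norm_cast
  have hi : IntegrableOn (fun s : ℝ => (s ^ 2)⁻¹) (Ioi c) :=
    (integrableOn_Ioi_rpow_of_lt (by norm_num : (-2 : ℝ) < -1) hc).congr_fun h measurableSet_Ioi
  rw [← ofReal_integral_eq_lintegral_ofReal hi (ae_of_all _ fun s => by positivity),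
    ← setIntegral_congr_fun measurableSet_Ioi h, integral_Ioi_rpow_of_lt (by norm_num) hc]
  congr 1
  norm_num [Real.rpow_neg_one]

theorem setLIntegral_far (n : ℕ) {c D : ℝ} (hc : 0 < c) (hD : 0 ≤ D) :
    ∫⁻ u in {u : E (n + 1) | c < ‖u‖}, ENNReal.ofReal (D * (‖u‖ ^ (n + 2))⁻¹) =
      (n + 1 : ℕ) * unitVol (n + 1) * ENNReal.ofReal (D * c⁻¹) := by
  have hS : MeasurableSet {u : E (n + 1) | c < ‖u‖} :=
    measurableSet_lt measurable_const measurable_norm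
  rw [← lintegral_indicator hS]
  have h1 := lintegral_norm n (φ := (Ioi c).indicator fun s => ENNReal.ofReal (D * (s ^ (n + 2))⁻¹))
    (Measurable.indicator (by fun_prop) measurableSet_Ioi)
  have h2 : ∀ u : E (n + 1), {u : E (n + 1) | c < ‖u‖}.indicator
      (fun u => ENNReal.ofReal (D * (‖u‖ ^ (n + 2))⁻¹)) u =
      (Ioi c).indicator (fun s => ENNReal.ofReal (D * (s ^ (n + 2))⁻¹)) ‖u‖ := fun u => rfl
  simp_rw [h2]
  rw [h1]
  congr 1
  have h3 : ∀ s : ℝ, ENNReal.ofReal (s ^ n) *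
      (Ioi c).indicator (fun s => ENNReal.ofReal (D * (s ^ (n + 2))⁻¹)) s =
      (Ioi c).indicator (fun s => ENNReal.ofReal D * ENNReal.ofReal ((s ^ 2)⁻¹)) s := by
    intro s
    by_cases hs : s ∈ Ioi c
    · have hs0 : 0 < s := hc.trans hs
      rw [indicator_of_mem hs, indicator_of_mem hs, ← ENNReal.ofReal_mul (by positivity),
        ← ENNReal.ofReal_mul hD]
      congr 1
      field_simp
      ring
    · rw [indicator_of_notMem hs, indicator_of_notMem hs, mul_zero]
  simp_rw [h3]
  rw [lintegral_indicator measurableSet_Ioi, Measure.restrict_restrict measurableSet_Ioi,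
    inter_eq_self_of_subset_left (Ioi_subset_Ioi hc.le),
    lintegral_const_mul _ (by fun_prop), lintegral_Ioi_inv_sq hc, ← ENNReal.ofReal_mul hD]

/-- The difference of averages of the Riesz kernel at scales `r` and `2 r` has `L¹` norm `O(r)`. -/
theorem exists_lintegral_rieszAvg_sub_le (n : ℕ) : ∃ C : ℝ≥0∞, C ≠ ∞ ∧ ∀ r : ℝ, 0 < r →
    ∫⁻ u, ‖rieszAvg n r u - rieszAvg n (2 * r) u‖ₑ ≤ C * ENNReal.ofReal r := by
  set A : ℝ := 4 * n + n ^ 2 * 2 ^ n * 4 with hA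
  have hA0 : 0 ≤ A := by positivity
  have hct : (ENNReal.ofReal (rieszConst n))⁻¹ ≠ ∞ :=
    ENNReal.inv_ne_top.2 (by simpa using rieszConst_pos n)
  -- 42 = 2(9 + 1) + 2(9 + 2): the ball of radius 9r at the averaging scales r and 2r.
  refine ⟨(ENNReal.ofReal (rieszConst n))⁻¹ * ENNReal.ofReal 42 +
    (n + 1 : ℕ) * unitVol (n + 1) * ENNReal.ofReal A, ?_, fun r hr => ?_⟩
  · refine ENNReal.add_ne_top.2 ⟨ENNReal.mul_ne_top hct ENNReal.ofReal_ne_top, ?_⟩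
    exact ENNReal.mul_ne_top (ENNReal.mul_ne_top (by simp) (unitVol_ne_top _))
      ENNReal.ofReal_ne_top
  have hm := (measurable_rieszAvg n r).sub (measurable_rieszAvg n (2 * r))
  have hp1 := isProbabilityMeasure_unif (n + 1) hr
  have hp2 := isProbabilityMeasure_unif (n + 1) (show 0 < 2 * r by positivity)
  have hS : MeasurableSet {u : E (n + 1) | 8 * r < ‖u‖} :=
    measurableSet_lt measurable_const measurable_norm
  -- Beyond 8r the second-difference bound applies at both scales, and r²|u|^(-n-2) integrates to
  -- O(r) there. Inside, each averaged kernel separately has mass O(r).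
  rw [← lintegral_add_compl _ hS, add_comm, add_mul]
  refine add_le_add ?_ ?_
  · have hsub : {u : E (n + 1) | 8 * r < ‖u‖}ᶜ ⊆ Metric.ball 0 (9 * r) := by
      intro u hu
      simp only [mem_compl_iff, mem_ofPred_eq, not_lt] at hu
      rw [mem_ball_zero_iff]
      linarith
    calc _ ≤ ∫⁻ u in Metric.ball (0 : E (n + 1)) (9 * r),
          ‖rieszAvg n r u - rieszAvg n (2 * r) u‖ₑ := lintegral_mono_set hsub
      _ ≤ ∫⁻ u in Metric.ball (0 : E (n + 1)) (9 * r),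
          (‖rieszAvg n r u‖ₑ + ‖rieszAvg n (2 * r) u‖ₑ) :=
          lintegral_mono fun u => enorm_sub_le
      _ = _ := lintegral_add_left (measurable_rieszAvg n r).enorm _
      _ ≤ _ := 
          add_le_add (setLIntegral_rieszAvg_near_le n) (setLIntegral_rieszAvg_near_le n)
      _ = _ := by
          rw [measure_univ, measure_univ, mul_one, mul_one, ← mul_add,
            ← ENNReal.ofReal_add (by positivity) (by positivity), mul_assoc,
            ← ENNReal.ofReal_mul (by norm_num)]
          congr 2
          ring
  · calc _ ≤ ∫⁻ u in {u : E (n + 1) | 8 * r < ‖u‖},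
          ENNReal.ofReal ((5 * A * r ^ 2) * (‖u‖ ^ (n + 2))⁻¹) := by
          refine setLIntegral_mono' hS fun u hu => ?_
          have hu' : 8 * r < ‖u‖ := hu
          rw [Real.enorm_eq_ofReal_abs]
          refine ENNReal.ofReal_le_ofReal ?_
          have h1 := abs_rieszAvg_sub_le (n := n) hr (u := u) (by linarith)
          have h2 := abs_rieszAvg_sub_le (n := n) (s := 2 * r) (by positivity) (u := u)
            (by linarith)
          calc |rieszAvg n r u - rieszAvg n (2 * r) u|
              = |(rieszAvg n r u - riesz n u) - (rieszAvg n (2 * r) u - riesz n u)| := by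
                congr 1; ring
            _ ≤ _ := abs_sub _ _
            _ ≤ _ := add_le_add h1 h2
            _ = _ := by rw [← hA]; ring
      _ = (n + 1 : ℕ) * unitVol (n + 1) * ENNReal.ofReal (5 * A * r ^ 2 * (8 * r)⁻¹) :=
          setLIntegral_far n (by positivity) (by positivity)
      _ ≤ _ := by
          rw [mul_assoc (((n + 1 : ℕ) : ℝ≥0∞) * unitVol (n + 1)), ← ENNReal.ofReal_mul hA0]
          refine mul_le_mul_right (ENNReal.ofReal_le_ofReal ?_) _
          have : 5 * A * r ^ 2 * (8 * r)⁻¹ = 5 / 8 * (A * r) := by field_simp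
          rw [this]
          have := mul_nonneg hA0 hr.le
          linarith

end KernelNorm

/-! ### The L² estimate: the X-ray transform gains a factor r at scale r. -/

section XraySquare

variable {n : ℕ} {Λ R : ℝ} {f g : E (n + 1) → ℝ}

theorem cons_zero_eq (s : ℝ) : cons s (0 : E n) = s • e0 n := by simp [cons]

/-- Expand the square as a double integral along the line, and use one of the two line parameters
together with y as coordinates of x; the other becomes a displacement in the direction θe₀. -/
theorem Nice.integral_xray_sq (hg : Nice Λ R g) (hR : 0 ≤ R) (θ : O (n + 1)) :
    ∫ y, KPlane.xray θ g y ^ 2 = ∫ x, g x * ∫ s : ℝ, g (x + s • θ.1 (e0 n)) := by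
  have hi : Integrable (fun q : ℝ × E n => g (θ.1 (cons q.1 q.2)) * KPlane.xray θ g q.2)
      (volume.prod volume) := by
    refine integrable_of_bounded_of_supp (S := Metric.ball 0 R ×ˢ Metric.ball 0 R)
      (Λ := Λ * (Λ * (2 * R))) ?_ (fun q => ?_) (fun q hq => ?_) ?_
    · refine Measurable.mul (hg.meas.comp (θ.1.continuous.measurable.comp measurable_cons)) ?_
      exact (hg.xray hR θ).meas.comp measurable_snd
    · rw [abs_mul]
      exact mul_le_mul (hg.bound _) ((hg.xray hR θ).bound _) (abs_nonneg _) hg.nonneg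
    · rw [hg.supp, zero_mul]
      rw [norm_act]
      by_contra! hc
      refine hq ⟨?_, ?_⟩
      · simpa using (abs_le_norm_cons q.1 q.2).trans_lt hc
      · simpa using (norm_le_norm_cons q.1 q.2).trans_lt hc
    · rw [Measure.prod_prod]
      exact ENNReal.mul_ne_top measure_ball_lt_top.ne measure_ball_lt_top.ne
  have hm : Measurable fun x => g x * ∫ s : ℝ, g (x + s • θ.1 (e0 n)) := by
    refine hg.meas.mul ?_
    have : Measurable fun q : E (n + 1) × ℝ => g (q.1 + q.2 • θ.1 (e0 n)) :=
      hg.meas.comp (by fun_prop)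
    exact this.stronglyMeasurable.integral_prod_right'.measurable
  rw [← (Unitary.linearIsometryEquiv θ).measurePreserving.integral_comp
    (Unitary.linearIsometryEquiv θ).toHomeomorph.measurableEmbedding]
  change _ = ∫ x, g (θ.1 x) * ∫ s : ℝ, g (θ.1 x + s • θ.1 (e0 n))
  have hemb : Measurable (fun q : ℝ × E n => cons q.1 q.2) := measurable_cons
  rw [← measurePreserving_cons.map_eq, integral_map hemb.aemeasurable
    (show AEStronglyMeasurable (fun x => g (θ.1 x) * ∫ s : ℝ, g (θ.1 x + s • θ.1 (e0 n))) _ from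
      (hm.comp θ.1.continuous.measurable).aestronglyMeasurable)]
  have he : ∀ q : ℝ × E n, g (θ.1 (cons q.1 q.2)) *
      ∫ s : ℝ, g (θ.1 (cons q.1 q.2) + s • θ.1 (e0 n)) =
      g (θ.1 (cons q.1 q.2)) * KPlane.xray θ g q.2 := by
    intro q
    congr 1
    rw [KPlane.xray, ← integral_add_left_eq_self (fun t => g (θ.1 (cons t q.2))) q.1]
    refine integral_congr_ae (ae_of_all _ fun s => ?_)
    simp only
    rw [← map_smul, ← map_add, ← cons_zero_eq, ← cons_add, add_zero]
  simp_rw [he]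
  rw [integral_prod_symm _ hi]
  refine integral_congr_ae (ae_of_all _ fun y => ?_)
  simp only
  rw [integral_mul_const, sq]
  rfl

/-- Averaged over θ, the displacement s θe₀ is distributed by `lineMeasure`. This is the identity of
the normal operator of the X-ray transform with a Riesz potential, after which absolute values are
taken. -/
theorem Nice.lintegral_xray_sq_le (hg : Nice Λ R g) (hR : 0 ≤ R) :
    ∫⁻ θ, (∫⁻ y, ‖KPlane.xray θ g y‖ₑ ^ 2) ∂haarO (n + 1) ≤
      ∫⁻ x, ‖g x‖ₑ * ‖∫ z, g (x + z) ∂lineMeasure n‖ₑ := by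
  have hF : Integrable (fun q : (O (n + 1) × ℝ) × E (n + 1) =>
      g q.2 * g (q.2 + q.1.2 • q.1.1.1 (e0 n)))
      (((haarO (n + 1)).prod volume).prod volume) := by
    refine integrable_of_bounded_of_supp
      (S := (univ ×ˢ Metric.ball 0 (2 * R)) ×ˢ Metric.ball 0 R)
      (Λ := Λ * Λ) ?_ (fun q => ?_) (fun q hq => ?_) ?_
    · refine (hg.meas.comp measurable_snd).mul (hg.meas.comp ?_)
      exact measurable_snd.add (measurable_smul_act.comp measurable_fst)
    · rw [abs_mul]
      exact mul_le_mul (hg.bound _) (hg.bound _) (abs_nonneg _) hg.nonneg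
    · by_cases h1 : R ≤ ‖q.2‖
      · rw [hg.supp _ h1, zero_mul]
      · rw [hg.supp (q.2 + q.1.2 • q.1.1.1 (e0 n)), mul_zero]
        by_contra! hc
        refine hq ⟨⟨mem_univ _, ?_⟩, by simpa using h1⟩
        have h2 : ‖q.1.2 • q.1.1.1 (e0 n)‖ ≤ ‖q.2 + q.1.2 • q.1.1.1 (e0 n)‖ + ‖q.2‖ := by
          calc ‖q.1.2 • q.1.1.1 (e0 n)‖ = ‖(q.2 + q.1.2 • q.1.1.1 (e0 n)) - q.2‖ := by
                congr 1; abel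
            _ ≤ _ := norm_sub_le _ _
        rw [norm_smul, norm_act, norm_e0, mul_one] at h2
        rw [mem_ball_zero_iff]
        linarith
    · rw [Measure.prod_prod, Measure.prod_prod]
      exact ENNReal.mul_ne_top (ENNReal.mul_ne_top (measure_ne_top _ _) measure_ball_lt_top.ne)
        measure_ball_lt_top.ne
  have hint := hF.integral_prod_left
  -- For each θ the order of integration is exchanged, which needs its own compactly supported
  -- domination.
  have hfix : ∀ᵐ θ ∂haarO (n + 1), (∫ s : ℝ, ∫ x, g x * g (x + s • θ.1 (e0 n))) =
      ∫ y, KPlane.xray θ g y ^ 2 := by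
    refine ae_of_all _ fun θ => ?_
    rw [hg.integral_xray_sq hR, integral_integral_swap]
    · simp_rw [integral_const_mul]
    · have := hF
      refine integrable_of_bounded_of_supp
        (S := Metric.ball 0 (2 * R) ×ˢ Metric.ball 0 R)
        (Λ := Λ * Λ) ?_ (fun q => ?_) (fun q hq => ?_) ?_
      · refine (hg.meas.comp measurable_snd).mul (hg.meas.comp ?_)
        exact measurable_snd.add (measurable_fst.smul_const _)
      · simp only [Function.uncurry]
        rw [abs_mul]
        exact mul_le_mul (hg.bound _) (hg.bound _) (abs_nonneg _) hg.nonneg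
      · simp only [Function.uncurry]
        by_cases h1 : R ≤ ‖q.2‖
        · rw [hg.supp _ h1, zero_mul]
        · rw [hg.supp (q.2 + q.1 • θ.1 (e0 n)), mul_zero]
          by_contra! hc
          refine hq ⟨?_, by simpa using h1⟩
          have h2 : ‖q.1 • θ.1 (e0 n)‖ ≤ ‖q.2 + q.1 • θ.1 (e0 n)‖ + ‖q.2‖ := by
            calc ‖q.1 • θ.1 (e0 n)‖ = ‖(q.2 + q.1 • θ.1 (e0 n)) - q.2‖ := by
                  congr 1; abel
              _ ≤ _ := norm_sub_le _ _
          rw [norm_smul, norm_act, norm_e0, mul_one] at h2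
          rw [mem_ball_zero_iff]
          linarith
      · rw [Measure.prod_prod]
        exact ENNReal.mul_ne_top measure_ball_lt_top.ne measure_ball_lt_top.ne
  have hI : Integrable (fun θ => ∫ y, KPlane.xray θ g y ^ 2) (haarO (n + 1)) :=
    hint.integral_prod_left.congr hfix
  have h1 : ∫⁻ θ, (∫⁻ y, ‖KPlane.xray θ g y‖ₑ ^ 2) ∂haarO (n + 1) =
      ENNReal.ofReal (∫ θ, (∫ y, KPlane.xray θ g y ^ 2) ∂haarO (n + 1)) := by
    rw [ofReal_integral_eq_lintegral_ofReal hI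
      (ae_of_all _ fun θ => integral_nonneg fun y => sq_nonneg _)]
    refine lintegral_congr fun θ => ?_
    have hn := hg.xray hR θ
    have hsq : Integrable (fun y => KPlane.xray θ g y ^ 2) := by
      refine integrable_of_bounded_of_supp (S := Metric.ball 0 R)
        (Λ := (Λ * (2 * R)) ^ 2) (hn.meas.pow_const 2) (fun y => ?_) (fun y hy => ?_)
        measure_ball_lt_top.ne
      · rw [abs_pow]
        exact pow_le_pow_left₀ (abs_nonneg _) (hn.bound y) 2
      · rw [hn.supp y (by simpa using hy)]
        simp
    rw [ofReal_integral_eq_lintegral_ofReal hsq (ae_of_all _ fun y => sq_nonneg _)]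
    refine lintegral_congr fun y => ?_
    rw [← enorm_pow, Real.enorm_eq_ofReal (sq_nonneg _)]
  rw [h1, ← integral_congr_ae hfix]
  have h2 := integral_prod _ hint
  rw [← h2, integral_integral_swap hF]
  refine (Real.ofReal_le_enorm _).trans ?_
  refine (enorm_integral_le_lintegral_enorm _).trans_eq ?_
  refine lintegral_congr fun x => ?_
  simp only
  rw [integral_const_mul, enorm_mul, lineMeasure, integral_map measurable_smul_act.aemeasurable]
  exact (hg.meas.comp (measurable_const_add x)).aestronglyMeasurable

/-- Convolution is associative: the average is moved from f to the Riesz kernel, so that differences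
of scales fall on the kernel. -/
theorem Nice.integral_avg_lineMeasure (hf : Nice Λ R f) {r : ℝ} (x : E (n + 1)) :
    Integrable (fun u => f (x + u) * rieszAvg n r u) ∧
    ∫ z, KPlane.avg r f (x + z) ∂lineMeasure n =
      rieszConst n * ∫ u, f (x + u) * rieszAvg n r u := by
  have hrm : Measurable (riesz n) := measurable_riesz
  have hH1 : Integrable (fun q : E (n + 1) × E (n + 1) => f (x + q.2 + q.1) * riesz n q.2)
      ((unif (n + 1) r).prod volume) := by
    have hdom : Integrable (fun q : E (n + 1) × E (n + 1) =>
        Λ * (Metric.ball (0 : E (n + 1)) (R + ‖x‖ + r)).indicator (riesz n) q.2)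
        ((unif (n + 1) r).prod volume) := by
      refine Integrable.mul_prod (f := fun _ => Λ) (integrable_const Λ) ?_
      refine ⟨(hrm.indicator Metric.isOpen_ball.measurableSet).aestronglyMeasurable, ?_⟩
      rw [HasFiniteIntegral]
      have : ∀ z, ‖(Metric.ball (0 : E (n + 1)) (R + ‖x‖ + r)).indicator (riesz n) z‖ₑ =
          (Metric.ball (0 : E (n + 1)) (R + ‖x‖ + r)).indicator
            (fun z => ENNReal.ofReal (riesz n z)) z := by
        intro z
        by_cases hz : z ∈ Metric.ball (0 : E (n + 1)) (R + ‖x‖ + r)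
        · rw [indicator_of_mem hz, indicator_of_mem hz, Real.enorm_eq_ofReal (riesz_nonneg _)]
        · rw [indicator_of_notMem hz, indicator_of_notMem hz, enorm_zero]
      simp_rw [this]
      rw [lintegral_indicator Metric.isOpen_ball.measurableSet, setLIntegral_riesz_ball]
      exact ENNReal.mul_lt_top (ENNReal.inv_lt_top.2 (by simpa using rieszConst_pos n))
        ENNReal.ofReal_lt_top
    refine hdom.mono' ?_ ?_
    · refine Measurable.aestronglyMeasurable ?_
      exact (hf.meas.comp (by fun_prop)).mul (hrm.comp measurable_snd)
    · have : ∀ᵐ q ∂(unif (n + 1) r).prod (volume : Measure (E (n + 1))), ‖q.1‖ < r :=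
        Measure.quasiMeasurePreserving_fst.ae (ae_unif (n + 1) r)
      filter_upwards [this] with q hq
      by_cases hz : q.2 ∈ Metric.ball (0 : E (n + 1)) (R + ‖x‖ + r)
      · rw [indicator_of_mem hz, norm_mul, Real.norm_of_nonneg (riesz_nonneg _)]
        exact mul_le_mul_of_nonneg_right (hf.bound _) (riesz_nonneg _)
      · rw [indicator_of_notMem hz, hf.supp, zero_mul, norm_zero, mul_zero]
        have h1 : R + ‖x‖ + r ≤ ‖q.2‖ := by simpa using hz
        have h2 : ‖q.2‖ ≤ ‖x + q.2 + q.1‖ + (‖x‖ + ‖q.1‖) := by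
          calc ‖q.2‖ = ‖(x + q.2 + q.1) - (x + q.1)‖ := by congr 1; abel
            _ ≤ _ := (norm_sub_le _ _).trans (add_le_add_right (norm_add_le _ _) _)
        linarith
  -- The shear u = z + w transfers integrability from the pair (w, z) to the pair (w, u).
  have hsh : MeasurePreserving (fun q : E (n + 1) × E (n + 1) => (q.1, q.2 - q.1))
      ((unif (n + 1) r).prod volume) ((unif (n + 1) r).prod volume) := by
    refine (MeasurePreserving.id _).skew_product (g := fun w u => u - w) (by fun_prop) ?_
    exact ae_of_all _ fun w => (measurePreserving_sub_right volume w).map_eq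
  have hH2 : Integrable (fun q : E (n + 1) × E (n + 1) => f (x + q.2) * riesz n (q.2 - q.1))
      ((unif (n + 1) r).prod volume) := by
    have := hsh.integrable_comp_of_integrable hH1
    refine this.congr (ae_of_all _ fun q => ?_)
    simp only [Function.comp_apply]
    congr 2
    abel
  refine ⟨?_, ?_⟩
  · have := hH2.integral_prod_right
    simp_rw [integral_const_mul] at this
    exact this
  · have hc := rieszConst_pos n
    rw [lineMeasure_eq, integral_withDensity_eq_integral_toReal_smul (by fun_prop)
      (ae_of_all _ fun _ => ENNReal.ofReal_lt_top)]
    have h1 : ∀ z, (ENNReal.ofReal (rieszConst n * riesz n z)).toReal • KPlane.avg r f (x + z) =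
        rieszConst n * ∫ w, f (x + z + w) * riesz n z ∂unif (n + 1) r := by
      intro z
      rw [ENNReal.toReal_ofReal (mul_nonneg hc.le (riesz_nonneg _)), integral_mul_const,
        smul_eq_mul, KPlane.avg]
      ring
    simp_rw [h1]
    rw [integral_const_mul, ← integral_integral_swap (f := fun w z => f (x + z + w) * riesz n z) hH1]
    congr 1
    have h2 : ∀ w, ∫ z, f (x + z + w) * riesz n z = ∫ u, f (x + u) * riesz n (u - w) := by
      intro w
      rw [← integral_sub_right_eq_self _ w]
      refine integral_congr_ae (ae_of_all _ fun u => ?_)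
      simp only
      congr 2
      abel
    simp_rw [h2]
    rw [integral_integral_swap hH2]
    simp_rw [integral_const_mul]
    rfl

theorem enorm_mul_le_sq_add_sq (a b : ℝ≥0∞) : a * b ≤ a ^ 2 + b ^ 2 := by
  rcases le_total a b with h | h
  · calc a * b ≤ b * b := by gcongr
      _ ≤ _ := by rw [← sq]; exact le_add_self
  · calc a * b ≤ a * a := by gcongr
      _ ≤ _ := by rw [← sq]; exact le_self_add

/-- The bound is uniform in the displacement u, so that the kernel will enter only through its L¹
norm. -/
theorem lintegral_avg_mul_le {d : ℕ} {f : E d → ℝ} (hf : Measurable f) {r : ℝ} (hr : 0 < r)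
    (u : E d) : ∫⁻ x, ‖avg r f x‖ₑ * ‖f (x + u)‖ₑ ≤ 2 * ∫⁻ x, ‖f x‖ₑ ^ 2 := by
  have hp := isProbabilityMeasure_unif d hr
  calc ∫⁻ x, ‖avg r f x‖ₑ * ‖f (x + u)‖ₑ
      ≤ ∫⁻ x, ∫⁻ w, (‖f (x + w)‖ₑ ^ 2 + ‖f (x + u)‖ₑ ^ 2) ∂unif d r := by
        refine lintegral_mono fun x => ?_
        calc ‖avg r f x‖ₑ * ‖f (x + u)‖ₑ
            ≤ (∫⁻ w, ‖f (x + w)‖ₑ ∂unif d r) * ‖f (x + u)‖ₑ := by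
              gcongr; exact enorm_integral_le_lintegral_enorm _
          _ = ∫⁻ w, ‖f (x + w)‖ₑ * ‖f (x + u)‖ₑ ∂unif d r := by
              rw [lintegral_mul_const _ (by fun_prop)]
          _ ≤ _ := lintegral_mono fun w => enorm_mul_le_sq_add_sq _ _
    _ = ∫⁻ w, (∫⁻ x, (‖f (x + w)‖ₑ ^ 2 + ‖f (x + u)‖ₑ ^ 2)) ∂unif d r := by
        refine lintegral_lintegral_swap ?_
        have : Measurable fun q : E d × E d => f (q.1 + q.2) := hf.comp (by fun_prop)
        have h2 : Measurable fun q : E d × E d => f (q.1 + u) := hf.comp (by fun_prop)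
        exact ((this.enorm.pow_const 2).add (h2.enorm.pow_const 2)).aemeasurable
    _ = ∫⁻ w, (2 * ∫⁻ x, ‖f x‖ₑ ^ 2) ∂unif d r := by
        refine lintegral_congr fun w => ?_
        rw [lintegral_add_left (by fun_prop), lintegral_add_right_eq_self (fun x => ‖f x‖ₑ ^ 2),
          lintegral_add_right_eq_self (fun x => ‖f x‖ₑ ^ 2), two_mul]
    _ = _ := by rw [lintegral_const, measure_univ, mul_one]

/-- The `L²` smoothing estimate for the X-ray transform. -/
theorem exists_xray_sq_le (n : ℕ) : ∃ C : ℝ≥0∞, C ≠ ∞ ∧ ∀ (Λ R : ℝ), 0 ≤ R →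
    ∀ f : E (n + 1) → ℝ, Nice Λ R f → ∀ r : ℝ, 0 < r →
    ∫⁻ θ, (∫⁻ y, ‖xray θ (fun x => avg r f x - avg (2 * r) f x) y‖ₑ ^ 2) ∂haarO (n + 1) ≤
      C * ENNReal.ofReal r * ∫⁻ x, ‖f x‖ₑ ^ 2 := by
  obtain ⟨C, hC, hker⟩ := exists_lintegral_rieszAvg_sub_le n
  refine ⟨4 * (ENNReal.ofReal (rieszConst n) * C), ?_, fun Λ R hR f hf r hr => ?_⟩
  · exact ENNReal.mul_ne_top (by simp) (ENNReal.mul_ne_top ENNReal.ofReal_ne_top hC)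
  have hr2 : 0 < 2 * r := by positivity
  have hg := (hf.avg hr).sub (hf.avg hr2)
  have hκm : Measurable fun u => ‖rieszAvg n r u - rieszAvg n (2 * r) u‖ₑ :=
    ((measurable_rieszAvg n r).sub (measurable_rieszAvg n (2 * r))).enorm
  have hfa : Measurable fun q : E (n + 1) × E (n + 1) => f (q.1 + q.2) := hf.meas.comp (by fun_prop)
  refine (hg.lintegral_xray_sq_le (le_max_of_le_left (by positivity))).trans ?_
  have h1 : ∀ x, ‖∫ z, (avg r f (x + z) - avg (2 * r) f (x + z)) ∂lineMeasure n‖ₑ ≤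
      ENNReal.ofReal (rieszConst n) *
        ∫⁻ u, ‖f (x + u)‖ₑ * ‖rieszAvg n r u - rieszAvg n (2 * r) u‖ₑ := by
    intro x
    have hia : ∀ s : ℝ, 0 < s → Integrable (fun z => avg s f (x + z)) (lineMeasure n) := by
      intro s hs
      have hn := hf.avg hs
      refine integrable_of_bounded_of_supp (S := Metric.ball 0 (R + s + ‖x‖))
        (hn.meas.comp (measurable_const_add x)) (fun z => hn.bound _) (fun z hz => hn.supp _ ?_) ?_
      · have h1 : R + s + ‖x‖ ≤ ‖z‖ := by simpa using hz
        have h2 : ‖z‖ ≤ ‖x + z‖ + ‖x‖ := by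
          calc ‖z‖ = ‖(x + z) - x‖ := by congr 1; abel
            _ ≤ _ := norm_sub_le _ _
        linarith
      · rw [lineMeasure_ball]
        exact ENNReal.ofReal_ne_top
    obtain ⟨i1, e1⟩ := hf.integral_avg_lineMeasure (r := r) x
    obtain ⟨i2, e2⟩ := hf.integral_avg_lineMeasure (r := 2 * r) x
    rw [integral_sub (hia r hr) (hia _ hr2), e1, e2, ← mul_sub, ← integral_sub i1 i2, enorm_mul,
      Real.enorm_eq_ofReal (rieszConst_pos n).le]
    gcongr
    refine (enorm_integral_le_lintegral_enorm _).trans_eq ?_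
    simp_rw [← mul_sub, enorm_mul]
  calc _ ≤ ∫⁻ x, ENNReal.ofReal (rieszConst n) *
        ∫⁻ u, ‖avg r f x - avg (2 * r) f x‖ₑ * (‖f (x + u)‖ₑ *
          ‖rieszAvg n r u - rieszAvg n (2 * r) u‖ₑ) := by
        refine lintegral_mono fun x => ?_
        rw [lintegral_const_mul _ (show Measurable fun u => ‖f (x + u)‖ₑ *
          ‖rieszAvg n r u - rieszAvg n (2 * r) u‖ₑ from
            (hf.meas.comp (measurable_const_add x)).enorm.mul hκm), mul_left_comm]
        gcongr
        exact h1 x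
    _ = ENNReal.ofReal (rieszConst n) * ∫⁻ x,
        ∫⁻ u, ‖avg r f x - avg (2 * r) f x‖ₑ * (‖f (x + u)‖ₑ *
          ‖rieszAvg n r u - rieszAvg n (2 * r) u‖ₑ) :=
        lintegral_const_mul' _ _ ENNReal.ofReal_ne_top
    _ = ENNReal.ofReal (rieszConst n) * ∫⁻ u, ∫⁻ x,
        ‖avg r f x - avg (2 * r) f x‖ₑ * (‖f (x + u)‖ₑ *
          ‖rieszAvg n r u - rieszAvg n (2 * r) u‖ₑ) := by
        congr 1
        refine lintegral_lintegral_swap ?_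
        exact ((hg.meas.enorm.comp measurable_fst).mul
          (hfa.enorm.mul (hκm.comp measurable_snd))).aemeasurable
    -- The factor D is estimated without cancellation, 2 + 2 from its two averages; the whole gain
    -- sits in the kernel difference.
    _ ≤ ENNReal.ofReal (rieszConst n) * ∫⁻ u, (4 * ∫⁻ x, ‖f x‖ₑ ^ 2) *
          ‖rieszAvg n r u - rieszAvg n (2 * r) u‖ₑ := by
        refine mul_le_mul_right (lintegral_mono fun u => ?_) _
        have hfu : Measurable fun x => ‖f (x + u)‖ₑ :=
          (hf.meas.comp (measurable_add_const u)).enorm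
        simp_rw [← mul_assoc]
        rw [lintegral_mul_const _ (show Measurable fun x => ‖avg r f x - avg (2 * r) f x‖ₑ *
          ‖f (x + u)‖ₑ from hg.meas.enorm.mul hfu)]
        refine mul_le_mul_left ?_ _
        calc ∫⁻ x, ‖avg r f x - avg (2 * r) f x‖ₑ * ‖f (x + u)‖ₑ
            ≤ ∫⁻ x, (‖avg r f x‖ₑ * ‖f (x + u)‖ₑ + ‖avg (2 * r) f x‖ₑ * ‖f (x + u)‖ₑ) := by
              refine lintegral_mono fun x => ?_
              rw [← add_mul]
              gcongr
              exact enorm_sub_le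
          _ = _ := lintegral_add_left ((hf.avg hr).meas.enorm.mul hfu) _
          _ ≤ _ := add_le_add (lintegral_avg_mul_le hf.meas hr u)
              (lintegral_avg_mul_le hf.meas hr2 u)
          _ = _ := by ring
    _ ≤ _ := by
        rw [lintegral_const_mul _ hκm]
        calc _ ≤ ENNReal.ofReal (rieszConst n) * ((4 * ∫⁻ x, ‖f x‖ₑ ^ 2) *
              (C * ENNReal.ofReal r)) := by gcongr; exact hker r hr
          _ = _ := by ring

end XraySquare

/-! ### From L² and L^∞ to L^p. -/

section Interpolation

variable {n : ℕ} {Λ R : ℝ}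

theorem Nice.restrict {d : ℕ} {f : E d → ℝ} (hf : Nice Λ R f) {S : Set (E d)}
    (hS : MeasurableSet S) : Nice Λ R (S.indicator f) where
  meas := hf.meas.indicator hS
  bound x := by
    by_cases hx : x ∈ S
    · rw [indicator_of_mem hx]; exact hf.bound x
    · rw [indicator_of_notMem hx, abs_zero]; exact hf.nonneg
  supp x hx := by
    by_cases h : x ∈ S
    · rw [indicator_of_mem h]; exact hf.supp x hx
    · rw [indicator_of_notMem h]

/-- The X-ray transform of the difference of the averages of `f` at scales `r` and `2 r`. -/
noncomputable def xrayDiff (r : ℝ) (f : E (n + 1) → ℝ) (q : O (n + 1) × E n) : ℝ :=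
  xray q.1 (fun x => avg r f x - avg (2 * r) f x) q.2

/-- Since 2r < 2, the support radius R + 2 serves all scales at once. -/
theorem Nice.diff {d : ℕ} {f : E d → ℝ} (hf : Nice Λ R f) {r : ℝ} (hr : 0 < r) (hr1 : r < 1) :
    Nice (2 * Λ) (R + 2) fun x => KPlane.avg r f x - KPlane.avg (2 * r) f x :=
  ((hf.avg hr).sub (hf.avg (show 0 < 2 * r by positivity))).mono (by linarith)
    (max_le (by linarith) (by linarith))

theorem Nice.xrayDiff_bound {f : E (n + 1) → ℝ} (hf : Nice Λ R f) (hR : 0 ≤ R) {r : ℝ}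
    (hr : 0 < r) (hr1 : r < 1) (q : O (n + 1) × E n) :
    |xrayDiff r f q| ≤ 4 * (R + 2) * Λ := by
  refine (((hf.diff hr hr1).xray (by linarith) q.1).bound q.2).trans_eq ?_
  ring

theorem Nice.measurable_xrayDiff {f : E (n + 1) → ℝ} (hf : Nice Λ R f) {r : ℝ}
    (hr : 0 < r) (hr1 : r < 1) : Measurable (xrayDiff (n := n) r f) :=
  measurable_xray (hf.diff hr hr1).meas

theorem Nice.xrayDiff_sub {Λ' : ℝ} {f g : E (n + 1) → ℝ} (hf : Nice Λ R f)
    (hg : Nice Λ' R g) {r : ℝ} (hr : 0 < r) (hr1 : r < 1) (q : O (n + 1) × E n) :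
    xrayDiff r (fun x => f x - g x) q = xrayDiff r f q - xrayDiff r g q := by
  unfold xrayDiff
  rw [← (hf.diff hr hr1).xray_sub (hg.diff hr hr1)]
  congr 1
  funext x
  rw [hf.avg_sub hg, hf.avg_sub hg]
  ring

theorem lintegral_xrayDiff_sq (n : ℕ) : ∃ C : ℝ≥0∞, C ≠ ∞ ∧ ∀ (Λ R : ℝ), 0 ≤ R →
    ∀ f : E (n + 1) → ℝ, Nice Λ R f → ∀ r : ℝ, 0 < r → r < 1 →
    ∫⁻ q, ‖xrayDiff r f q‖ₑ ^ 2 ∂((haarO (n + 1)).prod volume) ≤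
      C * ENNReal.ofReal r * ∫⁻ x, ‖f x‖ₑ ^ 2 := by
  obtain ⟨C, hC, h⟩ := exists_xray_sq_le n
  refine ⟨C, hC, fun Λ R hR f hf r hr hr1 => ?_⟩
  rw [lintegral_prod _ ((hf.measurable_xrayDiff hr hr1).enorm.pow_const 2).aemeasurable]
  exact h Λ R hR f hf r hr

/-- The `L^p` smoothing estimate for the X-ray transform, `2 ≤ p`. -/
theorem exists_xrayDiff_rpow_le (n : ℕ) (hR : 0 ≤ R) {p : ℝ} (hp : 2 ≤ p) :
    ∃ C : ℝ≥0∞, C ≠ ∞ ∧ ∀ (Λ : ℝ) (f : E (n + 1) → ℝ), Nice Λ R f → ∀ r : ℝ, 0 < r → r < 1 →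
    ∫⁻ q, ‖xrayDiff r f q‖ₑ ^ p ∂((haarO (n + 1)).prod volume) ≤
      C * ENNReal.ofReal r * ∫⁻ x, ‖f x‖ₑ ^ p := by
  obtain ⟨C, hC, hsq⟩ := lintegral_xrayDiff_sq n
  -- The argument below uses a layer-cake formula of exponent p - 2 > 0; at p = 2 the L² estimate is
  -- the claim.
  rcases hp.eq_or_lt with rfl | hp2
  · refine ⟨C, hC, fun Λ f hf r hr hr1 => ?_⟩
    simpa using hsq Λ R hR f hf r hr hr1
  -- Chosen so that the part of f with |f| ≤ ct has transform at most 4(R + 2)ct = t/2.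
  set c : ℝ := (8 * (R + 2))⁻¹ with hc
  have hc0 : 0 < c := by positivity
  have hpt : 0 < p - 2 := by linarith
  refine ⟨ENNReal.ofReal p * (4 * C) * ((ENNReal.ofReal (p - 2))⁻¹ *
    ENNReal.ofReal (c⁻¹ ^ (p - 2))), ?_, fun Λ f hf r hr hr1 => ?_⟩
  · refine ENNReal.mul_ne_top (ENNReal.mul_ne_top ENNReal.ofReal_ne_top
      (ENNReal.mul_ne_top (by simp) hC)) (ENNReal.mul_ne_top ?_ ENNReal.ofReal_ne_top)
    exact ENNReal.inv_ne_top.2 (by simpa using hpt)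
  set P := (haarO (n + 1)).prod (volume : Measure (E n)) with hP
  -- With density |f|², the layer-cake formula of exponent p - 2 for ν recovers the integral of
  -- |f|^p.
  set ν : Measure (E (n + 1)) := volume.withDensity fun x => ‖f x‖ₑ ^ 2 with hν
  have hfm : Measurable fun x => |f x| := hf.meas.abs
  have hTm := hf.measurable_xrayDiff hr hr1
  -- Where the transform of f exceeds t, that of the part with |f| > ct is at least t/2; Chebyshev
  -- and the L² estimate are applied to this part.
  have hweak : ∀ t : ℝ, 0 < t → P {q | t < |xrayDiff r f q|} ≤
      4 * C * ENNReal.ofReal r * (ENNReal.ofReal (t ^ 2))⁻¹ * ν {x | t < c⁻¹ * |f x|} := by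
    intro t ht
    have hS : MeasurableSet {x | t < c⁻¹ * |f x|} :=
      measurableSet_lt measurable_const (hfm.const_mul _)
    have hf1 := hf.restrict hS
    have hf2 : Nice (c * t) R ({x | t < c⁻¹ * |f x|}ᶜ.indicator f) := by
      refine ⟨hf.meas.indicator hS.compl, fun x => ?_, (hf.restrict hS.compl).supp⟩
      by_cases hx : x ∈ {x | t < c⁻¹ * |f x|}ᶜ
      · rw [indicator_of_mem hx]
        simp only [mem_compl_iff, mem_ofPred_eq, not_lt] at hx
        rwa [inv_mul_le_iff₀ hc0] at hx
      · rw [indicator_of_notMem hx, abs_zero]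
        positivity
    have hsplit : ∀ q : O (n + 1) × E n, xrayDiff r ({x | t < c⁻¹ * |f x|}ᶜ.indicator f) q =
        xrayDiff r f q - xrayDiff r ({x | t < c⁻¹ * |f x|}.indicator f) q := by
      intro q
      rw [← hf.xrayDiff_sub hf1 hr hr1]
      congr 1
      funext x
      rw [indicator_compl]
      rfl
    have hsub : {q | t < |xrayDiff r f q|} ⊆
        {q : O (n + 1) × E n | ENNReal.ofReal ((t / 2) ^ 2) ≤
          ‖xrayDiff r ({x | t < c⁻¹ * |f x|}.indicator f) q‖ₑ ^ 2} := by
      intro q hq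
      have h1 := hf2.xrayDiff_bound hR hr hr1 q
      rw [hsplit] at h1
      have h2 : 4 * (R + 2) * (c * t) = t / 2 := by
        rw [hc]; field_simp; norm_num
      rw [h2] at h1
      have hq' : t < |xrayDiff r f q| := hq
      have h3 : t / 2 ≤ |xrayDiff r ({x | t < c⁻¹ * |f x|}.indicator f) q| := by
        have := abs_sub_abs_le_abs_sub (xrayDiff r f q)
          (xrayDiff r ({x | t < c⁻¹ * |f x|}.indicator f) q)
        linarith
      rw [mem_ofPred_eq, Real.enorm_eq_ofReal_abs, ← ENNReal.ofReal_pow (abs_nonneg _)]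
      exact ENNReal.ofReal_le_ofReal (pow_le_pow_left₀ (by positivity) h3 2)
    have hsq0 : ENNReal.ofReal ((t / 2) ^ 2) ≠ 0 := by
      have : 0 < (t / 2) ^ 2 := by positivity
      simpa using this.ne'
    calc P {q | t < |xrayDiff r f q|}
        ≤ (ENNReal.ofReal ((t / 2) ^ 2))⁻¹ *
          ∫⁻ q, ‖xrayDiff r ({x | t < c⁻¹ * |f x|}.indicator f) q‖ₑ ^ 2 ∂P := by
          refine (measure_mono hsub).trans ?_
          rw [mul_comm, ← div_eq_mul_inv]
          exact meas_ge_le_lintegral_div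
            ((hf1.measurable_xrayDiff hr hr1).enorm.pow_const 2).aemeasurable hsq0
            ENNReal.ofReal_ne_top
      _ ≤ (ENNReal.ofReal ((t / 2) ^ 2))⁻¹ * (C * ENNReal.ofReal r *
          ∫⁻ x, ‖{x | t < c⁻¹ * |f x|}.indicator f x‖ₑ ^ 2) := by
          gcongr
          exact hsq Λ R hR _ hf1 r hr hr1
      _ = _ := by
          have e1 : ∫⁻ x, ‖{x | t < c⁻¹ * |f x|}.indicator f x‖ₑ ^ 2 =
              ν {x | t < c⁻¹ * |f x|} := by
            rw [hν, withDensity_apply _ hS, ← lintegral_indicator hS]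
            refine lintegral_congr fun x => ?_
            by_cases hx : x ∈ {x | t < c⁻¹ * |f x|}
            · rw [indicator_of_mem hx, indicator_of_mem hx]
            · rw [indicator_of_notMem hx, indicator_of_notMem hx]; simp
          have e2 : (ENNReal.ofReal ((t / 2) ^ 2))⁻¹ = 4 * (ENNReal.ofReal (t ^ 2))⁻¹ := by
            rw [show (t / 2) ^ 2 = t ^ 2 / 4 by ring, ENNReal.ofReal_div_of_pos (by norm_num),
              ENNReal.ofReal_ofNat, ENNReal.inv_div (by simp) (by simp), div_eq_mul_inv]
          rw [e1, e2]
          ring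
  have hlay := lintegral_rpow_eq_lintegral_meas_lt_mul P (f := fun q => |xrayDiff r f q|)
    (ae_of_all _ fun _ => abs_nonneg _) hTm.abs.aemeasurable (show 0 < p by linarith)
  have hlay2 := lintegral_rpow_eq_lintegral_meas_lt_mul ν (f := fun x => c⁻¹ * |f x|)
    (ae_of_all _ fun _ => by positivity) (hfm.const_mul _).aemeasurable hpt
  have e0 : ∫⁻ q, ‖xrayDiff r f q‖ₑ ^ p ∂P = ∫⁻ q, ENNReal.ofReal (|xrayDiff r f q| ^ p) ∂P := by
    refine lintegral_congr fun q => ?_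
    rw [Real.enorm_eq_ofReal_abs, ENNReal.ofReal_rpow_of_nonneg (abs_nonneg _) (by linarith)]
  have e3 : ∫⁻ x, ENNReal.ofReal ((c⁻¹ * |f x|) ^ (p - 2)) ∂ν =
      ENNReal.ofReal (c⁻¹ ^ (p - 2)) * ∫⁻ x, ‖f x‖ₑ ^ p := by
    rw [hν, lintegral_withDensity_eq_lintegral_mul _ (hf.meas.enorm.pow_const 2)
      (by fun_prop), ← lintegral_const_mul _ (hf.meas.enorm.pow_const p)]
    refine lintegral_congr fun x => ?_
    simp only [Pi.mul_apply]
    rw [Real.mul_rpow (by positivity) (abs_nonneg _), ENNReal.ofReal_mul (by positivity),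
      Real.enorm_eq_ofReal_abs, mul_left_comm, ENNReal.ofReal_rpow_of_nonneg (abs_nonneg _)
      (by linarith), ← ENNReal.ofReal_pow (abs_nonneg _), ← ENNReal.ofReal_mul (by positivity)]
    congr 2
    rw [← Real.rpow_natCast, ← Real.rpow_add_of_nonneg (abs_nonneg _) (by norm_num) hpt.le]
    norm_num
  rw [e0, hlay]
  calc _ ≤ ENNReal.ofReal p * ∫⁻ t in Ioi (0 : ℝ), 4 * C * ENNReal.ofReal r *
        (ν {x | t < c⁻¹ * |f x|} * ENNReal.ofReal (t ^ (p - 2 - 1))) := by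
        refine mul_le_mul_right (setLIntegral_mono' measurableSet_Ioi fun t ht => ?_) _
        have ht0 : 0 < t := ht
        refine (mul_le_mul_left (hweak t ht0) _).trans_eq ?_
        have e4 : (ENNReal.ofReal (t ^ 2))⁻¹ * ENNReal.ofReal (t ^ (p - 1)) =
            ENNReal.ofReal (t ^ (p - 2 - 1)) := by
          rw [← ENNReal.ofReal_inv_of_pos (by positivity), ← ENNReal.ofReal_mul (by positivity)]
          congr 1
          rw [← Real.rpow_natCast, ← Real.rpow_neg ht0.le, ← Real.rpow_add ht0]
          congr 1
          push_cast
          ring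
        rw [← e4]
        ring
    _ = ENNReal.ofReal p * (4 * C * ENNReal.ofReal r * ∫⁻ t in Ioi (0 : ℝ),
        (ν {x | t < c⁻¹ * |f x|} * ENNReal.ofReal (t ^ (p - 2 - 1)))) := by
        rw [lintegral_const_mul']
        exact ENNReal.mul_ne_top (ENNReal.mul_ne_top (by simp) hC) ENNReal.ofReal_ne_top
    _ = ENNReal.ofReal p * (4 * C * ENNReal.ofReal r * ((ENNReal.ofReal (p - 2))⁻¹ *
        (ENNReal.ofReal (c⁻¹ ^ (p - 2)) * ∫⁻ x, ‖f x‖ₑ ^ p))) := by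
        rw [← e3, hlay2, ← mul_assoc (ENNReal.ofReal (p - 2))⁻¹, ENNReal.inv_mul_cancel, one_mul]
        · simpa using hpt
        · exact ENNReal.ofReal_ne_top
    _ = _ := by ring

end Interpolation

/-! ### Ball averages of [0,∞]-valued functions. -/

section AverageENNReal

variable {d k n m : ℕ}

/-- The averages of a `[0,∞]`-valued function over balls of radius `r`. -/
noncomputable def lavg (r : ℝ) (F : E d → ℝ≥0∞) (x : E d) : ℝ≥0∞ := ∫⁻ z, F (x + z) ∂unif d r

theorem lavg_eq (r : ℝ) (F : E d → ℝ≥0∞) (x : E d) :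
    lavg r F x = (volume (Metric.ball (0 : E d) r))⁻¹ * ∫⁻ u in Metric.ball x r, F u := by
  rw [lavg, lintegral_unif]
  congr 1
  rw [← lintegral_indicator Metric.isOpen_ball.measurableSet,
    ← lintegral_indicator Metric.isOpen_ball.measurableSet,
    ← lintegral_add_left_eq_self ((Metric.ball x r).indicator F) x]
  refine lintegral_congr fun z => ?_
  have : x + z ∈ Metric.ball x r ↔ z ∈ Metric.ball (0 : E d) r := by
    simp [dist_eq_norm]
  by_cases hz : z ∈ Metric.ball (0 : E d) r
  · rw [indicator_of_mem hz, indicator_of_mem (this.2 hz)]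
  · rw [indicator_of_notMem hz, indicator_of_notMem (fun h => hz (this.1 h))]

/-- Up to a constant this is the mass under F dx of an open ball that moves with its centre; no
regularity of F enters. -/
theorem lowerSemicontinuous_lavg {r : ℝ} (hr : 0 < r) {F : E d → ℝ≥0∞} :
    LowerSemicontinuous (lavg r F) := by
  have : lavg r F = fun x => (volume (Metric.ball (0 : E d) r))⁻¹ *
      (volume.withDensity F) (Metric.ball x r) := by
    funext x
    rw [lavg_eq, withDensity_apply _ Metric.isOpen_ball.measurableSet]
  rw [this]
  refine (ENNReal.continuous_const_mul ?_).comp_lowerSemicontinuous ?_ ?_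
  · exact ENNReal.inv_ne_top.2 (Metric.measure_ball_pos _ _ hr).ne'
  · refine lowerSemicontinuous_measure (fun _ => Metric.isOpen_ball.measurableSet) fun y => ?_
    simp only [Metric.mem_ball, dist_comm y]
    exact Metric.isOpen_ball
  · exact fun x y h => mul_le_mul_right h _

theorem measurable_lavg {r : ℝ} (hr : 0 < r) {F : E d → ℝ≥0∞} : Measurable (lavg r F) :=
  (lowerSemicontinuous_lavg hr).measurable

theorem lavg_mono (r : ℝ) {F G : E d → ℝ≥0∞} (h : ∀ x, F x ≤ G x) (x : E d) :
    lavg r F x ≤ lavg r G x := lintegral_mono fun _ => h _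

theorem avg_nonneg (r : ℝ) {f : E d → ℝ} (hf : ∀ x, 0 ≤ f x) (x : E d) : 0 ≤ avg r f x :=
  integral_nonneg fun _ => hf _

theorem Nice.enorm_avg {Λ R : ℝ} {f : E d → ℝ} (hf : Nice Λ R f) (h0 : ∀ x, 0 ≤ f x) (r : ℝ)
    (x : E d) : ‖KPlane.avg r f x‖ₑ = lavg r (fun x => ‖f x‖ₑ) x := by
  rw [Real.enorm_eq_ofReal (avg_nonneg r h0 x), KPlane.avg,
    ofReal_integral_eq_lintegral_ofReal (hf.integrable_unif x r) (ae_of_all _ fun _ => h0 _)]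
  refine lintegral_congr fun z => ?_
  exact (Real.enorm_eq_ofReal (h0 _)).symm

theorem Nice.enorm_avg_avg {Λ R : ℝ} {f : E d → ℝ} (hf : Nice Λ R f) (h0 : ∀ x, 0 ≤ f x) {r : ℝ}
    (hr : 0 < r) (x : E d) :
    ‖KPlane.avg r (KPlane.avg r f) x‖ₑ = lavg r (lavg r fun x => ‖f x‖ₑ) x := by
  rw [(hf.avg hr).enorm_avg (avg_nonneg r h0)]
  congr 1
  funext x
  exact hf.enorm_avg h0 r x

theorem iSup_lavg (r : ℝ) {F : ℕ → E d → ℝ≥0∞} (hm : ∀ i, Measurable (F i)) (hF : Monotone F)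
    (x : E d) : lavg r (fun x => ⨆ i, F i x) x = ⨆ i, lavg r (F i) x :=
  lintegral_iSup (fun i => (hm i).comp (measurable_const_add x)) fun _ _ h _ => hF h _

theorem iSup_supInt {F : ℕ → E d → ℝ≥0∞} (hm : ∀ i, Measurable (F i)) (hF : Monotone F)
    (L : Gr d k) : supInt (fun x => ⨆ i, F i x) L = ⨆ i, supInt (F i) L := by
  unfold supInt
  rw [iSup_comm]
  congr 1
  funext x
  exact lintegral_iSup (fun i => (hm i).comp (by fun_prop)) fun _ _ h _ => hF h _

end AverageENNReal

/-! ### The starting scale of the telescoping sum. -/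

section LowFrequency

variable {d k : ℕ} {Λ R : ℝ}

theorem rpow_setLIntegral_ball_le (d : ℕ) (R : ℝ) {p : ℝ} (hp : 1 < p) {F : E d → ℝ≥0∞}
    (hF : Measurable F) (hs : ∀ x, R ≤ ‖x‖ → F x = 0) :
    (∫⁻ x, F x) ^ p ≤ volume (Metric.ball (0 : E d) R) ^ (p - 1) * ∫⁻ x, F x ^ p := by
  have hp0 : 0 < p := by linarith
  have hq := Real.HolderConjugate.conjExponent hp
  have h1 := ENNReal.lintegral_mul_le_Lp_mul_Lq volume hq hF.aemeasurable
    (g := (Metric.ball (0 : E d) R).indicator (1 : E d → ℝ≥0∞))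
    ((measurable_one.indicator Metric.isOpen_ball.measurableSet).aemeasurable)
  have h2 : ∀ x, (F * (Metric.ball (0 : E d) R).indicator (1 : E d → ℝ≥0∞)) x = F x := by
    intro x
    by_cases hx : x ∈ Metric.ball (0 : E d) R
    · rw [Pi.mul_apply, indicator_of_mem hx, Pi.one_apply, mul_one]
    · rw [Pi.mul_apply, indicator_of_notMem hx, mul_zero, hs x (by simpa using hx)]
  have h3 : ∀ x, (Metric.ball (0 : E d) R).indicator (1 : E d → ℝ≥0∞) x ^ p.conjExponent =
      (Metric.ball (0 : E d) R).indicator (1 : E d → ℝ≥0∞) x := by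
    intro x
    by_cases hx : x ∈ Metric.ball (0 : E d) R
    · rw [indicator_of_mem hx, Pi.one_apply, ENNReal.one_rpow]
    · rw [indicator_of_notMem hx, ENNReal.zero_rpow_of_pos hq.symm.pos]
  simp_rw [h2, h3] at h1
  rw [lintegral_indicator_one Metric.isOpen_ball.measurableSet] at h1
  calc (∫⁻ x, F x) ^ p ≤ _ := ENNReal.rpow_le_rpow h1 hp0.le
    _ = _ := by
      rw [ENNReal.mul_rpow_of_nonneg _ _ hp0.le, ← ENNReal.rpow_mul, ← ENNReal.rpow_mul,
        one_div_mul_cancel hp0.ne', ENNReal.rpow_one, mul_comm]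
      congr 2
      rw [Real.conjExponent]
      field_simp

/-- At a fixed scale no smoothing is needed: the double average is bounded by the L¹ norm of F,
vanishes outside a fixed ball, and a plane meets that ball in bounded measure. Hölder passes from L¹
to L^p. -/
theorem exists_supInt_lavg_lavg_le (d k : ℕ) (R : ℝ) {p : ℝ} (hp : 1 < p) {r : ℝ}
    (hr : 0 < r) : ∃ C : ℝ≥0∞, C ≠ ∞ ∧ ∀ F : E d → ℝ≥0∞, Measurable F →
      (∀ x, R ≤ ‖x‖ → F x = 0) → ∀ L : Gr d k,
      supInt (lavg r (lavg r F)) L ^ p ≤ C * ∫⁻ x, F x ^ p := by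
  have hp0 : 0 < p := by linarith
  set V := volume (Metric.ball (0 : E d) r) with hV
  set s := |R| + 2 * r with hs
  have hs0 : 0 < s := by positivity
  set A := ENNReal.ofReal (2 * s) ^ k * unitVol k with hA
  have hAt : A ≠ ∞ := ENNReal.mul_ne_top (ofReal_pow_ne_top _ _) (unitVol_ne_top k)
  have hVt : V⁻¹ ≠ ∞ := ENNReal.inv_ne_top.2 (Metric.measure_ball_pos _ _ hr).ne'
  have hprob := isProbabilityMeasure_unif d hr
  refine ⟨(V⁻¹ * A) ^ p * volume (Metric.ball (0 : E d) R) ^ (p - 1), ?_,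
    fun F hF hsupp L => ?_⟩
  · refine ENNReal.mul_ne_top
      (ENNReal.rpow_ne_top_of_nonneg hp0.le (ENNReal.mul_ne_top hVt hAt))
      (ENNReal.rpow_ne_top_of_nonneg (by linarith) measure_ball_lt_top.ne)
  obtain ⟨U, hU⟩ := exists_isometry L
  have h1 : ∀ x, lavg r F x ≤ V⁻¹ * ∫⁻ x, F x := fun x => by
    rw [lavg_eq]
    exact mul_le_mul_right (setLIntegral_le_lintegral _ _) _
  have h2 : ∀ x, lavg r (lavg r F) x ≤ V⁻¹ * ∫⁻ x, F x := fun x =>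
    (lintegral_mono fun z => h1 _).trans_eq (by rw [lintegral_const, measure_univ, mul_one])
  have h3 : ∀ x, R + r ≤ ‖x‖ → lavg r F x = 0 := fun x hx => by
    refine (lintegral_eq_zero_iff (hF.comp (measurable_const_add x))).2 ?_
    filter_upwards [ae_unif d r] with z hz
    refine hsupp _ ?_
    have : ‖x‖ ≤ ‖x + z‖ + ‖z‖ := by
      calc ‖x‖ = ‖(x + z) - z‖ := by congr 1; abel
        _ ≤ _ := norm_sub_le _ _
    linarith
  have h4 : ∀ x, s ≤ ‖x‖ → lavg r (lavg r F) x = 0 := fun x hx => by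
    refine (lintegral_eq_zero_iff ((measurable_lavg hr).comp (measurable_const_add x))).2 ?_
    filter_upwards [ae_unif d r] with z hz
    refine h3 _ ?_
    have : ‖x‖ ≤ ‖x + z‖ + ‖z‖ := by
      calc ‖x‖ = ‖(x + z) - z‖ := by congr 1; abel
        _ ≤ _ := norm_sub_le _ _
    have := le_abs_self R
    linarith
  have h5 : supInt (lavg r (lavg r F)) L ≤ V⁻¹ * A * ∫⁻ x, F x := by
    rw [supInt_eq hU]
    refine iSup_le fun x => ?_
    have hS : MeasurableSet {v : E k | ‖-x - U v‖ < s} :=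
      measurableSet_lt (by fun_prop) measurable_const
    calc ∫⁻ v, lavg r (lavg r F) (x + U v)
        ≤ ∫⁻ v, {v : E k | ‖-x - U v‖ < s}.indicator (fun _ => V⁻¹ * ∫⁻ x, F x) v := by
          refine lintegral_mono fun v => ?_
          by_cases hv : v ∈ {v : E k | ‖-x - U v‖ < s}
          · rw [indicator_of_mem hv]; exact h2 _
          · rw [indicator_of_notMem hv, h4]
            rw [mem_ofPred_eq, not_lt] at hv
            rwa [← neg_add', norm_neg] at hv
      _ = V⁻¹ * (∫⁻ x, F x) * volume {v : E k | ‖-x - U v‖ < s} := lintegral_indicator_const hS _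
      _ ≤ V⁻¹ * (∫⁻ x, F x) * A := mul_le_mul_right (volume_norm_sub_lt_le U (-x) hs0) _
      _ = _ := by ring
  calc _ ≤ (V⁻¹ * A * ∫⁻ x, F x) ^ p := ENNReal.rpow_le_rpow h5 hp0.le
    _ = (V⁻¹ * A) ^ p * (∫⁻ x, F x) ^ p := ENNReal.mul_rpow_of_nonneg _ _ hp0.le
    _ ≤ _ := (mul_le_mul_right (rpow_setLIntegral_ball_le d R hp hF hsupp) _).trans_eq (by ring)

end LowFrequency

/-! ### Telescoping over dyadic scales. -/

section Telescoping

variable {n m : ℕ} {Λ R : ℝ}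

/-- The dyadic radii `2^{-(j+1)}`. -/
noncomputable def rad (j : ℕ) : ℝ := (1 / 2) ^ (j + 1)

theorem rad_pos (j : ℕ) : 0 < rad j := by unfold rad; positivity

theorem rad_lt_one (j : ℕ) : rad j < 1 := pow_lt_one₀ (by norm_num) (by norm_num) (by simp)

theorem two_mul_rad (j : ℕ) : 2 * rad (j + 1) = rad j := by
  unfold rad; rw [pow_succ _ (j + 1)]; ring

/-- The sum over two consecutive scales of the plate averages of an X-ray difference. -/
noncomputable def scaleTerm (f : E (n + 1) → ℝ) (θ : O (n + 1)) (j : ℕ) (L : Gr n m) : ℝ≥0∞ :=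
  supAvg (rad (j + 1)) (fun y => ‖xrayDiff (rad (j + 1)) f (θ, y)‖ₑ) L +
    supAvg (rad j) (fun y => ‖xrayDiff (rad (j + 1)) f (θ, y)‖ₑ) L

theorem measurable_scaleTerm (f : E (n + 1) → ℝ) (θ : O (n + 1)) (j : ℕ) :
    Measurable (scaleTerm f θ j : Gr n m → ℝ≥0∞) :=
  (lowerSemicontinuous_supAvg (rad_pos _) _).measurable.add
    (lowerSemicontinuous_supAvg (rad_pos _) _).measurable

/-- A_r² - A_{2r}² = (A_r + A_{2r})(A_r - A_{2r}) because averages commute. Averaging twice is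
essential: one factor turns plane integrals into plate averages, the other supplies the difference
to which the X-ray estimate applies. -/
theorem exists_supInt_succ_le (n m : ℕ) (hR : 0 ≤ R) : ∃ C : ℝ≥0∞, C ≠ ∞ ∧
    ∀ (Λ : ℝ) (f : E (n + 1) → ℝ), Nice Λ R f → (∀ x, 0 ≤ f x) →
    ∀ (θ : O (n + 1)) (L : Gr n m) (j : ℕ),
    supInt (lavg (rad (j + 1)) (lavg (rad (j + 1)) fun x => ‖f x‖ₑ)) (rotate θ (lift L)) ≤
      supInt (lavg (rad j) (lavg (rad j) fun x => ‖f x‖ₑ)) (rotate θ (lift L)) +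
        C * scaleTerm f θ j L := by
  obtain ⟨C, hC, h⟩ := enorm_integral_plane_le n m (show 0 ≤ R + 2 by linarith)
  refine ⟨C, hC, fun Λ f hf h0 θ L j => ?_⟩
  obtain ⟨U, hU⟩ := exists_isometry L
  set V := rotIso θ (consIso U) with hV
  have hVr : LinearMap.range V.toLinearMap = (rotate θ (lift L)).1 :=
    range_rotIso (range_consIso hU) θ
  set r := rad (j + 1) with hr
  have hr0 : 0 < r := rad_pos _
  have hr1 : r < 1 := rad_lt_one _
  have h2r : rad j = 2 * r := (two_mul_rad j).symm
  have h2r0 : 0 < 2 * r := by linarith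
  have h2r1 : 2 * r < 1 := h2r ▸ rad_lt_one j
  set D : E (n + 1) → ℝ := fun x => avg r f x - avg (2 * r) f x with hD
  have hDn : Nice (2 * Λ) (R + 2) D := hf.diff hr0 hr1
  -- Because f ≥ 0, the integrals in [0,∞] are real integrals, in which differences of scales make
  -- sense.
  have hBB : ∀ s, 0 < s → ∀ x, ∫⁻ v, lavg s (lavg s fun x => ‖f x‖ₑ) (x + V v) =
      ‖∫ v, avg s (avg s f) (x + V v)‖ₑ := by
    intro s hs x
    have hn := (hf.avg hs).avg hs
    have hnn : ∀ x, 0 ≤ avg s (avg s f) x := avg_nonneg s (avg_nonneg s h0)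
    rw [Real.enorm_eq_ofReal (integral_nonneg fun v => hnn _),
      ofReal_integral_eq_lintegral_ofReal (hn.integrable_comp_isometry V x)
        (ae_of_all _ fun v => hnn _)]
    refine lintegral_congr fun v => ?_
    rw [← hf.enorm_avg_avg h0 hs, Real.enorm_eq_ofReal (hnn _)]
  have hpt : ∀ x, avg r (avg r f) x =
      avg (2 * r) (avg (2 * r) f) x + (avg r D x + avg (2 * r) D x) := by
    intro x
    rw [hD, (hf.avg hr0).avg_sub (hf.avg h2r0), (hf.avg hr0).avg_sub (hf.avg h2r0),
      hf.avg_comm r (2 * r)]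
    ring
  rw [h2r, supInt_eq hVr, supInt_eq hVr]
  refine iSup_le fun x => ?_
  rw [hBB r hr0]
  simp_rw [hpt]
  have hi1 := (hDn.avg hr0).integrable_comp_isometry V x
  have hi2 := (hDn.avg h2r0).integrable_comp_isometry V x
  rw [integral_add (((hf.avg h2r0).avg h2r0).integrable_comp_isometry V x)
      (show Integrable (fun v => avg r D (x + V v) + avg (2 * r) D (x + V v)) from hi1.add hi2),
    integral_add hi1 hi2]
  refine (enorm_add_le _ _).trans (add_le_add ?_ ((enorm_add_le _ _).trans ?_))
  · rw [← hBB _ h2r0]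
    exact le_iSup (fun x => ∫⁻ v, lavg (2 * r) (lavg (2 * r) fun x => ‖f x‖ₑ) (x + V v)) x
  · rw [scaleTerm, mul_add, h2r]
    exact add_le_add (h r hr0 hr1 L U hU _ D hDn θ x) (h _ h2r0 h2r1 L U hU _ D hDn θ x)

theorem exists_supInt_telescope_le (n m : ℕ) (hR : 0 ≤ R) : ∃ C : ℝ≥0∞, C ≠ ∞ ∧
    ∀ (Λ : ℝ) (f : E (n + 1) → ℝ), Nice Λ R f → (∀ x, 0 ≤ f x) →
    ∀ (θ : O (n + 1)) (L : Gr n m) (J : ℕ),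
    supInt (lavg (rad J) (lavg (rad J) fun x => ‖f x‖ₑ)) (rotate θ (lift L)) ≤
      supInt (lavg (rad 0) (lavg (rad 0) fun x => ‖f x‖ₑ)) (rotate θ (lift L)) +
        C * ∑ j ∈ Finset.range J, scaleTerm f θ j L := by
  obtain ⟨C, hC, h⟩ := exists_supInt_succ_le n m hR
  refine ⟨C, hC, fun Λ f hf h0 θ L J => ?_⟩
  induction J with
  | zero => simp
  | succ J ih =>
    refine (h Λ f hf h0 θ L J).trans ((add_le_add_left ih _).trans_eq ?_)
    rw [Finset.sum_range_succ, mul_add, add_assoc]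

end Telescoping

/-! ### The L^p bound for plane integrals of double averages. -/

section KeyEstimate

variable {n m : ℕ} {R p α : ℝ}

/-- The `L^p` bound with constant `A δ^{-α}` for the plate maximal function, on bounded functions of
bounded support. -/
def PlateBound (n m : ℕ) (p α : ℝ) (A : ℝ≥0∞) : Prop :=
  ∀ δ : ℝ, 0 < δ → δ < 1 → ∀ (Λ R : ℝ) (h : E n → ℝ), Nice Λ R h →
    ∫⁻ L : Gr n m, supAvg δ (fun y => ‖h y‖ₑ) L ^ p ∂gamma n m ≤
      A * ENNReal.ofReal (δ ^ (-α)) * ∫⁻ y, ‖h y‖ₑ ^ p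

/-- The weight of the scale `2^{-(j+2)}`. -/
noncomputable def weight (p α : ℝ) (j : ℕ) : ℝ≥0∞ := ENNReal.ofReal (rad (j + 1) ^ (-(α - 1) / p))

theorem weight_ne_zero (p α : ℝ) (j : ℕ) : weight p α j ≠ 0 :=
  (ENNReal.ofReal_pos.2 (Real.rpow_pos_of_pos (rad_pos _) _)).ne'

theorem weight_ne_top (p α : ℝ) (j : ℕ) : weight p α j ≠ ∞ := ENNReal.ofReal_ne_top

/-- The loss r^(-α) from the hypothesis times the gain r from the X-ray estimate. -/
theorem weight_rpow (hp : 0 < p) (j : ℕ) :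
    ENNReal.ofReal (rad (j + 1) ^ (-α)) * ENNReal.ofReal (rad (j + 1)) = weight p α j ^ p := by
  have h := rad_pos (j + 1)
  rw [weight, ENNReal.ofReal_rpow_of_nonneg (by positivity) hp.le, ← Real.rpow_mul h.le,
    div_mul_cancel₀ _ hp.ne', ← ENNReal.ofReal_mul (by positivity)]
  congr 1
  nth_rewrite 2 [← Real.rpow_one (rad (j + 1))]
  rw [← Real.rpow_add h]
  congr 1
  ring

/-- Hölder with weights. When the p-th power of S j integrates to at most (w j)^p, the right side
integrates to at most (Σ w j)^p, as Minkowski's inequality would give. -/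
theorem rpow_sum_le_weight (hp : 1 < p) (J : ℕ) (w S : ℕ → ℝ≥0∞) (h0 : ∀ j, w j ≠ 0)
    (ht : ∀ j, w j ≠ ∞) :
    (∑ j ∈ Finset.range J, S j) ^ p ≤ (∑ j ∈ Finset.range J, w j) ^ (p - 1) *
      ∑ j ∈ Finset.range J, w j * ((w j)⁻¹ ^ p * S j ^ p) := by
  have hp0 : 0 < p := by linarith
  have h := ENNReal.inner_le_weight_mul_Lp_of_nonneg (Finset.range J) hp.le w
    fun j => (w j)⁻¹ * S j
  have h1 : ∀ j, w j * ((w j)⁻¹ * S j) = S j := fun j => by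
    rw [← mul_assoc, ENNReal.mul_inv_cancel (h0 j) (ht j), one_mul]
  simp_rw [h1] at h
  calc _ ≤ _ := ENNReal.rpow_le_rpow h hp0.le
    _ = _ := by
      rw [ENNReal.mul_rpow_of_nonneg _ _ hp0.le, ← ENNReal.rpow_mul, ← ENNReal.rpow_mul,
        inv_mul_cancel₀ hp0.ne', ENNReal.rpow_one]
      simp_rw [ENNReal.mul_rpow_of_nonneg _ _ hp0.le]
      congr 2
      field_simp

/-- The hypothesis is applied for fixed θ to the transform at both plate widths; the coarser width,
twice the finer, changes the constant by 2^(-α) only. -/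
theorem PlateBound.exists_lintegral_scaleTerm_le {A : ℝ≥0∞} (hA : PlateBound n m p α A)
    (hAt : A ≠ ∞) (hp : 1 ≤ p) (hR : 0 ≤ R) : ∃ C : ℝ≥0∞, C ≠ ∞ ∧
    ∀ (Λ : ℝ) (f : E (n + 1) → ℝ), Nice Λ R f → ∀ (θ : O (n + 1)) (j : ℕ),
    ∫⁻ L : Gr n m, scaleTerm f θ j L ^ p ∂gamma n m ≤
      C * ENNReal.ofReal (rad (j + 1) ^ (-α)) *
        ∫⁻ y, ‖xrayDiff (rad (j + 1)) f (θ, y)‖ₑ ^ p := by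
  have hp0 : 0 < p := by linarith
  refine ⟨2 ^ (p - 1) * (A + A * ENNReal.ofReal (2 ^ (-α))), ?_, fun Λ f hf θ j => ?_⟩
  · exact ENNReal.mul_ne_top (ENNReal.rpow_ne_top_of_nonneg (by linarith) ENNReal.ofNat_ne_top)
      (ENNReal.add_ne_top.2 ⟨hAt, ENNReal.mul_ne_top hAt ENNReal.ofReal_ne_top⟩)
  have hn : Nice (2 * Λ * (2 * (R + 2))) (R + 2)
      fun y => xrayDiff (rad (j + 1)) f (θ, y) :=
    (hf.diff (rad_pos (j + 1)) (rad_lt_one _)).xray (by linarith : 0 ≤ R + 2) θ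
  have h1 := hA (rad (j + 1)) (rad_pos (j + 1)) (rad_lt_one _) _ _ _ hn
  have h2 := hA (rad j) (rad_pos j) (rad_lt_one _) _ _ _ hn
  have hr : ENNReal.ofReal (rad j ^ (-α)) =
      ENNReal.ofReal (2 ^ (-α)) * ENNReal.ofReal (rad (j + 1) ^ (-α)) := by
    rw [← two_mul_rad j, Real.mul_rpow zero_le_two (rad_pos _).le,
      ENNReal.ofReal_mul (by positivity)]
  rw [hr] at h2
  unfold scaleTerm
  generalize (fun y => ‖xrayDiff (rad (j + 1)) f (θ, y)‖ₑ) = G at h1 h2 ⊢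
  have hm1 := (lowerSemicontinuous_supAvg (rad_pos (j + 1)) G (k := m)).measurable
  calc ∫⁻ L : Gr n m, (supAvg (rad (j + 1)) G L + supAvg (rad j) G L) ^ p ∂gamma n m
      ≤ ∫⁻ L : Gr n m, 2 ^ (p - 1) *
        (supAvg (rad (j + 1)) G L ^ p + supAvg (rad j) G L ^ p) ∂gamma n m :=
        lintegral_mono fun L => ENNReal.rpow_add_le_mul_rpow_add_rpow _ _ hp
    _ = 2 ^ (p - 1) * (∫⁻ L : Gr n m, supAvg (rad (j + 1)) G L ^ p ∂gamma n m +
          ∫⁻ L : Gr n m, supAvg (rad j) G L ^ p ∂gamma n m) := by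
        rw [lintegral_const_mul' _ _
          (ENNReal.rpow_ne_top_of_nonneg (by linarith) ENNReal.ofNat_ne_top),
          lintegral_add_left (hm1.pow_const p)]
    _ ≤ _ := mul_le_mul_right (add_le_add h1 h2) _
    _ = _ := by ring

theorem PlateBound.exists_lintegral_sum_le {A : ℝ≥0∞} (hA : PlateBound n m p α A)
    (hAt : A ≠ ∞) (hp : 2 ≤ p) (hR : 0 ≤ R) : ∃ C : ℝ≥0∞, C ≠ ∞ ∧
    ∀ (Λ : ℝ) (f : E (n + 1) → ℝ), Nice Λ R f → ∀ J : ℕ,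
    ∫⁻ θ, (∫⁻ L : Gr n m, (∑ j ∈ Finset.range J, scaleTerm f θ j L) ^ p ∂gamma n m)
        ∂haarO (n + 1) ≤
      C * (∑ j ∈ Finset.range J, weight p α j) ^ p * ∫⁻ x, ‖f x‖ₑ ^ p := by
  have hp0 : 0 < p := by linarith
  obtain ⟨C₁, hC₁, h1⟩ := hA.exists_lintegral_scaleTerm_le hAt (by linarith) hR
  obtain ⟨C₂, hC₂, h2⟩ := exists_xrayDiff_rpow_le n hR hp
  refine ⟨C₁ * C₂, ENNReal.mul_ne_top hC₁ hC₂, fun Λ f hf J => ?_⟩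
  set W := ∑ j ∈ Finset.range J, weight p α j with hW
  have hWt : W ≠ ∞ := ENNReal.sum_ne_top.2 fun j _ => weight_ne_top _ _ _
  have hWp : W ^ (p - 1) ≠ ∞ := ENNReal.rpow_ne_top_of_nonneg (by linarith) hWt
  set c : ℕ → ℝ≥0∞ := fun j => weight p α j * (weight p α j)⁻¹ ^ p with hc
  have hct : ∀ j, c j ≠ ∞ := fun j => ENNReal.mul_ne_top (weight_ne_top _ _ _)
    (ENNReal.rpow_ne_top_of_nonneg hp0.le (ENNReal.inv_ne_top.2 (weight_ne_zero _ _ _)))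
  have hm : ∀ j, Measurable fun q : O (n + 1) × E n => ‖xrayDiff (rad (j + 1)) f q‖ₑ ^ p :=
    fun j => (hf.measurable_xrayDiff (rad_pos _) (rad_lt_one _)).enorm.pow_const p
  have hinner : ∀ θ : O (n + 1),
      ∫⁻ L : Gr n m, (∑ j ∈ Finset.range J, scaleTerm f θ j L) ^ p ∂gamma n m ≤
      W ^ (p - 1) * ∑ j ∈ Finset.range J, c j * (C₁ * ENNReal.ofReal (rad (j + 1) ^ (-α))) *
        ∫⁻ y, ‖xrayDiff (rad (j + 1)) f (θ, y)‖ₑ ^ p := by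
    intro θ
    calc _ ≤ ∫⁻ L : Gr n m, W ^ (p - 1) *
          ∑ j ∈ Finset.range J, c j * scaleTerm f θ j L ^ p ∂gamma n m := by
          refine lintegral_mono fun L => (rpow_sum_le_weight (by linarith) J (weight p α)
            (fun j => scaleTerm f θ j L) (weight_ne_zero p α) (weight_ne_top p α)).trans_eq ?_
          simp only [hc, mul_assoc, hW]
      _ = W ^ (p - 1) * ∑ j ∈ Finset.range J, c j *
          ∫⁻ L : Gr n m, scaleTerm f θ j L ^ p ∂gamma n m := by
          rw [lintegral_const_mul' _ _ hWp, lintegral_finsetSum _ fun j _ =>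
            ((measurable_scaleTerm f θ j).pow_const p).const_mul (c j)]
          congr 1
          exact Finset.sum_congr rfl fun j _ => lintegral_const_mul' _ _ (hct j)
      _ ≤ _ := by
          refine mul_le_mul_right (Finset.sum_le_sum fun j _ => ?_) _
          rw [mul_assoc (c j)]
          exact mul_le_mul_right (h1 Λ f hf θ j) _
  have hcw : ∀ j, c j * weight p α j ^ p = weight p α j := fun j => by
    rw [hc]
    dsimp only
    rw [mul_assoc, ← ENNReal.mul_rpow_of_nonneg _ _ hp0.le,
      ENNReal.inv_mul_cancel (weight_ne_zero _ _ _) (weight_ne_top _ _ _), ENNReal.one_rpow,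
      mul_one]
  calc _ ≤ _ := lintegral_mono hinner
    _ = W ^ (p - 1) * ∑ j ∈ Finset.range J, c j * (C₁ * ENNReal.ofReal (rad (j + 1) ^ (-α))) *
        ∫⁻ q, ‖xrayDiff (rad (j + 1)) f q‖ₑ ^ p ∂((haarO (n + 1)).prod volume) := by
        rw [lintegral_const_mul' _ _ hWp, lintegral_finsetSum _ fun j _ =>
          ((hm j).lintegral_prod_right').const_mul _]
        congr 1
        refine Finset.sum_congr rfl fun j _ => ?_
        rw [lintegral_const_mul' _ _ (ENNReal.mul_ne_top (hct j)
          (ENNReal.mul_ne_top hC₁ ENNReal.ofReal_ne_top)), lintegral_prod _ (hm j).aemeasurable]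
    _ ≤ W ^ (p - 1) * ∑ j ∈ Finset.range J, c j * (C₁ * ENNReal.ofReal (rad (j + 1) ^ (-α))) *
        (C₂ * ENNReal.ofReal (rad (j + 1)) * ∫⁻ x, ‖f x‖ₑ ^ p) :=
        mul_le_mul_right (Finset.sum_le_sum fun j _ =>
          mul_le_mul_right (h2 Λ f hf _ (rad_pos _) (rad_lt_one _)) _) _
    _ = W ^ (p - 1) * ∑ j ∈ Finset.range J, weight p α j * (C₁ * C₂ * ∫⁻ x, ‖f x‖ₑ ^ p) := by
        congr 1
        refine Finset.sum_congr rfl fun j _ => ?_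
        calc _ = c j * (ENNReal.ofReal (rad (j + 1) ^ (-α)) * ENNReal.ofReal (rad (j + 1))) *
              (C₁ * C₂ * ∫⁻ x, ‖f x‖ₑ ^ p) := by ring
          _ = _ := by rw [weight_rpow hp0, hcw j]
    _ = W ^ (p - 1) * W ^ (1 : ℝ) * (C₁ * C₂ * ∫⁻ x, ‖f x‖ₑ ^ p) := by
        rw [← Finset.sum_mul, ENNReal.rpow_one, mul_assoc (W ^ (p - 1)) W]
    _ = _ := by
        rw [← ENNReal.rpow_add_of_nonneg _ _ (by linarith) zero_le_one, sub_add_cancel]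
        ring

theorem PlateBound.exists_supInt_nice_le [Nonempty (Gr n m)] {A : ℝ≥0∞}
    (hA : PlateBound n m p α A) (hAt : A ≠ ∞) (hp : 2 ≤ p) (hR : 0 ≤ R) : ∃ C : ℝ≥0∞, C ≠ ∞ ∧
    ∀ (Λ : ℝ) (f : E (n + 1) → ℝ), Nice Λ R f → (∀ x, 0 ≤ f x) → ∀ J : ℕ,
    ∫⁻ M : Gr (n + 1) (m + 1), supInt (lavg (rad J) (lavg (rad J) fun x => ‖f x‖ₑ)) M ^ p
        ∂gamma (n + 1) (m + 1) ≤
      C * (1 + (∑ j ∈ Finset.range J, weight p α j) ^ p) * ∫⁻ x, ‖f x‖ₑ ^ p := by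
  have hp0 : 0 < p := by linarith
  obtain ⟨C₁, hC₁, h1⟩ := exists_supInt_telescope_le n m hR
  obtain ⟨C₂, hC₂, h2⟩ := hA.exists_lintegral_sum_le hAt hp hR
  obtain ⟨C₃, hC₃, h3⟩ := exists_supInt_lavg_lavg_le (n + 1) (m + 1) R (p := p) (by linarith)
    (rad_pos 0)
  have h2p : (2 : ℝ≥0∞) ^ (p - 1) ≠ ∞ :=
    ENNReal.rpow_ne_top_of_nonneg (by linarith) ENNReal.ofNat_ne_top
  have hC₁p : C₁ ^ p ≠ ∞ := ENNReal.rpow_ne_top_of_nonneg hp0.le hC₁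
  refine ⟨2 ^ (p - 1) * (C₃ + C₁ ^ p * C₂), ENNReal.mul_ne_top h2p
    (ENNReal.add_ne_top.2 ⟨hC₃, ENNReal.mul_ne_top hC₁p hC₂⟩), fun Λ f hf h0 J => ?_⟩
  set N := ∫⁻ x, ‖f x‖ₑ ^ p
  set W := ∑ j ∈ Finset.range J, weight p α j with hW
  have hms : Measurable fun M : Gr (n + 1) (m + 1) =>
      supInt (lavg (rad J) (lavg (rad J) fun x => ‖f x‖ₑ)) M ^ p :=
    (lowerSemicontinuous_supInt (lowerSemicontinuous_lavg (rad_pos J))).measurable.pow_const p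
  rw [lintegral_gamma_lift hms]
  have hpt : ∀ (θ : O (n + 1)) (L : Gr n m),
      supInt (lavg (rad J) (lavg (rad J) fun x => ‖f x‖ₑ)) (rotate θ (lift L)) ^ p ≤
      2 ^ (p - 1) * (C₃ * N) +
        2 ^ (p - 1) * C₁ ^ p * (∑ j ∈ Finset.range J, scaleTerm f θ j L) ^ p := by
    intro θ L
    refine (ENNReal.rpow_le_rpow (h1 Λ f hf h0 θ L J) hp0.le).trans ?_
    refine (ENNReal.rpow_add_le_mul_rpow_add_rpow _ _ (by linarith)).trans ?_
    rw [mul_add, ENNReal.mul_rpow_of_nonneg _ _ hp0.le, mul_assoc]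
    refine add_le_add_left (mul_le_mul_right (h3 _ hf.meas.enorm (fun x hx => ?_) _) _) _
    rw [hf.supp x hx, enorm_zero]
  calc _ ≤ ∫⁻ θ, (∫⁻ L : Gr n m, (2 ^ (p - 1) * (C₃ * N) +
        2 ^ (p - 1) * C₁ ^ p * (∑ j ∈ Finset.range J, scaleTerm f θ j L) ^ p) ∂gamma n m)
          ∂haarO (n + 1) := lintegral_mono fun θ => lintegral_mono fun L => hpt θ L
    _ = 2 ^ (p - 1) * (C₃ * N) + 2 ^ (p - 1) * C₁ ^ p *
        ∫⁻ θ, (∫⁻ L : Gr n m, (∑ j ∈ Finset.range J, scaleTerm f θ j L) ^ p ∂gamma n m)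
          ∂haarO (n + 1) := by
        simp_rw [lintegral_add_left measurable_const, lintegral_const, measure_univ, mul_one]
        congr 1
        simp_rw [lintegral_const_mul' _ _ (ENNReal.mul_ne_top h2p hC₁p)]
    _ ≤ 2 ^ (p - 1) * (C₃ * N) + 2 ^ (p - 1) * C₁ ^ p * (C₂ * W ^ p * N) :=
        add_le_add_right (mul_le_mul_right (h2 Λ f hf J) _) _
    -- The missing cross terms are added so that the bound factors.
    _ ≤ 2 ^ (p - 1) * (C₃ * N) + 2 ^ (p - 1) * C₁ ^ p * (C₂ * W ^ p * N) +
        (2 ^ (p - 1) * (C₃ * W ^ p * N) + 2 ^ (p - 1) * C₁ ^ p * (C₂ * N)) := le_self_add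
    _ = _ := by ring

/-- Monotone convergence along the truncations min(F, i), to which the bounded case applies with
constants independent of i. -/
theorem PlateBound.exists_supInt_lavg_le [Nonempty (Gr n m)] {A : ℝ≥0∞}
    (hA : PlateBound n m p α A) (hAt : A ≠ ∞) (hp : 2 ≤ p) (hR : 0 ≤ R) : ∃ C : ℝ≥0∞, C ≠ ∞ ∧
    ∀ F : E (n + 1) → ℝ≥0∞, Measurable F → (∀ x, R ≤ ‖x‖ → F x = 0) → ∀ J : ℕ,
    ∫⁻ M : Gr (n + 1) (m + 1), supInt (lavg (rad J) (lavg (rad J) F)) M ^ p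
        ∂gamma (n + 1) (m + 1) ≤
      C * (1 + (∑ j ∈ Finset.range J, weight p α j) ^ p) * ∫⁻ x, F x ^ p := by
  have hp0 : 0 < p := by linarith
  obtain ⟨C, hC, h⟩ := hA.exists_supInt_nice_le hAt hp hR
  refine ⟨C, hC, fun F hF hs J => ?_⟩
  set G : ℕ → E (n + 1) → ℝ≥0∞ := fun i x => min (F x) i with hG
  have hGm : ∀ i, Measurable (G i) := fun i => hF.min measurable_const
  have hGmono : Monotone G := fun i j hij x => min_le_min_left _ (by exact_mod_cast hij)
  have hGF : ∀ x, ⨆ i, G i x = F x := fun x => by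
    refine le_antisymm (iSup_le fun i => min_le_left _ _) (le_of_forall_lt fun a ha => ?_)
    obtain ⟨i, hi⟩ := ENNReal.exists_nat_gt ha.ne_top
    exact (lt_min ha hi).trans_le (le_iSup (fun i => G i x) i)
  have hGt : ∀ i x, G i x ≠ ∞ := fun i x =>
    ((min_le_right _ _).trans_lt (ENNReal.natCast_lt_top i)).ne
  have hGe : ∀ i, (fun x => ‖(G i x).toReal‖ₑ) = G i := fun i => by
    funext x
    rw [Real.enorm_eq_ofReal ENNReal.toReal_nonneg, ENNReal.ofReal_toReal (hGt i x)]
  have hnice : ∀ i : ℕ, Nice (i : ℝ) R fun x => (G i x).toReal := fun i =>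
    { meas := (hGm i).ennreal_toReal
      bound := fun x => by
        rw [abs_of_nonneg ENNReal.toReal_nonneg]
        refine ENNReal.toReal_le_of_le_ofReal (by positivity) ?_
        rw [ENNReal.ofReal_natCast]
        exact min_le_right _ _
      supp := fun x hx => by simp [hG, hs x hx] }
  have hbd : ∀ i, ∫⁻ M : Gr (n + 1) (m + 1), supInt (lavg (rad J) (lavg (rad J) (G i))) M ^ p
      ∂gamma (n + 1) (m + 1) ≤
      C * (1 + (∑ j ∈ Finset.range J, weight p α j) ^ p) * ∫⁻ x, F x ^ p := fun i => by
    have := h i _ (hnice i) (fun x => ENNReal.toReal_nonneg) J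
    rw [hGe i] at this
    refine this.trans (mul_le_mul_right (lintegral_mono fun x => ?_) _)
    exact ENNReal.rpow_le_rpow ((congrFun (hGe i) x).trans_le (min_le_left _ _)) hp0.le
  have hFe : lavg (rad J) (lavg (rad J) F) =
      fun x => ⨆ i, lavg (rad J) (lavg (rad J) (G i)) x := by
    have h1 : lavg (rad J) F = fun x => ⨆ i, lavg (rad J) (G i) x := by
      funext x
      rw [← iSup_lavg _ hGm hGmono]
      simp_rw [hGF]
    funext x
    rw [h1, iSup_lavg _ (fun i => measurable_lavg (rad_pos J))
      fun i j hij => lavg_mono _ (hGmono hij)]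
  have hmono : Monotone fun i => lavg (rad J) (lavg (rad J) (G i)) := fun i j hij =>
    lavg_mono _ (lavg_mono _ (hGmono hij))
  rw [hFe]
  simp_rw [iSup_supInt (fun i => measurable_lavg (rad_pos J)) hmono]
  have hsup : ∀ M : Gr (n + 1) (m + 1),
      (⨆ i, supInt (lavg (rad J) (lavg (rad J) (G i))) M) ^ p =
      ⨆ i, supInt (lavg (rad J) (lavg (rad J) (G i))) M ^ p := fun M =>
    (ENNReal.orderIsoRpow p hp0).map_iSup _
  simp_rw [hsup]
  rw [lintegral_iSup (fun i => (lowerSemicontinuous_supInt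
    (lowerSemicontinuous_lavg (rad_pos J))).measurable.pow_const p)
    fun i j hij M => ENNReal.rpow_le_rpow (supInt_mono (hmono hij) M) hp0.le]
  exact iSup_le hbd

end KeyEstimate

/-! ### Plate averages are controlled by plane integrals of double averages. -/

section PlateAverage

variable {d k : ℕ}

/-- For u within r/2 of x, the ball of radius r about u contains the ball of radius r/2 about x. The
factor 2^d is the ratio of the two volumes. -/
theorem setLIntegral_ball_le_lavg_lavg {r : ℝ} (hr : 0 < r) (F : E d → ℝ≥0∞) (x : E d) :
    ∫⁻ u in Metric.ball x (r / 2), F u ≤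
      2 ^ d * volume (Metric.ball (0 : E d) r) * lavg r (lavg r F) x := by
  set V := volume (Metric.ball (0 : E d) r) with hV
  have hV0 : V ≠ 0 := (Metric.measure_ball_pos _ _ hr).ne'
  have hVt : V ≠ ∞ := measure_ball_lt_top.ne
  have hhalf : 2 ^ d * volume (Metric.ball x (r / 2)) = V := by
    rw [hV, volume_ball_eq _ hr, volume_ball_eq _ (half_pos hr), ← mul_assoc, ← mul_pow]
    congr 2
    rw [show (2 : ℝ≥0∞) = ENNReal.ofReal 2 by simp, ← ENNReal.ofReal_mul zero_le_two]
    congr 1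
    ring
  have h1 : ∀ u ∈ Metric.ball x (r / 2), ∫⁻ u in Metric.ball x (r / 2), F u ≤ V * lavg r F u := by
    intro u hu
    rw [lavg_eq, ← mul_assoc, ENNReal.mul_inv_cancel hV0 hVt, one_mul]
    refine lintegral_mono_set (Metric.ball_subset_ball' ?_)
    rw [dist_comm]
    linarith [Metric.mem_ball.1 hu]
  have h2 : volume (Metric.ball x (r / 2)) * ∫⁻ u in Metric.ball x (r / 2), F u ≤
      V * (V * lavg r (lavg r F) x) := by
    calc _ = ∫⁻ _ in Metric.ball x (r / 2), ∫⁻ u in Metric.ball x (r / 2), F u := by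
          rw [setLIntegral_const, mul_comm]
      _ ≤ ∫⁻ u in Metric.ball x (r / 2), V * lavg r F u :=
          setLIntegral_mono' Metric.isOpen_ball.measurableSet h1
      _ ≤ ∫⁻ u in Metric.ball x r, V * lavg r F u :=
          lintegral_mono_set (Metric.ball_subset_ball (by linarith))
      _ = _ := by
          rw [lintegral_const_mul' _ _ hVt, lavg_eq r (lavg r F), ← mul_assoc V V⁻¹,
            ENNReal.mul_inv_cancel hV0 hVt, one_mul]
  have h3 : V * ∫⁻ u in Metric.ball x (r / 2), F u ≤
      V * (2 ^ d * V * lavg r (lavg r F) x) := by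
    calc V * ∫⁻ u in Metric.ball x (r / 2), F u
        = 2 ^ d * (volume (Metric.ball x (r / 2)) * ∫⁻ u in Metric.ball x (r / 2), F u) := by
          rw [← mul_assoc, hhalf]
      _ ≤ 2 ^ d * (V * (V * lavg r (lavg r F) x)) := mul_le_mul_right h2 _
      _ = _ := by ring
  exact (ENNReal.mul_le_mul_iff_right hV0 hVt).1 h3

/-- A point u of the plate is within δ of some point of the plane, hence within 2δ ≤ r/2 of a whole
δ-ball of its points. Integrating over the plane the integrals of F over r/2-balls therefore counts
u with weight at least a constant times δ^k. -/
theorem setLIntegral_plate_le_supInt {δ r : ℝ} (hδ : 0 < δ) (hr : 4 * δ ≤ r) {F : E d → ℝ≥0∞}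
    (hF : Measurable F) (L : Gr d k) (a : E d) :
    ENNReal.ofReal δ ^ k * unitVol k * ∫⁻ u in plate δ L a, F u ≤
      2 ^ d * volume (Metric.ball (0 : E d) r) * supInt (lavg r (lavg r F)) L := by
  have hr0 : 0 < r := by linarith
  obtain ⟨U, hU⟩ := exists_isometry L
  have hpt : ∀ u, (plate δ L a).indicator (fun u => ENNReal.ofReal δ ^ k * unitVol k * F u) u ≤
      F u * volume {v : E k | ‖u - a - U v‖ < r / 2} := by
    intro u
    by_cases hu : u ∈ plate δ L a
    swap
    · rw [indicator_of_notMem hu]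
      exact zero_le
    rw [indicator_of_mem hu]
    obtain ⟨v₀, -, hv₀⟩ := (mem_plate_iff hU).1 hu
    rw [mul_comm, ← volume_ball_eq v₀ hδ]
    refine mul_le_mul_right (measure_mono fun v hv => ?_) _
    rw [mem_ball_iff_norm, ← U.norm_map, map_sub] at hv
    change ‖u - a - U v‖ < r / 2
    calc ‖u - a - U v‖ = ‖(u - a - U v₀) - (U v - U v₀)‖ := by congr 1; abel
      _ ≤ ‖u - a - U v₀‖ + ‖U v - U v₀‖ := norm_sub_le _ _
      _ < r / 2 := by linarith
  calc _ = ∫⁻ u, (plate δ L a).indicator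
        (fun u => ENNReal.ofReal δ ^ k * unitVol k * F u) u := by
        rw [lintegral_indicator isOpen_plate.measurableSet, lintegral_const_mul _ hF]
    _ ≤ ∫⁻ u, F u * volume {v : E k | ‖u - a - U v‖ < r / 2} := lintegral_mono hpt
    _ = ∫⁻ v : E k, ∫⁻ w in Metric.ball (0 : E d) (r / 2), F (a + U v + w) :=
        (lintegral_lintegral_ball U a _ hF).symm
    _ ≤ ∫⁻ v : E k, 2 ^ d * volume (Metric.ball (0 : E d) r) *
          lavg r (lavg r F) (a + U v) := by
        refine lintegral_mono fun v => ?_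
        refine le_trans (le_of_eq ?_) (setLIntegral_ball_le_lavg_lavg hr0 F (a + U v))
        rw [← lintegral_indicator Metric.isOpen_ball.measurableSet,
          ← lintegral_indicator Metric.isOpen_ball.measurableSet,
          ← lintegral_add_left_eq_self ((Metric.ball (a + U v) (r / 2)).indicator F) (a + U v)]
        refine lintegral_congr fun w => ?_
        have : a + U v + w ∈ Metric.ball (a + U v) (r / 2) ↔
            w ∈ Metric.ball (0 : E d) (r / 2) := by
          rw [mem_ball_iff_norm, mem_ball_iff_norm, add_sub_cancel_left, sub_zero]
        by_cases hw : w ∈ Metric.ball (0 : E d) (r / 2)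
        · rw [indicator_of_mem hw, indicator_of_mem (this.2 hw)]
        · rw [indicator_of_notMem hw, indicator_of_notMem (fun h => hw (this.1 h))]
    _ ≤ _ := by
        rw [lintegral_const_mul' _ _ (ENNReal.mul_ne_top (by simp) measure_ball_lt_top.ne),
          supInt_eq hU]
        exact mul_le_mul_right (le_iSup (fun x => ∫⁻ v, lavg r (lavg r F) (x + U v)) a) _

theorem exists_supAvg_le_supInt (d k : ℕ) : ∃ C : ℝ≥0∞, C ≠ ∞ ∧ ∀ δ r : ℝ, 0 < δ → 4 * δ ≤ r →
    r ≤ 8 * δ → ∀ F : E d → ℝ≥0∞, Measurable F → ∀ L : Gr d k,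
    supAvg δ F L ≤ C * supInt (lavg r (lavg r F)) L := by
  obtain ⟨C, hC, h⟩ := exists_le_volume_plate d k
  refine ⟨(unitVol k)⁻¹ * (C * (2 ^ d * (8 ^ d * unitVol d))), ?_,
    fun δ r hδ hr hr' F hF L => iSup_le fun a => ?_⟩
  · exact ENNReal.mul_ne_top (ENNReal.inv_ne_top.2 (unitVol_pos k)) (ENNReal.mul_ne_top hC
      (ENNReal.mul_ne_top (by simp) (ENNReal.mul_ne_top (by simp) (unitVol_ne_top d))))
  have hr0 : 0 < r := by linarith
  set S := supInt (lavg r (lavg r F)) L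
  set P := volume (plate δ L a) with hP
  set I := ∫⁻ u in plate δ L a, F u
  set e := ENNReal.ofReal δ with he
  have hP0 : P ≠ 0 := (volume_plate_pos hδ L a).ne'
  have hPt : P ≠ ∞ := ((measure_mono plate_subset_ball).trans_lt measure_ball_lt_top).ne
  have hk0 : e ^ k ≠ 0 := ofReal_pow_ne_zero hδ k
  have hkt : e ^ k ≠ ∞ := ofReal_pow_ne_top δ k
  have hV : volume (Metric.ball (0 : E d) r) ≤ 8 ^ d * unitVol d * (C * e ^ k * P) := by
    calc volume (Metric.ball (0 : E d) r) ≤ volume (Metric.ball (0 : E d) (8 * δ)) :=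
          measure_mono (Metric.ball_subset_ball hr')
      _ = 8 ^ d * unitVol d * e ^ d := by
          rw [volume_ball_eq _ (by positivity), ENNReal.ofReal_mul (by norm_num), mul_pow]
          simp only [ENNReal.ofReal_ofNat]
          ring
      _ ≤ _ := mul_le_mul_right (h δ hδ L a) _
  have h1 : e ^ k * (unitVol k * I) ≤
      e ^ k * (P * (C * (2 ^ d * (8 ^ d * unitVol d)) * S)) := by
    calc e ^ k * (unitVol k * I) = e ^ k * unitVol k * I := by ring
      _ ≤ 2 ^ d * volume (Metric.ball (0 : E d) r) * S :=
          setLIntegral_plate_le_supInt hδ hr hF L a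
      _ ≤ 2 ^ d * (8 ^ d * unitVol d * (C * e ^ k * P)) * S := by gcongr
      _ = _ := by ring
  have h2 := (ENNReal.mul_le_mul_iff_right hk0 hkt).1 h1
  calc P⁻¹ * I = (unitVol k)⁻¹ * (P⁻¹ * (unitVol k * I)) := by
        rw [mul_left_comm P⁻¹, ← mul_assoc,
          ENNReal.inv_mul_cancel (unitVol_pos k) (unitVol_ne_top k), one_mul]
    _ ≤ (unitVol k)⁻¹ * (C * (2 ^ d * (8 ^ d * unitVol d)) * S) :=
        mul_le_mul_right ((ENNReal.inv_mul_le_iff hP0 hPt).2 h2) _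
    _ = _ := (mul_assoc _ _ _).symm

/-- Plates of width bounded below have volume bounded below, so Hölder suffices. -/
theorem exists_supAvg_rpow_le (d k : ℕ) (R : ℝ) {p : ℝ} (hp : 1 < p) {δ₀ : ℝ} (hδ₀ : 0 < δ₀) :
    ∃ C : ℝ≥0∞, C ≠ ∞ ∧ ∀ δ : ℝ, δ₀ ≤ δ → δ < 1 → ∀ F : E d → ℝ≥0∞, Measurable F →
    (∀ x, R ≤ ‖x‖ → F x = 0) → ∀ L : Gr d k,
    supAvg δ F L ^ p ≤ C * ∫⁻ x, F x ^ p := by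
  have hp0 : 0 < p := by linarith
  set V := volume (Metric.ball (0 : E d) δ₀) with hV
  have hVt : V⁻¹ ≠ ∞ := ENNReal.inv_ne_top.2 (Metric.measure_ball_pos _ _ hδ₀).ne'
  refine ⟨V⁻¹ ^ p * volume (Metric.ball (0 : E d) R) ^ (p - 1), ?_,
    fun δ hδ hδ1 F hF hs L => ?_⟩
  · exact ENNReal.mul_ne_top (ENNReal.rpow_ne_top_of_nonneg hp0.le hVt)
      (ENNReal.rpow_ne_top_of_nonneg (by linarith) measure_ball_lt_top.ne)
  have h1 : supAvg δ F L ≤ V⁻¹ * ∫⁻ x, F x := by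
    refine iSup_le fun a => mul_le_mul' (ENNReal.inv_le_inv.2 ?_) (setLIntegral_le_lintegral _ _)
    calc V = volume (Metric.ball a δ₀) := (Measure.addHaar_ball_center _ _ _).symm
      _ ≤ _ := measure_mono ((Metric.ball_subset_ball hδ).trans ball_subset_plate)
  calc _ ≤ (V⁻¹ * ∫⁻ x, F x) ^ p := ENNReal.rpow_le_rpow h1 hp0.le
    _ = V⁻¹ ^ p * (∫⁻ x, F x) ^ p := ENNReal.mul_rpow_of_nonneg _ _ hp0.le
    _ ≤ V⁻¹ ^ p * (_ * _) := mul_le_mul_right (rpow_setLIntegral_ball_le d _ hp hF hs) _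
    _ = _ := (mul_assoc _ _ _).symm

end PlateAverage

/-! ### The sum of the weights in the three ranges of α. -/

section Weights

variable {p α : ℝ}

theorem exists_rad {δ : ℝ} (h0 : 0 < δ) (h1 : δ < 1 / 8) :
    ∃ J, 4 * δ ≤ rad J ∧ rad J ≤ 8 * δ := by
  obtain ⟨J, h2, h3⟩ := exists_nat_pow_near_of_lt_one (show 0 < 8 * δ by linarith)
    (show 8 * δ ≤ 1 by linarith) (show (0 : ℝ) < 1 / 2 by norm_num) (by norm_num)
  refine ⟨J, ?_, h2.le⟩
  rw [rad, pow_succ]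
  linarith

theorem exists_sum_weight_le_of_one_lt (hp : 0 < p) (hα : 1 < α) : ∃ K : ℝ≥0∞, K ≠ ∞ ∧
    ∀ δ : ℝ, 0 < δ → ∀ J, δ ≤ rad J →
    ∑ j ∈ Finset.range J, weight p α j ≤ K * ENNReal.ofReal (δ ^ (-(α - 1) / p)) := by
  set s := (α - 1) / p with hs
  have hs0 : 0 < s := div_pos (by linarith) hp
  have hexp : -(α - 1) / p = -s := neg_div _ _
  set b : ℝ := 2 ^ s with hb
  have hb1 : 1 < b := Real.one_lt_rpow one_lt_two hs0
  -- K solves K + b = Kb, which makes the induction over J close exactly.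
  set K := b / (b - 1) with hK
  have hbpos : 0 < b - 1 := by linarith
  have hK0 : 0 ≤ K := by positivity
  have hq : ∀ j, rad (j + 1) ^ (-s) = b * rad j ^ (-s) := fun j => by
    rw [← two_mul_rad j, Real.mul_rpow zero_le_two (rad_pos _).le, hb, ← mul_assoc,
      ← Real.rpow_add two_pos, add_neg_cancel, Real.rpow_zero, one_mul]
  have hsum : ∀ J, ∑ j ∈ Finset.range J, rad (j + 1) ^ (-s) ≤ K * rad J ^ (-s) := fun J => by
    induction J with
    | zero => simpa using mul_nonneg hK0 (Real.rpow_nonneg (rad_pos 0).le _)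
    | succ J ih =>
      rw [Finset.sum_range_succ]
      refine (add_le_add_left ih _).trans_eq ?_
      rw [hq J, hK]
      field_simp
      ring
  refine ⟨ENNReal.ofReal K, ENNReal.ofReal_ne_top, fun δ hδ J hJ => ?_⟩
  unfold weight
  rw [hexp, ← ENNReal.ofReal_sum_of_nonneg fun j _ => Real.rpow_nonneg (rad_pos _).le _]
  rw [← ENNReal.ofReal_mul hK0]
  refine ENNReal.ofReal_le_ofReal ((hsum J).trans (mul_le_mul_of_nonneg_left ?_ hK0))
  exact Real.rpow_le_rpow_of_nonpos hδ hJ (by linarith)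

/-- All weights are 1, so the sum is J. From δ ≤ 2^(-(J+1)) one gets (J+1) log 2 ≤ log(1/δ), and log
2 > 1/2. -/
theorem sum_weight_le_log {δ : ℝ} (hδ : 0 < δ) {J : ℕ} (hJ : δ ≤ rad J) :
    ∑ j ∈ Finset.range J, weight p 1 j ≤ 2 * ENNReal.ofReal (Real.log (1 / δ)) := by
  have h1 : ∀ j, weight p 1 j = 1 := fun j => by simp [weight]
  simp only [h1, Finset.sum_const, Finset.card_range, nsmul_eq_mul, mul_one]
  rw [show (2 : ℝ≥0∞) = ENNReal.ofReal 2 by simp, ← ENNReal.ofReal_mul zero_le_two,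
    ← ENNReal.ofReal_natCast]
  refine ENNReal.ofReal_le_ofReal ?_
  have h2 : Real.log δ ≤ -((J + 1) * Real.log 2) := by
    calc Real.log δ ≤ Real.log (rad J) := Real.log_le_log hδ hJ
      _ = _ := by
        rw [rad, Real.log_pow, one_div, Real.log_inv]
        push_cast
        ring
  have h3 := Real.log_two_gt_d9
  rw [one_div, Real.log_inv]
  have h4 : (0 : ℝ) ≤ J := Nat.cast_nonneg _
  nlinarith

theorem exists_sum_weight_le_of_lt_one (hp : 0 < p) (hα : α < 1) : ∃ K : ℝ≥0∞, K ≠ ∞ ∧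
    ∀ J, ∑ j ∈ Finset.range J, weight p α j ≤ K := by
  set s := -(α - 1) / p with hs
  have hs0 : 0 < s := div_pos (by linarith) hp
  set q : ℝ := (1 / 2) ^ s with hq
  have hq0 : 0 < q := by positivity
  have hq1 : q < 1 := Real.rpow_lt_one (by norm_num) (by norm_num) hs0
  refine ⟨(1 - ENNReal.ofReal q)⁻¹, ?_, fun J => ?_⟩
  · refine ENNReal.inv_ne_top.2 (tsub_pos_of_lt ?_).ne'
    rwa [ENNReal.ofReal_lt_one]
  · rw [← ENNReal.tsum_geometric]
    refine le_trans (Finset.sum_le_sum fun j _ => ?_) (ENNReal.sum_le_tsum _)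
    rw [weight, ← ENNReal.ofReal_pow hq0.le, hq, ← Real.rpow_mul_natCast (by norm_num),
      mul_comm, Real.rpow_natCast_mul (by norm_num)]
    refine ENNReal.ofReal_le_ofReal (Real.rpow_le_rpow (rad_pos _).le ?_ hs0.le)
    exact pow_le_pow_of_le_one (by norm_num) (by norm_num) (by omega)

end Weights

/-! ### Reduction to functions supported in a fixed ball. -/

section Localization

variable {d k : ℕ}

/-- A point of the lattice `ℤ^d`. -/
noncomputable def latticePt (m : Fin d → ℤ) : E d := WithLp.toLp 2 fun i => (m i : ℝ)

theorem exists_norm_sub_latticePt_le (a : E d) : ∃ m, ‖a - latticePt m‖ ≤ d := by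
  refine ⟨fun i => round (a i), ?_⟩
  rw [EuclideanSpace.norm_eq, Real.sqrt_le_iff]
  refine ⟨Nat.cast_nonneg _, ?_⟩
  calc ∑ i, ‖(a - latticePt fun i => round (a i)) i‖ ^ 2 ≤ ∑ _i : Fin d, (1 : ℝ) := by
        refine Finset.sum_le_sum fun i _ => ?_
        have h := abs_sub_round (a i)
        have : ‖(a - latticePt fun i => round (a i)) i‖ ≤ 1 := by
          change |a i - (round (a i) : ℝ)| ≤ 1
          linarith
        exact pow_le_one₀ (norm_nonneg _) this
    _ = d := by simp
    _ ≤ (d : ℝ) ^ 2 := by exact_mod_cast Nat.le_self_pow two_ne_zero d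

/-- The restriction of `F` to a ball about a lattice point, translated to the origin. -/
noncomputable def localize (F : E d → ℝ≥0∞) (m : Fin d → ℤ) (x : E d) : ℝ≥0∞ :=
  (Metric.ball (0 : E d) (d + 2)).indicator (fun x => F (x + latticePt m)) x

theorem measurable_localize {F : E d → ℝ≥0∞} (hF : Measurable F) (m : Fin d → ℤ) :
    Measurable (localize F m) :=
  (hF.comp (measurable_add_const _)).indicator Metric.isOpen_ball.measurableSet

theorem localize_eq_zero (F : E d → ℝ≥0∞) (m : Fin d → ℤ) (x : E d) (hx : (d : ℝ) + 2 ≤ ‖x‖) :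
    localize F m x = 0 := by
  rw [localize, indicator_of_notMem]
  simpa using hx

/-- A plate has radius less than 3/2 about its centre, and the centre is within d of a lattice
point, so one ball of radius d + 2 contains the whole plate. -/
theorem supAvg_le_iSup_localize {δ : ℝ} (hδ : δ < 1) (F : E d → ℝ≥0∞) (L : Gr d k) :
    supAvg δ F L ≤ ⨆ m, supAvg δ (localize F m) L := by
  refine iSup_le fun a => ?_
  obtain ⟨m, hm⟩ := exists_norm_sub_latticePt_le a
  refine le_trans ?_ (le_iSup (fun m => supAvg δ (localize F m) L) m)
  refine le_trans (le_of_eq ?_) (le_iSup (fun a => (volume (plate δ L a))⁻¹ *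
    ∫⁻ y in plate δ L a, localize F m y) (a - latticePt m))
  rw [volume_plate_eq δ L L a (a - latticePt m)]
  congr 1
  rw [← lintegral_indicator isOpen_plate.measurableSet,
    ← lintegral_indicator isOpen_plate.measurableSet,
    ← lintegral_add_right_eq_self ((plate δ L a).indicator F) (latticePt m)]
  refine lintegral_congr fun x => ?_
  have hmem : x + latticePt m ∈ plate δ L a ↔ x ∈ plate δ L (a - latticePt m) := by
    rw [mem_plate, mem_plate]
    simp only [sub_sub_eq_add_sub, sub_sub]
  by_cases hx : x ∈ plate δ L (a - latticePt m)
  · rw [indicator_of_mem hx, indicator_of_mem (hmem.2 hx), localize, indicator_of_mem]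
    have h1 := mem_ball_iff_norm.1 (plate_subset_ball hx)
    rw [mem_ball_zero_iff]
    calc ‖x‖ = ‖(x - (a - latticePt m)) + (a - latticePt m)‖ := by congr 1; abel
      _ ≤ ‖x - (a - latticePt m)‖ + ‖a - latticePt m‖ := norm_add_le _ _
      _ < d + 2 := by linarith
  · rw [indicator_of_notMem hx, indicator_of_notMem (fun h => hx (hmem.1 h))]

/-- Bounded overlap: in each coordinate at most 2d + 6 integers are near enough to that of x. -/
theorem tsum_indicator_ball_le (x : E d) (c : ℝ≥0∞) :
    ∑' m : Fin d → ℤ, (Metric.ball (latticePt m) ((d : ℝ) + 2)).indicator (fun _ => c) x ≤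
      ((2 * d + 6) ^ d : ℕ) * c := by
  set T : Finset (Fin d → ℤ) := Fintype.piFinset fun i =>
    Finset.Icc (⌊x i⌋ - (d + 2)) (⌊x i⌋ + (d + 3)) with hT
  have hcard : T.card = (2 * d + 6) ^ d := by
    rw [hT, Fintype.card_piFinset]
    simp only [Int.card_Icc]
    rw [Finset.prod_congr rfl (g := fun _ => 2 * d + 6) fun i _ => by omega]
    simp
  have hsub : ∀ m, m ∉ T → (Metric.ball (latticePt m) ((d : ℝ) + 2)).indicator (fun _ => c) x = 0 := by
    intro m hm
    refine indicator_of_notMem (fun hx => hm ?_) _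
    rw [hT, Fintype.mem_piFinset]
    intro i
    rw [mem_ball_iff_norm] at hx
    have h1 : |x i - (m i : ℝ)| < d + 2 := lt_of_le_of_lt (PiLp.norm_apply_le (x - latticePt m) i) hx
    rw [abs_lt] at h1
    have h2 := Int.floor_le (x i)
    have h3 := Int.lt_floor_add_one (x i)
    rw [Finset.mem_Icc]
    constructor
    · have : ((⌊x i⌋ - (d + 2) : ℤ) : ℝ) ≤ (m i : ℝ) := by push_cast; linarith
      exact_mod_cast this
    · have : (m i : ℝ) ≤ ((⌊x i⌋ + (d + 3) : ℤ) : ℝ) := by push_cast; linarith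
      exact_mod_cast this
  rw [tsum_eq_sum hsub]
  refine (Finset.sum_le_card_nsmul T _ c fun m _ => indicator_le_self' (fun _ _ => by simp) x).trans_eq ?_
  rw [hcard, nsmul_eq_mul]

theorem tsum_lintegral_localize_le {F : E d → ℝ≥0∞} (hF : Measurable F) {p : ℝ} (hp : 0 < p) :
    ∑' m, ∫⁻ x, localize F m x ^ p ≤ ((2 * d + 6) ^ d : ℕ) * ∫⁻ x, F x ^ p := by
  have h1 : ∀ m, ∫⁻ x, localize F m x ^ p =
      ∫⁻ x, (Metric.ball (latticePt m) ((d : ℝ) + 2)).indicator (fun x => F x ^ p) x := by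
    intro m
    rw [← lintegral_add_right_eq_self ((Metric.ball (latticePt m) ((d : ℝ) + 2)).indicator
      fun x => F x ^ p) (latticePt m)]
    refine lintegral_congr fun x => ?_
    have hmem : x + latticePt m ∈ Metric.ball (latticePt m) ((d : ℝ) + 2) ↔
        x ∈ Metric.ball (0 : E d) (d + 2) := by
      rw [mem_ball_iff_norm, add_sub_cancel_right, mem_ball_zero_iff]
    by_cases hx : x ∈ Metric.ball (0 : E d) (d + 2)
    · rw [localize, indicator_of_mem hx, indicator_of_mem (hmem.2 hx)]
    · rw [localize, indicator_of_notMem hx, indicator_of_notMem (fun h => hx (hmem.1 h)),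
        ENNReal.zero_rpow_of_pos hp]
  simp_rw [h1]
  rw [← lintegral_tsum fun m =>
    ((hF.pow_const p).indicator Metric.isOpen_ball.measurableSet).aemeasurable,
    ← lintegral_const_mul _ (hF.pow_const p)]
  refine lintegral_mono fun x => ?_
  refine le_trans (le_of_eq ?_) (tsum_indicator_ball_le x (F x ^ p))
  refine tsum_congr fun m => ?_
  simp only [indicator]

end Localization

/-! ### The L^p bound for the plate maximal function. -/

section PlateEstimate

variable {n m : ℕ} {p α : ℝ}

/-- For δ < 1/8 the radius `rad J` is chosen between 4δ and 8δ. For larger δ the trivial bound is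
enough, and J = 0 makes the sum empty. -/
theorem PlateBound.exists_supAvg_local_le [Nonempty (Gr n m)] {A : ℝ≥0∞}
    (hA : PlateBound n m p α A) (hAt : A ≠ ∞) (hp : 2 ≤ p) {R : ℝ} (hR : 0 ≤ R) :
    ∃ C : ℝ≥0∞, C ≠ ∞ ∧ ∀ δ : ℝ, 0 < δ → δ < 1 → ∃ J, (J = 0 ∨ δ ≤ rad J) ∧
    ∀ F : E (n + 1) → ℝ≥0∞, Measurable F → (∀ x, R ≤ ‖x‖ → F x = 0) →
    ∫⁻ M : Gr (n + 1) (m + 1), supAvg δ F M ^ p ∂gamma (n + 1) (m + 1) ≤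
      C * (1 + ∑ j ∈ Finset.range J, weight p α j) ^ p * ∫⁻ x, F x ^ p := by
  have hp0 : 0 < p := by linarith
  have hne : Nonempty (Gr (n + 1) (m + 1)) := ‹Nonempty (Gr n m)›.map lift
  obtain ⟨C₁, hC₁, h1⟩ := exists_supAvg_le_supInt (n + 1) (m + 1)
  obtain ⟨C₂, hC₂, h2⟩ := hA.exists_supInt_lavg_le hAt hp hR
  obtain ⟨C₃, hC₃, h3⟩ := exists_supAvg_rpow_le (n + 1) (m + 1) R (p := p) (by linarith)
    (show (0 : ℝ) < 1 / 8 by norm_num)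
  have hC₁p : C₁ ^ p ≠ ∞ := ENNReal.rpow_ne_top_of_nonneg hp0.le hC₁
  refine ⟨C₁ ^ p * C₂ + C₃, ENNReal.add_ne_top.2 ⟨ENNReal.mul_ne_top hC₁p hC₂, hC₃⟩,
    fun δ hδ hδ1 => ?_⟩
  rcases lt_or_ge δ (1 / 8) with hsmall | hbig
  · obtain ⟨J, hJ1, hJ2⟩ := exists_rad hδ hsmall
    refine ⟨J, Or.inr (by linarith), fun F hF hs => ?_⟩
    set W := ∑ j ∈ Finset.range J, weight p α j
    calc ∫⁻ M : Gr (n + 1) (m + 1), supAvg δ F M ^ p ∂gamma (n + 1) (m + 1)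
        ≤ ∫⁻ M : Gr (n + 1) (m + 1), C₁ ^ p * supInt (lavg (rad J) (lavg (rad J) F)) M ^ p
          ∂gamma (n + 1) (m + 1) := by
          refine lintegral_mono fun M => ?_
          rw [← ENNReal.mul_rpow_of_nonneg _ _ hp0.le]
          exact ENNReal.rpow_le_rpow (h1 δ _ hδ hJ1 hJ2 F hF M) hp0.le
      _ ≤ C₁ ^ p * (C₂ * (1 + W ^ p) * ∫⁻ x, F x ^ p) := by
          rw [lintegral_const_mul' _ _ hC₁p]
          exact mul_le_mul_right (h2 F hF hs J) _
      _ = C₁ ^ p * C₂ * (1 ^ p + W ^ p) * ∫⁻ x, F x ^ p := by rw [ENNReal.one_rpow]; ring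
      _ ≤ _ := by
          refine mul_le_mul_left (mul_le_mul' le_self_add ?_) _
          exact ENNReal.add_rpow_le_rpow_add _ _ (by linarith)
  · refine ⟨0, Or.inl rfl, fun F hF hs => ?_⟩
    calc _ ≤ ∫⁻ _ : Gr (n + 1) (m + 1), (C₃ * ∫⁻ x, F x ^ p) ∂gamma (n + 1) (m + 1) :=
          lintegral_mono fun M => h3 δ hbig hδ1 F hF hs M
      _ = C₃ * ∫⁻ x, F x ^ p := by rw [lintegral_const, measure_univ, mul_one]
      _ ≤ _ := by
          rw [Finset.sum_range_zero, add_zero, ENNReal.one_rpow, mul_one]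
          exact mul_le_mul_left le_add_self _

/-- The supremum over the localized pieces is bounded by their ℓ^p sum, and bounded overlap adds up
the p-th powers of their norms. -/
theorem PlateBound.exists_supAvg_le [Nonempty (Gr n m)] {A : ℝ≥0∞}
    (hA : PlateBound n m p α A) (hAt : A ≠ ∞) (hp : 2 ≤ p) :
    ∃ C : ℝ≥0∞, C ≠ ∞ ∧ ∀ δ : ℝ, 0 < δ → δ < 1 → ∃ J, (J = 0 ∨ δ ≤ rad J) ∧
    ∀ F : E (n + 1) → ℝ≥0∞, Measurable F →
    ∫⁻ M : Gr (n + 1) (m + 1), supAvg δ F M ^ p ∂gamma (n + 1) (m + 1) ≤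
      C * (1 + ∑ j ∈ Finset.range J, weight p α j) ^ p * ∫⁻ x, F x ^ p := by
  have hp0 : 0 < p := by linarith
  obtain ⟨C, hC, h⟩ := hA.exists_supAvg_local_le hAt hp
    (R := ((n + 1 : ℕ) : ℝ) + 2) (by positivity)
  refine ⟨((2 * (n + 1) + 6) ^ (n + 1) : ℕ) * C,
    ENNReal.mul_ne_top (ENNReal.natCast_ne_top _) hC, fun δ hδ hδ1 => ?_⟩
  obtain ⟨J, hJ, hb⟩ := h δ hδ hδ1
  refine ⟨J, hJ, fun F hF => ?_⟩
  set W := ∑ j ∈ Finset.range J, weight p α j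
  calc ∫⁻ M : Gr (n + 1) (m + 1), supAvg δ F M ^ p ∂gamma (n + 1) (m + 1)
      ≤ ∫⁻ M : Gr (n + 1) (m + 1), ∑' i, supAvg δ (localize F i) M ^ p
        ∂gamma (n + 1) (m + 1) := by
        refine lintegral_mono fun M => ?_
        refine (ENNReal.rpow_le_rpow (supAvg_le_iSup_localize hδ1 F M) hp0.le).trans ?_
        have hsup : (⨆ i, supAvg δ (localize F i) M) ^ p = ⨆ i, supAvg δ (localize F i) M ^ p :=
          (ENNReal.orderIsoRpow p hp0).map_iSup _
        rw [hsup]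
        exact iSup_le fun i => ENNReal.le_tsum (f := fun i => supAvg δ (localize F i) M ^ p) i
    _ = ∑' i, ∫⁻ M : Gr (n + 1) (m + 1), supAvg δ (localize F i) M ^ p
        ∂gamma (n + 1) (m + 1) :=
        lintegral_tsum fun i =>
          ((lowerSemicontinuous_supAvg hδ _).measurable.pow_const p).aemeasurable
    _ ≤ ∑' i, C * (1 + W) ^ p * ∫⁻ x, localize F i x ^ p :=
        ENNReal.tsum_le_tsum fun i =>
          hb _ (measurable_localize hF i) (localize_eq_zero F i)
    _ ≤ C * (1 + W) ^ p * (((2 * (n + 1) + 6) ^ (n + 1) : ℕ) * ∫⁻ x, F x ^ p) := by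
        rw [ENNReal.tsum_mul_left]
        exact mul_le_mul_right (tsum_lintegral_localize_le hF hp0) _
    _ = _ := by ring

end PlateEstimate

/-! ### L^p norms as integrals of p-th powers. -/

section LpNorm

theorem eLpNorm_rpow_eq {X ε : Type*} [MeasurableSpace X] [ENorm ε] {p : ℝ} (hp : 0 < p)
    (f : X → ε) (μ : Measure X) :
    eLpNorm f (ENNReal.ofReal p) μ ^ p = ∫⁻ x, ‖f x‖ₑ ^ p ∂μ := by
  rw [eLpNorm_eq_lintegral_rpow_enorm_toReal (ENNReal.ofReal_pos.2 hp).ne' ENNReal.ofReal_ne_top,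
    ENNReal.toReal_ofReal hp.le, ← ENNReal.rpow_mul, one_div_mul_cancel hp.ne', ENNReal.rpow_one]

end LpNorm

/-! ### Passage to the limit r → 0 for lower semicontinuous functions. -/

section LowerSemicontinuousBound

variable {d k n m : ℕ} {p α : ℝ}

theorem le_lavg {r : ℝ} (hr : 0 < r) {G : E d → ℝ≥0∞} {c : ℝ≥0∞} {x : E d}
    (h : ∀ y, ‖y - x‖ < r → c ≤ G y) : c ≤ lavg r G x := by
  have := isProbabilityMeasure_unif d hr
  calc c = ∫⁻ _, c ∂unif d r := by rw [lintegral_const, measure_univ, mul_one]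
    _ ≤ _ := by
      refine lintegral_mono_ae ?_
      filter_upwards [ae_unif d r] with z hz
      exact h _ (by rwa [add_sub_cancel_left])

theorem tendsto_rad : Tendsto rad atTop (𝓝 0) :=
  (tendsto_pow_atTop_nhds_zero_of_lt_one (by norm_num) (by norm_num)).comp (tendsto_add_atTop_nat 1)

/-- Below G x, any level is exceeded by G on a neighbourhood of x, hence reached by all averages at
small enough scales. This holds at every x, not just almost everywhere, so it may be integrated over
planes. -/
theorem le_liminf_lavg {G : E d → ℝ≥0∞} (hG : LowerSemicontinuous G) (x : E d) :
    G x ≤ liminf (fun J => lavg (rad J) (lavg (rad J) G) x) atTop := by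
  refine le_of_forall_lt fun c hc => ?_
  obtain ⟨c', hc', hc''⟩ := exists_between hc
  refine hc'.trans_le (le_liminf_of_le (by isBoundedDefault) ?_)
  obtain ⟨ε, hε, hball⟩ := Metric.eventually_nhds_iff.1 (hG x c' hc'')
  filter_upwards [tendsto_rad.eventually_lt_const (half_pos hε)] with J hJ
  refine le_lavg (rad_pos J) fun y hy => le_lavg (rad_pos J) fun z hz => (hball ?_).le
  rw [dist_eq_norm]
  calc ‖z - x‖ = ‖(z - y) + (y - x)‖ := by congr 1; abel
    _ ≤ ‖z - y‖ + ‖y - x‖ := norm_add_le _ _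
    _ < ε := by linarith

theorem supInt_le_liminf {G : E d → ℝ≥0∞} (hG : LowerSemicontinuous G) (L : Gr d k) :
    supInt G L ≤ liminf (fun J => supInt (lavg (rad J) (lavg (rad J) G)) L) atTop := by
  refine iSup_le fun x => ?_
  calc ∫⁻ y : L.1, G (x + (y : E d)) ∂leb L
      ≤ ∫⁻ y : L.1, liminf (fun J => lavg (rad J) (lavg (rad J) G) (x + (y : E d))) atTop
        ∂leb L := lintegral_mono fun y => le_liminf_lavg hG _
    _ ≤ liminf (fun J => ∫⁻ y : L.1, lavg (rad J) (lavg (rad J) G) (x + (y : E d)) ∂leb L) atTop :=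
        lintegral_liminf_le fun J => (measurable_lavg (rad_pos J)).comp (by fun_prop)
    _ ≤ _ := liminf_le_liminf (Eventually.of_forall fun J =>
        le_iSup (fun x : E d => ∫⁻ y : L.1, lavg (rad J) (lavg (rad J) G) (x + (y : E d)) ∂leb L) x)

/-- For α < 1 the bounds at scale `rad J` are uniform in J, so Fatou on the Grassmannian applies. -/
theorem PlateBound.exists_supInt_le [Nonempty (Gr n m)] {A : ℝ≥0∞}
    (hA : PlateBound n m p α A) (hAt : A ≠ ∞) (hp : 2 ≤ p) (hα : α < 1) {R : ℝ} (hR : 0 ≤ R) :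
    ∃ C : ℝ≥0∞, C ≠ ∞ ∧ ∀ G : E (n + 1) → ℝ≥0∞, LowerSemicontinuous G →
    (∀ x, R ≤ ‖x‖ → G x = 0) →
    ∫⁻ M : Gr (n + 1) (m + 1), supInt G M ^ p ∂gamma (n + 1) (m + 1) ≤
      C * ∫⁻ x, G x ^ p := by
  have hp0 : 0 < p := by linarith
  obtain ⟨C, hC, h⟩ := hA.exists_supInt_lavg_le hAt hp hR
  obtain ⟨K, hK, hW⟩ := exists_sum_weight_le_of_lt_one hp0 hα
  refine ⟨C * (1 + K ^ p), ENNReal.mul_ne_top hC (ENNReal.add_ne_top.2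
    ⟨ENNReal.one_ne_top, ENNReal.rpow_ne_top_of_nonneg hp0.le hK⟩), fun G hG hs => ?_⟩
  calc ∫⁻ M : Gr (n + 1) (m + 1), supInt G M ^ p ∂gamma (n + 1) (m + 1)
      ≤ ∫⁻ M : Gr (n + 1) (m + 1),
        liminf (fun J => supInt (lavg (rad J) (lavg (rad J) G)) M ^ p) atTop
        ∂gamma (n + 1) (m + 1) := by
        refine lintegral_mono fun M => ?_
        refine (ENNReal.rpow_le_rpow (supInt_le_liminf hG M) hp0.le).trans_eq ?_
        exact (ENNReal.orderIsoRpow p hp0).liminf_apply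
    _ ≤ liminf (fun J => ∫⁻ M : Gr (n + 1) (m + 1),
        supInt (lavg (rad J) (lavg (rad J) G)) M ^ p ∂gamma (n + 1) (m + 1)) atTop :=
        lintegral_liminf_le fun J => (lowerSemicontinuous_supInt
          (lowerSemicontinuous_lavg (rad_pos J))).measurable.pow_const p
    _ ≤ _ := by
        refine liminf_le_of_frequently_le' (Frequently.of_forall fun J => ?_)
        refine (h G hG.measurable hs J).trans ?_
        have := hW J
        gcongr

theorem lowerSemicontinuous_indicator {X : Type*} [TopologicalSpace X] {S : Set X} (hS : IsOpen S)
    {g : X → ℝ≥0∞} (hg : LowerSemicontinuous g) : LowerSemicontinuous (S.indicator g) := by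
  rw [lowerSemicontinuous_iff_isOpen_preimage]
  intro c
  have : S.indicator g ⁻¹' Ioi c = S ∩ g ⁻¹' Ioi c := by
    ext x
    by_cases hx : x ∈ S <;> simp [hx]
  rw [this]
  exact hS.inter (hg.isOpen_preimage c)

/-- The Vitali–Carathéodory theorem for |f|^p, followed by a p-th root; cutting off to an open ball
preserves lower semicontinuity. -/
theorem exists_lowerSemicontinuous_majorant (hp : 0 < p) {R : ℝ} {f : E d → ℝ}
    (hf : AEMeasurable f) (hs : ∀ x, R ≤ ‖x‖ → f x = 0) {ε : ℝ≥0∞} (hε : ε ≠ 0) :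
    ∃ G : E d → ℝ≥0∞, LowerSemicontinuous G ∧ (∀ x, R ≤ ‖x‖ → G x = 0) ∧
      (∀ x, ‖f x‖ₑ ≤ G x) ∧ ∫⁻ x, G x ^ p ≤ (∫⁻ x, ‖f x‖ₑ ^ p) + ε := by
  obtain ⟨g, hg1, hg2, hg3⟩ := exists_lt_lowerSemicontinuous_lintegral_ge_of_aemeasurable volume
    (fun x => ‖f x‖₊ ^ p) (hf.nnnorm.pow_const p) hε
  have hcoe : ∀ x, ((‖f x‖₊ ^ p : ℝ≥0) : ℝ≥0∞) = ‖f x‖ₑ ^ p := fun x => by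
    rw [ENNReal.coe_rpow_of_nonneg _ hp.le]
    rfl
  simp_rw [hcoe] at hg1 hg3
  have hgl : LowerSemicontinuous fun x => g x ^ (1 / p) :=
    ENNReal.continuous_rpow_const.comp_lowerSemicontinuous hg2
      (ENNReal.monotone_rpow_of_nonneg (by positivity))
  refine ⟨(Metric.ball 0 R).indicator fun x => g x ^ (1 / p),
    lowerSemicontinuous_indicator Metric.isOpen_ball hgl, fun x hx => ?_, fun x => ?_, ?_⟩
  · exact indicator_of_notMem (by simpa using hx) _
  · by_cases hx : x ∈ Metric.ball (0 : E d) R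
    · rw [indicator_of_mem hx, one_div, ENNReal.le_rpow_inv_iff hp]
      exact (hg1 x).le
    · rw [hs x (by simpa using hx), enorm_zero]
      exact zero_le
  · refine (lintegral_mono fun x => ?_).trans hg3
    by_cases hx : x ∈ Metric.ball (0 : E d) R
    · rw [indicator_of_mem hx, ← ENNReal.rpow_mul, one_div_mul_cancel hp.ne', ENNReal.rpow_one]
    · rw [indicator_of_notMem hx, ENNReal.zero_rpow_of_pos hp]
      exact zero_le

end LowerSemicontinuousBound

/-! ### The maximal function over planes: bound and measurability. -/

section Planes

variable {n m : ℕ} {p α : ℝ}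

theorem exists_lintegral_maxN_le {R : ℝ} (hp : 0 < p) {C : ℝ≥0∞} (hC : C ≠ ∞)
    (h : ∀ G : E n → ℝ≥0∞, LowerSemicontinuous G → (∀ x, R ≤ ‖x‖ → G x = 0) →
      ∫⁻ M : Gr n m, supInt G M ^ p ∂gamma n m ≤ C * ∫⁻ x, G x ^ p)
    {f : E n → ℝ} (hf : AEMeasurable f) (hs : ∀ x, R ≤ ‖x‖ → f x = 0) :
    ∫⁻ M : Gr n m, maxN f M ^ p ∂gamma n m ≤ (C + 1) * ∫⁻ x, ‖f x‖ₑ ^ p := by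
  have hC1 : C + 1 ≠ ∞ := ENNReal.add_ne_top.2 ⟨hC, ENNReal.one_ne_top⟩
  refine ENNReal.le_of_forall_pos_le_add fun ε hε _ => ?_
  -- Dividing by C + 1 rather than C also covers C = 0.
  obtain ⟨G, hG, hGs, hfG, hle⟩ := exists_lowerSemicontinuous_majorant hp hf hs
    (ε := (ε : ℝ≥0∞) / (C + 1)) (ENNReal.div_pos (by exact_mod_cast hε.ne') hC1).ne'
  calc ∫⁻ M : Gr n m, maxN f M ^ p ∂gamma n m ≤ ∫⁻ M : Gr n m, supInt G M ^ p ∂gamma n m :=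
        lintegral_mono fun M => ENNReal.rpow_le_rpow (supInt_mono hfG M) hp.le
    _ ≤ C * ∫⁻ x, G x ^ p := h G hG hGs
    _ ≤ (C + 1) * ((∫⁻ x, ‖f x‖ₑ ^ p) + ε / (C + 1)) := mul_le_mul' le_self_add hle
    _ ≤ _ := by
        rw [mul_add]
        exact add_le_add_right ENNReal.mul_div_le _

/-- A continuous g close to f in L^p is cut off to the open ball; H is its absolute value and G a
majorant of the error. The two pointwise inequalities hold everywhere, so they survive integration
over planes. -/
theorem exists_lowerSemicontinuous_approx {R : ℝ} (hp : 1 ≤ p)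
    {f : E n → ℝ} (hf : MemLp f (ENNReal.ofReal p)) (hs : ∀ x, R ≤ ‖x‖ → f x = 0)
    {ε : ℝ≥0∞} (hε : ε ≠ 0) :
    ∃ (H : E n → ℝ≥0∞) (G : E n → ℝ≥0∞), LowerSemicontinuous H ∧ LowerSemicontinuous G ∧
      (∀ x, R ≤ ‖x‖ → G x = 0) ∧ (∀ x, ‖f x‖ₑ ≤ H x + G x) ∧ (∀ x, H x ≤ ‖f x‖ₑ + G x) ∧
      ∫⁻ x, G x ^ p ≤ 2 * ε := by
  have hp0 : 0 < p := by linarith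
  obtain ⟨g, -, hg1, hg2, hg3⟩ := hf.exists_hasCompactSupport_eLpNorm_sub_le ENNReal.ofReal_ne_top
    (ε := ε ^ (1 / p)) (fun h0 => (ENNReal.rpow_eq_zero_iff.1 h0).elim (fun h0 => hε h0.1)
      fun h0 => h0.2.not_ge (by positivity))
  set h : E n → ℝ := (Metric.ball 0 R).indicator g with hh
  have hfh : ∀ x, ‖f x - h x‖ₑ ≤ ‖(f - g) x‖ₑ := by
    intro x
    by_cases hx : x ∈ Metric.ball (0 : E n) R
    · rw [hh, indicator_of_mem hx]; rfl
    · rw [hh, indicator_of_notMem hx, hs x (by simpa using hx), sub_zero, enorm_zero]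
      exact zero_le
  have hsupp : ∀ x, R ≤ ‖x‖ → f x - h x = 0 := fun x hx => by
    rw [hs x hx, hh, indicator_of_notMem (by simpa using hx), sub_zero]
  have hhm : Measurable h := hg2.measurable.indicator Metric.isOpen_ball.measurableSet
  obtain ⟨G, hG, hGs, hle, hint⟩ := exists_lowerSemicontinuous_majorant hp0
    (hf.aestronglyMeasurable.aemeasurable.sub hhm.aemeasurable) hsupp hε
  refine ⟨fun x => ‖h x‖ₑ, G, ?_, hG, hGs, fun x => ?_, fun x => ?_, ?_⟩
  · have : (fun x => ‖h x‖ₑ) = (Metric.ball 0 R).indicator fun x => ‖g x‖ₑ := by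
      funext x
      by_cases hx : x ∈ Metric.ball (0 : E n) R
      · rw [hh, indicator_of_mem hx, indicator_of_mem hx]
      · rw [hh, indicator_of_notMem hx, indicator_of_notMem hx, enorm_zero]
    rw [this]
    exact lowerSemicontinuous_indicator Metric.isOpen_ball hg2.enorm.lowerSemicontinuous
  · calc ‖f x‖ₑ = ‖h x + (f x - h x)‖ₑ := by congr 1; ring
      _ ≤ ‖h x‖ₑ + ‖f x - h x‖ₑ := enorm_add_le _ _
      _ ≤ _ := add_le_add_right (hle x) _
  · calc ‖h x‖ₑ = ‖f x - (f x - h x)‖ₑ := by congr 1; ring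
      _ ≤ ‖f x‖ₑ + ‖f x - h x‖ₑ := enorm_sub_le
      _ ≤ _ := add_le_add_right (hle x) _
  · refine hint.trans ?_
    rw [two_mul]
    refine add_le_add_left ?_ _
    calc ∫⁻ x, ‖f x - h x‖ₑ ^ p ≤ ∫⁻ x, ‖(f - g) x‖ₑ ^ p :=
          lintegral_mono fun x => ENNReal.rpow_le_rpow (hfh x) hp0.le
      _ = eLpNorm (f - g) (ENNReal.ofReal p) volume ^ p := (eLpNorm_rpow_eq hp0 _ _).symm
      _ ≤ (ε ^ (1 / p)) ^ p := ENNReal.rpow_le_rpow hg1 hp0.le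
      _ = ε := by rw [← ENNReal.rpow_mul, one_div_mul_cancel hp0.ne', ENNReal.rpow_one]

/-- With errors 2^(-i), the p-th powers of `supInt (G i)` have summable integrals, so these
functions tend to 0 almost everywhere. The measurable functions `supInt (H i)` differ from `maxN f`
by at most that much, hence converge to it. -/
theorem aemeasurable_maxN {R : ℝ} (hp : 1 ≤ p) {C : ℝ≥0∞} (hC : C ≠ ∞)
    (h : ∀ G : E n → ℝ≥0∞, LowerSemicontinuous G → (∀ x, R ≤ ‖x‖ → G x = 0) →
      ∫⁻ M : Gr n m, supInt G M ^ p ∂gamma n m ≤ C * ∫⁻ x, G x ^ p)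
    {f : E n → ℝ} (hf : MemLp f (ENNReal.ofReal p)) (hs : ∀ x, R ≤ ‖x‖ → f x = 0) :
    AEMeasurable (maxN f) (gamma n m) := by
  have hp0 : 0 < p := by linarith
  choose H G hH hG hGs hfH hHf hint using fun i : ℕ =>
    exists_lowerSemicontinuous_approx hp hf hs (ε := 2⁻¹ ^ i) (by simp)
  have hHm : ∀ i, Measurable (supInt (H i) : Gr n m → ℝ≥0∞) := fun i =>
    (lowerSemicontinuous_supInt (hH i)).measurable
  have hGm : ∀ i, Measurable (supInt (G i) : Gr n m → ℝ≥0∞) := fun i =>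
    (lowerSemicontinuous_supInt (hG i)).measurable
  refine aemeasurable_of_tendsto_metrizable_ae atTop (fun i => (hHm i).aemeasurable) ?_
  have hsum : ∫⁻ M : Gr n m, ∑' i, supInt (G i) M ^ p ∂gamma n m ≠ ∞ := by
    rw [lintegral_tsum fun i => ((hGm i).pow_const p).aemeasurable]
    refine ne_top_of_le_ne_top (b := ∑' i : ℕ, C * (2 * 2⁻¹ ^ i)) ?_
      (ENNReal.tsum_le_tsum fun i => (h (G i) (hG i) (hGs i)).trans (mul_le_mul_right (hint i) _))
    rw [ENNReal.tsum_mul_left, ENNReal.tsum_mul_left, ENNReal.tsum_geometric,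
      ENNReal.one_sub_inv_two, inv_inv]
    exact ENNReal.mul_ne_top hC (by norm_num)
  filter_upwards [ae_lt_top (Measurable.tsum fun i => (hGm i).pow_const p) hsum] with M hM
  have h0 : Tendsto (fun i => supInt (G i) M) atTop (𝓝 0) := by
    have h1 := ENNReal.tendsto_atTop_zero_of_tsum_ne_top hM.ne
    have h2 := (ENNReal.continuous_rpow_const (y := 1 / p)).tendsto 0 |>.comp h1
    rw [ENNReal.zero_rpow_of_pos (by positivity)] at h2
    refine h2.congr fun i => ?_
    simp only [Function.comp]
    rw [← ENNReal.rpow_mul, mul_one_div_cancel hp0.ne', ENNReal.rpow_one]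
  have hup : Tendsto (fun i => maxN f M + supInt (G i) M) atTop (𝓝 (maxN f M)) := by
    simpa using (tendsto_const_nhds (x := maxN f M)).add h0
  have hlow : Tendsto (fun i => maxN f M - supInt (G i) M) atTop (𝓝 (maxN f M)) := by
    simpa using ENNReal.Tendsto.sub (tendsto_const_nhds (x := maxN f M)) h0 (Or.inr (by simp))
  refine tendsto_of_tendsto_of_tendsto_of_le_of_le hlow hup (fun i => ?_) fun i => ?_
  · exact tsub_le_iff_right.2
      ((supInt_mono (hfH i) M).trans (supInt_add_le (hG i).measurable M))
  · exact (supInt_mono (hHf i) M).trans (supInt_add_le (hG i).measurable M)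

end Planes

/-! ### Translation between norms and integrals of p-th powers. -/

section Reformulation

variable {d k n m : ℕ} {p α : ℝ}

theorem Nice.memLp {Λ R : ℝ} {f : E d → ℝ} (hf : Nice Λ R f) (q : ℝ≥0∞) : MemLp f q := by
  have h1 : (Metric.ball (0 : E d) R).indicator f = f := by
    funext x
    by_cases hx : x ∈ Metric.ball (0 : E d) R
    · exact indicator_of_mem hx f
    · rw [indicator_of_notMem hx, hf.supp x (by simpa using hx)]
  have hfin : IsFiniteMeasure (volume.restrict (Metric.ball (0 : E d) R)) :=
    ⟨by simpa using measure_ball_lt_top⟩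
  rw [← h1, memLp_indicator_iff_restrict Metric.isOpen_ball.measurableSet]
  exact MemLp.of_bound hf.meas.aestronglyMeasurable Λ
    (ae_of_all _ fun x => (Real.norm_eq_abs _).trans_le (hf.bound x))

theorem eLpNorm_le_of_rpow_le {X Y ε ε' : Type*} [MeasurableSpace X] [MeasurableSpace Y]
    [ENorm ε] [ENorm ε'] {μ : Measure X} {ν : Measure Y} (hp : 0 < p) {f : X → ε} {g : Y → ε'}
    {C : ℝ≥0∞} (h : ∫⁻ x, ‖f x‖ₑ ^ p ∂μ ≤ C ^ p * ∫⁻ y, ‖g y‖ₑ ^ p ∂ν) :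
    eLpNorm f (ENNReal.ofReal p) μ ≤ C * eLpNorm g (ENNReal.ofReal p) ν := by
  rw [← ENNReal.rpow_le_rpow_iff hp, ENNReal.mul_rpow_of_nonneg _ _ hp.le, eLpNorm_rpow_eq hp,
    eLpNorm_rpow_eq hp]
  exact h

theorem plateBound_of_eLpNorm_le (hp : 0 < p) {A : ℝ≥0∞}
    (h : ∀ δ : ℝ, 0 < δ → δ < 1 → ∀ f : E n → ℝ, MemLp f (ENNReal.ofReal p) volume →
      eLpNorm (maxM (k := m) δ f) (ENNReal.ofReal p) (gamma n m) ≤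
        A * ENNReal.ofReal (δ ^ (-α / p)) * eLpNorm f (ENNReal.ofReal p) volume) :
    PlateBound n m p α (A ^ p) := by
  intro δ hδ hδ1 Λ R f hf
  have h1 := ENNReal.rpow_le_rpow (h δ hδ hδ1 f (hf.memLp _)) hp.le
  rw [ENNReal.mul_rpow_of_nonneg _ _ hp.le, ENNReal.mul_rpow_of_nonneg _ _ hp.le,
    eLpNorm_rpow_eq hp, eLpNorm_rpow_eq hp, ENNReal.ofReal_rpow_of_nonneg (by positivity) hp.le,
    ← Real.rpow_mul hδ.le, div_mul_cancel₀ _ hp.ne'] at h1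
  exact h1

/-- Plate averages ignore null sets, so f may be replaced by a measurable representative. -/
theorem maxM_congr (δ : ℝ) {f g : E d → ℝ} (h : f =ᵐ[volume] g) :
    (maxM δ f : Gr d k → ℝ≥0∞) = maxM δ g := by
  funext L
  unfold maxM
  congr 1
  funext a
  congr 1
  exact lintegral_congr_ae (ae_restrict_of_ae (h.fun_comp fun t => ‖t‖ₑ))

theorem PlateBound.exists_eLpNorm_maxM_le [Nonempty (Gr n m)] {A : ℝ≥0∞}
    (hA : PlateBound n m p α A) (hAt : A ≠ ∞) (hp : 2 ≤ p) :
    ∃ C : ℝ≥0∞, C ≠ ∞ ∧ ∀ δ : ℝ, 0 < δ → δ < 1 → ∃ J, (J = 0 ∨ δ ≤ rad J) ∧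
    ∀ f : E (n + 1) → ℝ, MemLp f (ENNReal.ofReal p) volume →
    eLpNorm (maxM (k := m + 1) δ f) (ENNReal.ofReal p) (gamma (n + 1) (m + 1)) ≤
      C * (1 + ∑ j ∈ Finset.range J, weight p α j) * eLpNorm f (ENNReal.ofReal p) volume := by
  have hp0 : 0 < p := by linarith
  obtain ⟨C, hC, h⟩ := hA.exists_supAvg_le hAt hp
  refine ⟨C ^ (1 / p), ENNReal.rpow_ne_top_of_nonneg (by positivity) hC, fun δ hδ hδ1 => ?_⟩
  obtain ⟨J, hJ, hb⟩ := h δ hδ hδ1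
  refine ⟨J, hJ, fun f hf => ?_⟩
  have hfm := hf.aestronglyMeasurable
  rw [maxM_congr δ hfm.ae_eq_mk, eLpNorm_congr_ae hfm.ae_eq_mk]
  refine eLpNorm_le_of_rpow_le hp0 ?_
  rw [ENNReal.mul_rpow_of_nonneg _ _ hp0.le, ← ENNReal.rpow_mul, one_div_mul_cancel hp0.ne',
    ENNReal.rpow_one]
  exact hb _ hfm.stronglyMeasurable_mk.measurable.enorm

end Reformulation

end KPlane

/-! ### The three ranges of α. -/

theorem mainTheorem5 (d k : ℕ) (hk : 2 ≤ k) (hkd : k ≤ d) (p : ℝ) (hp : 2 ≤ p) (α : ℝ)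
    (hbound : ∃ A : ℝ≥0, ∀ δ : ℝ, 0 < δ → δ < 1 → ∀ f : KPlane.E (d - 1) → ℝ,
      MemLp f (ENNReal.ofReal p) volume →
        eLpNorm (KPlane.maxM (k := k - 1) δ f) (ENNReal.ofReal p) (KPlane.gamma (d - 1) (k - 1)) ≤
          A * ENNReal.ofReal (δ ^ (-α / p)) * eLpNorm f (ENNReal.ofReal p) volume) :
    (1 < α → ∃ C : ℝ≥0, ∀ δ : ℝ, 0 < δ → δ < 1 → ∀ f : KPlane.E d → ℝ,
      MemLp f (ENNReal.ofReal p) volume →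
        eLpNorm (KPlane.maxM (k := k) δ f) (ENNReal.ofReal p) (KPlane.gamma d k) ≤
          C * ENNReal.ofReal (δ ^ (-(α - 1) / p)) * eLpNorm f (ENNReal.ofReal p) volume) ∧
    (α = 1 → ∃ C : ℝ≥0, ∀ δ : ℝ, 0 < δ → δ < 1 → ∀ f : KPlane.E d → ℝ,
      MemLp f (ENNReal.ofReal p) volume →
        eLpNorm (KPlane.maxM (k := k) δ f) (ENNReal.ofReal p) (KPlane.gamma d k) ≤
          C * ENNReal.ofReal (1 + Real.log (1 / δ)) * eLpNorm f (ENNReal.ofReal p) volume) ∧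
    (α < 1 → ∃ C : ℝ≥0, ∀ f : KPlane.E d → ℝ,
      MemLp f (ENNReal.ofReal p) volume → Function.support f ⊆ Metric.closedBall 0 1 →
        AEMeasurable (KPlane.maxN (k := k) f) (KPlane.gamma d k) ∧
        eLpNorm (KPlane.maxN (k := k) f) (ENNReal.ofReal p) (KPlane.gamma d k) ≤
          C * eLpNorm f (ENNReal.ofReal p) volume) := by
  obtain ⟨n, rfl⟩ : ∃ n, d = n + 1 := ⟨d - 1, by omega⟩
  obtain ⟨m, rfl⟩ : ∃ m, k = m + 1 := ⟨k - 1, by omega⟩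
  obtain ⟨A, hA⟩ := hbound
  have hp0 : 0 < p := by linarith
  have hne : Nonempty (KPlane.Gr n m) := KPlane.nonempty_gr (by omega)
  have hB := KPlane.plateBound_of_eLpNorm_le (n := n) (m := m) hp0 hA
  have hAt : (A : ℝ≥0∞) ^ p ≠ ∞ := ENNReal.rpow_ne_top_of_nonneg hp0.le ENNReal.coe_ne_top
  refine ⟨fun hα => ?_, ?_, fun hα => ?_⟩
  · obtain ⟨C, hC, h⟩ := hB.exists_eLpNorm_maxM_le hAt hp
    obtain ⟨K, hK, hW⟩ := KPlane.exists_sum_weight_le_of_one_lt hp0 hα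
    have hC' : C * (1 + K) ≠ ∞ :=
      ENNReal.mul_ne_top hC (ENNReal.add_ne_top.2 ⟨ENNReal.one_ne_top, hK⟩)
    refine ⟨(C * (1 + K)).toNNReal, fun δ hδ hδ1 f hf => ?_⟩
    obtain ⟨J, hJ, hb⟩ := h δ hδ hδ1
    rw [ENNReal.coe_toNNReal hC']
    refine (hb f hf).trans (mul_le_mul_left ?_ _)
    rw [mul_assoc, add_mul, one_mul]
    refine mul_le_mul_right (add_le_add ?_ ?_) _
    -- For α > 1 the power of δ is at least 1 and absorbs the contribution of the coarsest scale.
    · rw [← ENNReal.ofReal_one]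
      exact ENNReal.ofReal_le_ofReal (Real.one_le_rpow_of_pos_of_le_one_of_nonpos hδ hδ1.le
        (div_nonpos_of_nonpos_of_nonneg (by linarith) hp0.le))
    · rcases hJ with rfl | hJ
      · simp
      · exact hW δ hδ J hJ
  · rintro rfl
    obtain ⟨C, hC, h⟩ := hB.exists_eLpNorm_maxM_le hAt hp
    have hC' : C * 2 ≠ ∞ := ENNReal.mul_ne_top hC (by norm_num)
    refine ⟨(C * 2).toNNReal, fun δ hδ hδ1 f hf => ?_⟩
    obtain ⟨J, hJ, hb⟩ := h δ hδ hδ1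
    rw [ENNReal.coe_toNNReal hC']
    refine (hb f hf).trans (mul_le_mul_left ?_ _)
    have hlog : 0 ≤ Real.log (1 / δ) := Real.log_nonneg ((one_le_div hδ).2 hδ1.le)
    rw [mul_assoc, ENNReal.ofReal_add zero_le_one hlog, ENNReal.ofReal_one, mul_add 2, mul_one]
    refine mul_le_mul_right (add_le_add (show (1 : ℝ≥0∞) ≤ 2 from one_le_two) ?_) _
    rcases hJ with rfl | hJ
    · simp
    · exact KPlane.sum_weight_le_log hδ hJ
  -- Functions here must vanish where |x| ≥ R, so the closed unit ball requires some R > 1; R = 2 is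
  -- taken.
  · obtain ⟨C, hC, h⟩ := hB.exists_supInt_le hAt hp hα zero_le_two
    have hC1 : C + 1 ≠ ∞ := ENNReal.add_ne_top.2 ⟨hC, ENNReal.one_ne_top⟩
    have hC' : (C + 1) ^ (1 / p) ≠ ∞ := ENNReal.rpow_ne_top_of_nonneg (by positivity) hC1
    refine ⟨((C + 1) ^ (1 / p)).toNNReal, fun f hf hsupp => ?_⟩
    have hs : ∀ x, 2 ≤ ‖x‖ → f x = 0 := fun x hx => by
      by_contra hne
      have := mem_closedBall_zero_iff.1 (hsupp hne)
      linarith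
    refine ⟨KPlane.aemeasurable_maxN (by linarith) hC h hf hs, ?_⟩
    rw [ENNReal.coe_toNNReal hC']
    refine KPlane.eLpNorm_le_of_rpow_le hp0 ?_
    rw [← ENNReal.rpow_mul, one_div_mul_cancel hp0.ne', ENNReal.rpow_one]
    exact KPlane.exists_lintegral_maxN_le hp0 hC h hf.aestronglyMeasurable.aemeasurable hs
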